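/- A \emph{network} is a finite connected undirected graph $G=(V,E)$ (representing the symmetric directed graph with both arcs $(u,v),(v,u)$ for every edge) with sets $C\subseteq F\subseteq V$ of customer and facility locations. A set $X\subseteq V$ is a \emph{UPDFL cover} of $C$ if for every $c\in C\setminus X$ there are $f_1,f_2\in X\setminus\{c\}$ and (simple, not necessarily shortest) paths from $c$ to $f_1$ and from $c$ to $f_2$ whose only common vertex is $c$. It is a \emph{PDFL cover} with respect to given real arc weights if these paths can moreover be chosen to be shortest. A UPDFL cover $X\subseteq F$ is \emph{optimal} if it has minimum size among the UPDFL covers contained in $F$. For a connected graph $H$, a vertex is an \emph{articulation point} if deleting it leaves at least two connected components, and a \emph{leaf} if it has degree 1. A graph is \emph{2-connected} if it is connected, has at least three vertices and has no articulation point; a \emph{2-connected component} of $H$ is a maximal vertex set inducing a 2-connected subgraph. Its \emph{internal vertices} are those of its vertices that are not articulation points of $H$, and it is a \emph{leaf component} if it contains exactly one articulation point of $H$. The graph $t(H)$ has as vertices the leaves and articulation points of $H$ and a new vertex $v_B$ for every 2-connected component $B$; its edges are the edges of $H$ that do not join two vertices of one 2-connected component, and the pairs $\{u,v_B\}$ with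 $u$ an articulation point contained in $B$. \emph{Pruning} starts with the graph $G$ and repeats the following steps in any order until none applies: delete a leaf of the current graph that is not a customer; or, if no internal vertex of some leaf component of the current graph is a customer, delete all internal vertices of that component. Call any resulting graph $G^*$. The following hold. (1) If the network is 2-connected, then any two distinct facility locations form a UPDFL cover of $C$. (2) If $H$ is a finite connected graph with at least two vertices, then $t(H)$ is a tree. (3) If $C=\emptyset$, then $\emptyset$ is an optimal UPDFL cover. If $C\ne\emptyset$, then the pruning process has a result $G^*$, and every such result contains all customers, all its leaves are customers, and each of its leaf components has an internal vertex that is a customer. Moreover: (a) if $G^*$ has no leaf and no leaf component, then $\{v\}$ is an optimal UPDFL cover of the network if $C=\{v\}$, and $\{u,v\}$ is an optimal UPDFL cover for any two distinct customers $u,v$ if $|C|\ge 2$; (b) if $G^*$ has a leaf or a leaf component, then every set consisting of all the leaves of $G^*$ and one internal customer of each leaf component of $G^*$ is an optimal UPDFL cover of the network. (4) For all real arc weights, the size of an optimal UPDFL cover is at most the size of every PDFL cover contained in $F$. (5) An optimal UPDFL cover and its size (hence the lower bound of (4)) can be computed in linear time: there are a fixed random access machine program, with registers and arrays of natural numbers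 and unit-cost operations (copying, array access, comparison, adding or subtracting one, branching and loops), and a constant $K$, such that on every network with $n$ vertices and $m$ edges, given by $n$, adjacency lists in any order and the indicator arrays of $C$ and $F$, the program halts after at most $K(n+m)$ steps with the indicator array of an optimal UPDFL cover and its size as output. -/

import Mathlib

namespace FacilityLocation

/-! ### Covers by vertex-disjoint paths

A network is a finite connected simple graph `G` (a symmetric directed graph: its arcs are
the darts of `G`) with sets `C ⊆ F` of customer and facility locations. -/

section Covers

variable {V : Type*} {G : SimpleGraph V}

/-- The pair `{f₁, f₂}` of locations other than `c` covers `c` when there are admissible paths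
from `c` to `f₁` and from `c` to `f₂` that have no common vertex except `c`. Here `P c f` is the
set of admissible paths from `c` to `f`. -/
def CoversCustomer (P : ∀ c f : V, Set (G.Walk c f)) (c f₁ f₂ : V) : Prop :=
  f₁ ≠ c ∧ f₂ ≠ c ∧ ∃ p₁ ∈ P c f₁, ∃ p₂ ∈ P c f₂,
    ∀ x, x ∈ p₁.support → x ∈ p₂.support → x = c

/-- `X` is a cover for `C`: every customer outside `X` is covered by a pair from `X`
(customers in `X` cover themselves). -/
def IsCover (P : ∀ c f : V, Set (G.Walk c f)) (C X : Set V) : Prop :=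
  ∀ c ∈ C, c ∉ X → ∃ f₁ ∈ X, ∃ f₂ ∈ X, CoversCustomer P c f₁ f₂

/-- `X ⊆ F` is a cover for `C` of minimum size among all covers contained in `F`. -/
def IsOptimalCover (P : ∀ c f : V, Set (G.Walk c f)) (C F X : Set V) : Prop :=
  X ⊆ F ∧ IsCover P C X ∧ ∀ Y : Set V, Y ⊆ F → IsCover P C Y → X.ncard ≤ Y.ncard

/-- The admissible paths of UPDFL: all (simple) paths. -/
def allPaths (G : SimpleGraph V) (c f : V) : Set (G.Walk c f) :=
  {p | p.IsPath}

/-- The length of a walk with respect to the arc weights `w`. -/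
def walkLength (w : G.Dart → ℝ) {c f : V} (p : G.Walk c f) : ℝ :=
  (p.darts.map w).sum

/-- The admissible paths of PDFL: the shortest paths with respect to the arc weights `w`. -/
def shortestPaths (w : G.Dart → ℝ) (c f : V) : Set (G.Walk c f) :=
  {p | p.IsPath ∧ ∀ q : G.Walk c f, q.IsPath → walkLength w p ≤ walkLength w q}

end Covers

/-! ### 2-connected components and pruning

The graphs that occur are induced subgraphs `G[S]` of one graph `G`, so all notions below are
stated for a vertex set `S` of `G`; for `S = Set.univ` they are those of `G` itself. -/

section Blocks

variable {V : Type*}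

/-- `v` is an articulation point of the connected graph `G[S]`: deleting `v` leaves at least
two connected components. -/
def IsArticulation (G : SimpleGraph V) (S : Set V) (v : V) : Prop :=
  v ∈ S ∧ ¬ (G.induce (S \ {v})).Preconnected

/-- `G[S]` is 2-connected: connected, with at least three vertices and no articulation point. -/
def TwoConnected (G : SimpleGraph V) (S : Set V) : Prop :=
  (G.induce S).Connected ∧ 3 ≤ S.ncard ∧ ∀ v, ¬ IsArticulation G S v

/-- `B` is (the vertex set of) a 2-connected component of `G[S]`: a maximal 2-connected set. -/
def IsBlock (G : SimpleGraph V) (S B : Set V) : Prop :=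
  Maximal (fun A : Set V => A ⊆ S ∧ TwoConnected G A) B

/-- `v` is a leaf of `G[S]`: a vertex of degree one. -/
def IsLeaf (G : SimpleGraph V) (S : Set V) (v : V) : Prop :=
  v ∈ S ∧ (G.neighborSet v ∩ S).ncard = 1

/-- `B` is a leaf component of `G[S]`: a 2-connected component of `G[S]` that contains exactly
one articulation point of `G[S]`. -/
def IsLeafBlock (G : SimpleGraph V) (S B : Set V) : Prop :=
  IsBlock G S B ∧ ∃! a, a ∈ B ∧ IsArticulation G S a

/-- The internal vertices of a 2-connected component `B` of `G[S]`. -/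
def internalVertices (G : SimpleGraph V) (S B : Set V) : Set V :=
  {v | v ∈ B ∧ ¬ IsArticulation G S v}

/-- The tree structure `t(G[S])`. Its vertices are the leaves and the articulation points of
`G[S]` together with a new vertex for each 2-connected component. Its edges are the edges of
`G[S]` that do not connect two vertices of one 2-connected component, together with an edge
between an articulation point and each 2-connected component containing it. -/
def blockTree (G : SimpleGraph V) (S : Set V) :
    SimpleGraph ({v : V // IsLeaf G S v ∨ IsArticulation G S v} ⊕ {B : Set V // IsBlock G S B}) :=
  SimpleGraph.fromRel fun x y =>
    match x, y with
    | Sum.inl u, Sum.inl v =>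
        G.Adj u.1 v.1 ∧ ¬ ∃ B : Set V, IsBlock G S B ∧ u.1 ∈ B ∧ v.1 ∈ B
    | Sum.inl u, Sum.inr B => IsArticulation G S u.1 ∧ u.1 ∈ B.1
    | Sum.inr _, _ => False

/-- One pruning step from `G[S]` to `G[S']`: delete a leaf that is not a customer, or delete all
internal vertices of a leaf component none of whose internal vertices is a customer. -/
def PruneStep (G : SimpleGraph V) (C S S' : Set V) : Prop :=
  (∃ v, IsLeaf G S v ∧ v ∉ C ∧ S' = S \ {v}) ∨
  (∃ B, IsLeafBlock G S B ∧ Disjoint (internalVertices G S B) C ∧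
    S' = S \ internalVertices G S B)

/-- `G[S]` is a possible result of the pruning process, started at `G` and carried on until no
pruning step applies. -/
def IsPruned (G : SimpleGraph V) (C S : Set V) : Prop :=
  Relation.ReflTransGen (PruneStep G C) Set.univ S ∧ ∀ S', ¬ PruneStep G C S S'

end Blocks

/-! ### Random access machines

Programs work on registers and on arrays of natural numbers, every operation having unit cost.
The only arithmetic is adding or subtracting one, so that a number can grow by at most one per
step beyond the input and the fixed literals: a run of linear length on a graph with `n` vertices
and `m` edges uses only numbers of `O(log (n + m))` bits. -/

/-- The contents of the registers, `reg x`, and of the arrays, `arr a i`. -/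
structure Memory where
  reg : ℕ → ℕ
  arr : ℕ → ℕ → ℕ

/-- Expressions: literals, registers, array cells, successor, truncated predecessor, and
comparisons with value `1` (true) or `0` (false). -/
inductive Expr where
  | lit (k : ℕ)
  | var (x : ℕ)
  | cell (a : ℕ) (i : Expr)
  | succ (e : Expr)
  | pred (e : Expr)
  | lt (e e' : Expr)
  | eq (e e' : Expr)

/-- The value of an expression. -/
def Expr.eval (s : Memory) : Expr → ℕ
  | .lit k => k
  | .var x => s.reg x
  | .cell a i => s.arr a (i.eval s)
  | .succ e => e.eval s + 1
  | .pred e => e.eval s - 1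
  | .lt e e' => if e.eval s < e'.eval s then 1 else 0
  | .eq e e' => if e.eval s = e'.eval s then 1 else 0

/-- The number of operations in the evaluation of an expression. -/
def Expr.cost : Expr → ℕ
  | .lit _ => 1
  | .var _ => 1
  | .cell _ i => i.cost + 1
  | .succ e => e.cost + 1
  | .pred e => e.cost + 1
  | .lt e e' => e.cost + e'.cost + 1
  | .eq e e' => e.cost + e'.cost + 1

/-- Programs: `x := e`, `a[i] := e`, sequencing, branching and loops (a condition holds when its
value is not `0`). A program mentions finitely many registers and arrays. -/
inductive Program where
  | skip
  | assign (x : ℕ) (e : Expr)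
  | store (a : ℕ) (i e : Expr)
  | seq (p q : Program)
  | ite (e : Expr) (p q : Program)
  | loop (e : Expr) (p : Program)

/-- The memory after `x := k`. -/
def Memory.setReg (s : Memory) (x k : ℕ) : Memory :=
  { s with reg := Function.update s.reg x k }

/-- The memory after `a[i] := k`. -/
def Memory.setArr (s : Memory) (a i k : ℕ) : Memory :=
  { s with arr := Function.update s.arr a (Function.update (s.arr a) i k) }

/-- `Runs p s s' t`: started in memory `s`, the program `p` halts in memory `s'` after exactly
`t` steps. -/
inductive Runs : Program → Memory → Memory → ℕ → Prop where
  | skip (s : Memory) : Runs .skip s s 1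
  | assign (s : Memory) (x : ℕ) (e : Expr) :
      Runs (.assign x e) s (s.setReg x (e.eval s)) (e.cost + 1)
  | store (s : Memory) (a : ℕ) (i e : Expr) :
      Runs (.store a i e) s (s.setArr a (i.eval s) (e.eval s)) (i.cost + e.cost + 1)
  | seq {p q : Program} {s s' s'' : Memory} {t t' : ℕ} :
      Runs p s s' t → Runs q s' s'' t' → Runs (.seq p q) s s'' (t + t')
  | iteTrue {e : Expr} {p q : Program} {s s' : Memory} {t : ℕ} :
      e.eval s ≠ 0 → Runs p s s' t → Runs (.ite e p q) s s' (e.cost + 1 + t)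
  | iteFalse {e : Expr} {p q : Program} {s s' : Memory} {t : ℕ} :
      e.eval s = 0 → Runs q s s' t → Runs (.ite e p q) s s' (e.cost + 1 + t)
  | loopTrue {e : Expr} {p : Program} {s s' s'' : Memory} {t t' : ℕ} :
      e.eval s ≠ 0 → Runs p s s' t → Runs (.loop e p) s' s'' t' →
      Runs (.loop e p) s s'' (e.cost + 1 + t + t')
  | loopFalse {e : Expr} {p : Program} {s : Memory} :
      e.eval s = 0 → Runs (.loop e p) s s (e.cost + 1)

/-- The initial memory `s` holds the network with vertices `0, …, n - 1`, graph `G`, customers `C`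
and facilities `F`, given by adjacency lists in an arbitrary order:
* register `0` holds `n`, and all other registers hold `0`;
* the cells of array `1` from index `arr 0 v` to index `arr 0 (v + 1) - 1` list the neighbours
  of `v`, each of them once; array `0` starts with `0`, so the lists are consecutive;
* arrays `2` and `3` hold the indicator functions of `C` and `F`;
* all further arrays are filled with `0`. -/
structure HoldsNetwork {n : ℕ} (G : SimpleGraph (Fin n)) (C F : Set (Fin n)) (s : Memory) :
    Prop where
  reg_zero : s.reg 0 = n
  reg_other : ∀ x, x ≠ 0 → s.reg x = 0
  first : s.arr 0 0 = 0
  mono : ∀ v : Fin n, s.arr 0 v ≤ s.arr 0 ((v : ℕ) + 1)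
  entry : ∀ (v : Fin n) (k : ℕ), s.arr 0 v ≤ k → k < s.arr 0 ((v : ℕ) + 1) →
    ∃ u : Fin n, G.Adj v u ∧ s.arr 1 k = u
  once : ∀ v u : Fin n, G.Adj v u →
    ∃! k : ℕ, s.arr 0 v ≤ k ∧ k < s.arr 0 ((v : ℕ) + 1) ∧ s.arr 1 k = u
  customer : ∀ v : Fin n, (v ∈ C → s.arr 2 v = 1) ∧ (v ∉ C → s.arr 2 v = 0)
  facility : ∀ v : Fin n, (v ∈ F → s.arr 3 v = 1) ∧ (v ∉ F → s.arr 3 v = 0)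
  arr_other : ∀ a i, 4 ≤ a → s.arr a i = 0

end FacilityLocation

open FacilityLocation

/-!
# Optimal covers by vertex-disjoint paths

**Covers are hitting sets.** Call two vertices linked in `A` if they are connected in `G[A]`. The
fan lemma for two paths (`exists_coversCustomer`) says that a customer `c ∉ X` has two paths to `X`
that share only `c` unless a single vertex separates `c` from `X`. Hence (`isCover_iff`) `X` is a
cover if and only if for every vertex `x` each customer `c ≠ x` is linked in `G - x` to a member
of `X`: the set `X` has to hit every component of every `G - x` that contains a customer. In
particular a cover has at least two elements if there are two customers, and in a 2-connected
network any two vertices form a cover.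

**The tree of the 2-connected components.** A set is nonseparable if it is connected and stays so
when a vertex is deleted; two nonseparable sets with two common vertices have a nonseparable union.
In `t(G[S])` each edge separates its ends (`blockTree_crossing_unique`), because deleting a suitable
articulation point of `G[S]` does so in `G[S]`, and following an edge of `G[S]` moves between
vertices that represent its ends (`blockTreeReps_reachable`).

**Pruning.** Both pruning steps delete a pendant part, a set that is attached to the rest at one
vertex. Therefore `G` retracts onto the pruned graph `G[S]` in such a way that every edge outside
`S` is contracted (`exists_isHangingRetraction`). Each component of `G[S] - x`, for an articulation
point `x`, contains a leaf or all internal vertices of a leaf component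
(`exists_isLeaf_or_isLeafBlock`), so that a set with one vertex in each of these pendant parts
hits all that has to be hit. Conversely the pendant parts of `G[S]` at the ends are disjoint and
each of them contains a customer, so that, together with the parts of `G` that are retracted to it,
each contains a member of every cover.

**Linear time.** The program does not prune. It runs a depth-first search from a customer `r`. A
vertex `v ≠ r` is a cut if no edge leaves its subtree for a proper ancestor of its parent; then the
subtree is a component of `G` minus the parent. The minimal cuts with a customer in their subtree
have disjoint subtrees, and every cover meets each of them. One customer from each is an optimal
cover (`isOptimalCover_cuts`), unless there are no such cuts or there is a vertex other than `r`
whose deletion leaves `r` in a component without any of the chosen customers; then `r` has to be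
added (`isOptimalCover_insert_root`). A sweep through the vertices against their search order
chooses the customers, and a second sweep in search order looks for such a vertex. Correctness and
running time are shown together: the number of iterations of a loop with loop-free body is bounded
by a potential that each iteration decreases (`Achieves.loop`). For the search the potential is the
number of vertices that are not finished and of their list entries that have not been looked at.
-/

namespace FacilityLocation

/-! ### Vertices linked inside a vertex set -/

section Linked

variable {V : Type*} {G : SimpleGraph V} {A B : Set V} {u v w : V}

/-- `u` and `v` are linked in `A`: some walk from `u` to `v` stays in `A`. -/
def Linked (G : SimpleGraph V) (A : Set V) (u v : V) : Prop :=
  ∃ p : G.Walk u v, ∀ x ∈ p.support, x ∈ A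

theorem Linked.refl (h : u ∈ A) : Linked G A u u :=
  ⟨.nil, by simpa using h⟩

theorem Linked.symm (h : Linked G A u v) : Linked G A v u := by
  obtain ⟨p, hp⟩ := h
  exact ⟨p.reverse, by simpa using hp⟩

theorem Linked.trans (h : Linked G A u v) (h' : Linked G A v w) : Linked G A u w := by
  obtain ⟨p, hp⟩ := h
  obtain ⟨q, hq⟩ := h'
  refine ⟨p.append q, fun x hx => ?_⟩
  rcases (SimpleGraph.Walk.mem_support_append_iff p q).1 hx with h | h
  exacts [hp x h, hq x h]

theorem Linked.mono (hAB : A ⊆ B) (h : Linked G A u v) : Linked G B u v := by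
  obtain ⟨p, hp⟩ := h
  exact ⟨p, fun x hx => hAB (hp x hx)⟩

theorem Linked.mem_left (h : Linked G A u v) : u ∈ A := by
  obtain ⟨p, hp⟩ := h
  exact hp _ p.start_mem_support

theorem Linked.mem_right (h : Linked G A u v) : v ∈ A :=
  h.symm.mem_left

theorem Linked.of_adj (h : G.Adj u v) (hu : u ∈ A) (hv : v ∈ A) : Linked G A u v :=
  ⟨h.toWalk, by simp [SimpleGraph.Adj.toWalk, hu, hv]⟩

/-- A property that passes along the edges inside `A` passes between linked vertices. -/
theorem Linked.induction {Q : V → Prop} (h : Linked G A u v) (hu : Q u)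
    (step : ∀ x y, x ∈ A → y ∈ A → G.Adj x y → Q x → Q y) : Q v := by
  obtain ⟨p, hp⟩ := h
  induction p with
  | nil => exact hu
  | cons hadj p ih =>
    have hx : ∀ x ∈ p.support, x ∈ A := fun x hx => hp x (by simp [hx])
    exact ih (step _ _ (hp _ (by simp)) (hx _ p.start_mem_support) hadj hu) hx

theorem preconnected_induce_iff_linked :
    (G.induce A).Preconnected ↔ ∀ u ∈ A, ∀ v ∈ A, Linked G A u v := by
  constructor
  · intro h u hu v hv
    obtain ⟨p⟩ := h ⟨u, hu⟩ ⟨v, hv⟩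
    let f : G.induce A →g G := ⟨Subtype.val, fun h => h⟩
    refine ⟨p.map f, fun x hx => ?_⟩
    rw [SimpleGraph.Walk.support_map, List.mem_map] at hx
    obtain ⟨y, -, rfl⟩ := hx
    exact y.2
  · rintro h ⟨u, hu⟩ ⟨v, hv⟩
    obtain ⟨p, hp⟩ := h u hu v hv
    exact ⟨p.induce A hp⟩

theorem linked_univ_of_connected (hG : G.Connected) (u v : V) : Linked G Set.univ u v := by
  obtain ⟨p⟩ := hG.preconnected u v
  exact ⟨p, fun _ _ => trivial⟩

/-- A walk that meets `M` has a last vertex `q` in `M`. -/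
theorem exists_last_mem (M : Set V) (p : G.Walk u v) (h : ∃ y ∈ p.support, y ∈ M) :
    ∃ q ∈ M, q ∈ p.support ∧ ∃ p' : G.Walk q v,
      (∀ x ∈ p'.support, x ∈ p.support) ∧ ∀ x ∈ p'.support, x ∈ M → x = q := by
  induction p with
  | @nil a =>
    obtain ⟨y, hy, hyM⟩ := h
    obtain rfl : y = a := by simpa using hy
    exact ⟨y, hyM, by simp, .nil, by simp, by simp⟩
  | @cons a b c hadj p ih =>
    by_cases hex : ∃ y ∈ p.support, y ∈ M
    · obtain ⟨q, hq, hqp, p', h1, h2⟩ := ih hex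
      exact ⟨q, hq, by simp [hqp], p', fun x hx => by simp [h1 x hx], h2⟩
    · push Not at hex
      have ha : a ∈ M := by
        obtain ⟨y, hy, hyM⟩ := h
        rcases List.mem_cons.1 (by simpa using hy) with rfl | h
        exacts [hyM, absurd hyM (hex y h)]
      refine ⟨a, ha, by simp, .cons hadj p, fun x hx => hx, fun x hx hxM => ?_⟩
      rcases List.mem_cons.1 (by simpa using hx) with h | h
      exacts [h, absurd hxM (hex x h)]

end Linked

/-! ### Covers as hitting sets -/

section Fan

variable {V : Type*} {G : SimpleGraph V} {C X Y : Set V} {c : V}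

/-- There are walks from `c` to `a` and from `c` to some vertex of `X` that share only `c`. -/
def HasFan (G : SimpleGraph V) (X : Set V) (c a : V) : Prop :=
  ∃ p : G.Walk c a, ∃ f ∈ X, ∃ q : G.Walk c f, ∀ x, x ∈ p.support → x ∈ q.support → x = c

/-- Whitney's rerouting step: a fan to `a` gives a fan to any neighbour `b` of `a`, since some
walk from `c` to `X` avoids `b`. -/
theorem HasFan.adj {a b : V} (hX : ∀ x, c ≠ x → ∃ y ∈ X, Linked G {x}ᶜ c y)
    (h : HasFan G X c a) (hab : G.Adj a b) (hb : b ≠ c) : HasFan G X c b := by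
  classical
  obtain ⟨p, f, hf, q₀, hpq₀⟩ := h
  obtain ⟨q, hq, hpq⟩ : ∃ q : G.Walk c f, q.IsPath ∧
      ∀ x, x ∈ p.support → x ∈ q.support → x = c :=
    ⟨q₀.bypass, q₀.bypass_isPath, fun x hx hx' => hpq₀ x hx (q₀.support_bypass_subset_support hx')⟩
  have hmem : ∀ x, x ∈ (p.concat hab).support ↔ x ∈ p.support ∨ x = b := by
    simp [SimpleGraph.Walk.support_concat]
  by_cases hbq : b ∈ q.support
  swap
  · refine ⟨p.concat hab, f, hf, q, fun x hx hx' => ?_⟩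
    rcases (hmem x).1 hx with h | rfl
    exacts [hpq x h hx', absurd hx' hbq]
  have hbp : b ∉ p.support := fun h => hb (hpq b h hbq)
  set R := q.takeUntil b hbq with hR
  have hRq : ∀ x ∈ R.support, x ∈ q.support := q.support_takeUntil_subset_support hbq
  have hRpath : R.IsPath := hq.takeUntil hbq
  obtain ⟨g, hg, Q, hQ⟩ := hX b hb.symm
  obtain ⟨z, hz, hzQ, Q', hQ', hlast⟩ :=
    exists_last_mem {x | x ∈ p.support ∨ x ∈ R.support} Q ⟨c, by simp, by simp⟩
  have hzb : z ≠ b := hQ z hzQ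
  have hbQ' : b ∉ Q'.support := fun h => hQ b (hQ' b h) rfl
  by_cases hzp : z ∈ p.support
  · refine ⟨R, g, hg, (p.takeUntil z hzp).append Q', fun x hx hx' => ?_⟩
    rcases (SimpleGraph.Walk.mem_support_append_iff _ _).1 hx' with h | h
    · exact hpq x (p.support_takeUntil_subset_support hzp h) (hRq x hx)
    · obtain rfl := hlast x h (Or.inr hx)
      exact hpq x hzp (hRq x hx)
  · have hzR : z ∈ R.support := hz.resolve_left hzp
    refine ⟨p.concat hab, g, hg, (R.takeUntil z hzR).append Q', fun x hx hx' => ?_⟩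
    rcases (SimpleGraph.Walk.mem_support_append_iff _ _).1 hx' with h | h
    · rcases (hmem x).1 hx with h' | rfl
      · exact hpq x h' (hRq x (R.support_takeUntil_subset_support hzR h))
      · exact absurd h (SimpleGraph.Walk.endpoint_notMem_support_takeUntil hRpath hzR hzb.symm)
    · rcases (hmem x).1 hx with h' | rfl
      · exact absurd (hlast x h (Or.inl h') ▸ h') hzp
      · exact absurd h hbQ'

/-- The fan lemma for two paths: two paths from `c` to `X` that share only `c` exist if no single
vertex separates `c` from `X`. -/
theorem exists_coversCustomer (hc : c ∉ X)
    (hX : ∀ x, c ≠ x → ∃ y ∈ X, Linked G {x}ᶜ c y) :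
    ∀ z, c ≠ z → ∃ f₁ ∈ X, ∃ f₂ ∈ X, CoversCustomer (allPaths G) c f₁ f₂ := by
  classical
  intro z hz
  obtain ⟨f, hf, p, -⟩ := hX z hz
  have hfc : f ≠ c := fun h => hc (h ▸ hf)
  obtain ⟨p, hp⟩ : ∃ p : G.Walk c f, p.IsPath := ⟨p.bypass, p.bypass_isPath⟩
  cases p with
  | nil => exact absurd rfl hfc
  | @cons _ b _ hadj p =>
    rw [SimpleGraph.Walk.cons_isPath_iff] at hp
    have hbase : HasFan G X c b := by
      obtain ⟨g, hg, q, hq⟩ := hX b hadj.ne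
      refine ⟨hadj.toWalk, g, hg, q, fun x hx hx' => ?_⟩
      have : x = c ∨ x = b := by simpa [SimpleGraph.Adj.toWalk] using hx
      exact this.resolve_right (hq x hx')
    have hfan : HasFan G X c f :=
      Linked.induction (A := {c}ᶜ) ⟨p, fun x hx (h : x = c) => hp.2 (h ▸ hx)⟩ hbase
        fun x y _ hy hxy h => h.adj hX hxy hy
    obtain ⟨p, g, hg, q, hpq⟩ := hfan
    exact ⟨f, hf, g, hg, hfc, fun h => hc (h ▸ hg), p.bypass, p.bypass_isPath, q.bypass,
      q.bypass_isPath, fun x hx hx' => hpq x (p.support_bypass_subset_support hx)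
        (q.support_bypass_subset_support hx')⟩

/-- A cover is a set that, for each vertex `x`, meets every component of `G - x` that contains a
customer. -/
theorem isCover_iff [Nontrivial V] :
    IsCover (allPaths G) C X ↔ ∀ c ∈ C, ∀ x, c ≠ x → ∃ y ∈ X, Linked G {x}ᶜ c y := by
  constructor
  · intro h c hc x hcx
    by_cases hcX : c ∈ X
    · exact ⟨c, hcX, .refl hcx⟩
    · obtain ⟨f₁, hf₁, f₂, hf₂, -, -, p₁, -, p₂, -, hp⟩ := h c hc hcX
      by_cases hx : x ∈ p₁.support
      · exact ⟨f₂, hf₂, p₂, fun y hy (h : y = x) => hcx (hp x hx (h ▸ hy)).symm⟩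
      · exact ⟨f₁, hf₁, p₁, fun y hy (h : y = x) => hx (h ▸ hy)⟩
  · intro h c hc hcX
    obtain ⟨z, hz⟩ := exists_ne c
    exact exists_coversCustomer hcX (h c hc) z hz.symm

/-- A cover of at least two customers has at least two elements. -/
theorem two_le_ncard_of_isCover [Finite V] {u v : V} (hu : u ∈ C) (hv : v ∈ C) (huv : u ≠ v)
    (h : IsCover (allPaths G) C Y) : 2 ≤ Y.ncard := by
  have : Nontrivial V := ⟨u, v, huv⟩
  rw [isCover_iff] at h
  obtain ⟨y, hy, -⟩ := h u hu v huv
  obtain ⟨c, hc, hcy⟩ : ∃ c ∈ C, c ≠ y := by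
    by_cases huy : u = y
    · exact ⟨v, hv, huy ▸ huv.symm⟩
    · exact ⟨u, hu, huy⟩
  obtain ⟨y', hy', hl⟩ := h c hc y hcy
  have : ({y, y'} : Set V).ncard = 2 := Set.ncard_pair fun h : y = y' => hl.mem_right h.symm
  rw [← this]
  exact Set.ncard_le_ncard (by rintro _ (rfl | rfl) <;> assumption) (Set.toFinite _)

theorem nonempty_of_isCover (hC : C.Nonempty) (h : IsCover (allPaths G) C Y) : Y.Nonempty := by
  obtain ⟨c, hc⟩ := hC
  by_cases hcY : c ∈ Y
  · exact ⟨c, hcY⟩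
  · obtain ⟨f, hf, -⟩ := h c hc hcY
    exact ⟨f, hf⟩

/-- The lower bound for covers: `X` is at most as large as `Y` if its points have pairwise disjoint
sets `T x` that all meet `Y`. -/
theorem ncard_le_of_disjoint_family [Finite V] {X Y : Set V} (T : V → Set V)
    (hT : ∀ x ∈ X, (T x ∩ Y).Nonempty)
    (hd : ∀ x ∈ X, ∀ x' ∈ X, x ≠ x' → Disjoint (T x) (T x')) : X.ncard ≤ Y.ncard := by
  choose! f hf using hT
  refine Set.ncard_le_ncard_of_injOn f (fun x hx => (hf x hx).2) (fun x hx x' hx' h => ?_)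
    (Set.toFinite _)
  by_contra hne
  exact Set.disjoint_left.1 (hd x hx x' hx' hne) (hf x hx).1 (h ▸ (hf x' hx').1)

end Fan

/-! ### Nonseparable sets and 2-connected components -/

section Nonseparable

variable {V : Type*} {G : SimpleGraph V} {S A B B' : Set V} {a u v w x y : V}

/-- `G[A]` is connected (or empty) and stays so when any one vertex is deleted. Unlike a
2-connected set, `A` may consist of one vertex or of the two ends of an edge. -/
def Nonseparable (G : SimpleGraph V) (A : Set V) : Prop :=
  (∀ u ∈ A, ∀ v ∈ A, Linked G A u v) ∧
    ∀ x, ∀ u ∈ A \ {x}, ∀ v ∈ A \ {x}, Linked G (A \ {x}) u v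

theorem not_isArticulation_iff (hx : x ∈ S) :
    ¬ IsArticulation G S x ↔ ∀ u ∈ S \ {x}, ∀ v ∈ S \ {x}, Linked G (S \ {x}) u v := by
  simp only [IsArticulation, hx, true_and, not_not, preconnected_induce_iff_linked]

/-- Deleting a vertex that is not an articulation point leaves a connected graph; this includes
the case that the vertex is not there. -/
theorem linked_diff_of_not_isArticulation (hS : ∀ u ∈ S, ∀ v ∈ S, Linked G S u v)
    (hx : ¬ IsArticulation G S x) : ∀ u ∈ S \ {x}, ∀ v ∈ S \ {x}, Linked G (S \ {x}) u v := by
  by_cases hxS : x ∈ S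
  · exact (not_isArticulation_iff hxS).1 hx
  · rw [Set.sdiff_singleton_eq_self hxS]
    exact hS

theorem twoConnected_iff [Finite V] : TwoConnected G A ↔ Nonseparable G A ∧ 3 ≤ A.ncard := by
  constructor
  · rintro ⟨hconn, hcard, hart⟩
    have hlink := preconnected_induce_iff_linked.1 hconn.preconnected
    exact ⟨⟨hlink, fun x => linked_diff_of_not_isArticulation hlink (hart x)⟩, hcard⟩
  · rintro ⟨⟨hlink, hdel⟩, hcard⟩
    have hne : A.Nonempty := by
      rw [← Set.ncard_pos (Set.toFinite A)]
      lia
    refine ⟨?_, hcard, fun x hx => (not_isArticulation_iff hx.1).2 (hdel x) hx⟩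
    have : Nonempty A := hne.to_subtype
    exact ⟨preconnected_induce_iff_linked.2 hlink⟩

theorem Nonseparable.pair (h : G.Adj u v) : Nonseparable G {u, v} := by
  refine ⟨?_, fun x => ?_⟩
  · rintro a (rfl | rfl) b (rfl | rfl)
    exacts [.refl (by simp), .of_adj h (by simp) (by simp), .of_adj h.symm (by simp) (by simp),
      .refl (by simp)]
  · rintro a ⟨rfl | rfl, hax⟩ b ⟨rfl | rfl, hbx⟩
    · exact .refl ⟨by simp, hax⟩
    · exact .of_adj h ⟨by simp, hax⟩ ⟨by simp, hbx⟩
    · exact .of_adj h.symm ⟨by simp, hax⟩ ⟨by simp, hbx⟩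
    · exact .refl ⟨by simp, hax⟩

theorem Nonseparable.union (hA : Nonseparable G A) (hB : Nonseparable G B) (hu : u ∈ A ∩ B)
    (hv : v ∈ A ∩ B) (huv : u ≠ v) : Nonseparable G (A ∪ B) := by
  have key : ∀ A' B' : Set V, (∀ u ∈ A', ∀ v ∈ A', Linked G A' u v) →
      (∀ u ∈ B', ∀ v ∈ B', Linked G B' u v) → (A' ∩ B').Nonempty →
      ∀ u ∈ A' ∪ B', ∀ v ∈ A' ∪ B', Linked G (A' ∪ B') u v := by
    rintro A' B' hA' hB' ⟨z, hzA, hzB⟩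
    have h : ∀ u ∈ A' ∪ B', Linked G (A' ∪ B') u z := by
      rintro u (hu | hu)
      exacts [(hA' u hu z hzA).mono Set.subset_union_left,
        (hB' u hu z hzB).mono Set.subset_union_right]
    exact fun u hu v hv => (h u hu).trans (h v hv).symm
  refine ⟨key A B hA.1 hB.1 ⟨u, hu⟩, fun x => ?_⟩
  rw [Set.union_sdiff_distrib]
  refine key _ _ (hA.2 x) (hB.2 x) ?_
  by_cases hux : u = x
  · exact ⟨v, ⟨hv.1, fun h : v = x => huv (hux.trans h.symm)⟩,
      ⟨hv.2, fun h : v = x => huv (hux.trans h.symm)⟩⟩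
  · exact ⟨u, ⟨hu.1, hux⟩, ⟨hu.2, hux⟩⟩

/-- Adding an ear: a nonseparable set can be enlarged by a path that leaves it at `a` along an
edge to `v` and returns to it elsewhere. -/
theorem Nonseparable.exists_ear (hA : Nonseparable G A) (hAS : A ⊆ S) (ha : a ∈ A)
    (hav : G.Adj a v) (hyA : y ∈ A) (hl : Linked G (S \ {a}) v y) :
    ∃ A', A ⊆ A' ∧ v ∈ A' ∧ A' ⊆ S ∧ Nonseparable G A' := by
  classical
  obtain ⟨p₀, hp₀⟩ := hl
  obtain ⟨p, hp, hpS⟩ : ∃ p : G.Walk v y, p.IsPath ∧ ∀ x ∈ p.support, x ∈ S \ {a} :=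
    ⟨p₀.bypass, p₀.bypass_isPath, fun x hx => hp₀ x (p₀.support_bypass_subset_support hx)⟩
  have hya : y ≠ a := (hpS y p.end_mem_support).2
  set M : Set V := A ∪ {x | x ∈ p.support} with hM
  have hAM : A ⊆ M := Set.subset_union_left
  have hpM : ∀ x ∈ p.support, x ∈ M := fun x hx => Or.inr hx
  refine ⟨M, hAM, hpM _ p.start_mem_support, ?_, ?_, fun z => ?_⟩
  · rintro x (hx | hx)
    exacts [hAS hx, (hpS x hx).1]
  · have h : ∀ u ∈ M, Linked G M u y := by
      rintro u (hu | hu)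
      · exact (hA.1 u hu y hyA).mono hAM
      · exact ⟨p.dropUntil u hu, fun x hx => hpM x (p.support_dropUntil_subset_support hu hx)⟩
    exact fun u hu v hv => (h u hu).trans (h v hv).symm
  · -- every vertex of the ear other than `z` reaches one of the two ends of the ear without `z`
    have hAz : ∀ s t, s ∈ A \ {z} → t ∈ A \ {z} → Linked G (M \ {z}) s t := fun s t hs ht =>
      (hA.2 z s hs t ht).mono (Set.sdiff_subset_sdiff_left hAM)
    have hend : ∀ u ∈ M \ {z}, ∃ t ∈ A \ {z}, Linked G (M \ {z}) u t := by
      rintro u ⟨hu | hu, huz⟩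
      · exact ⟨u, ⟨hu, huz⟩, .refl ⟨hAM hu, huz⟩⟩
      · by_cases hzd : z ∈ (p.dropUntil u hu).support
        · have hzt : z ∉ (p.takeUntil u hu).support := by
            intro hzt
            have hpp := hp
            rw [← p.take_spec hu] at hpp
            exact hpp.ne_of_mem_support_of_append (Ne.symm huz) hzt hzd rfl
          have hza : z ≠ a := fun h =>
            (hpS z (p.support_dropUntil_subset_support hu hzd)).2 h
          refine ⟨a, ⟨ha, hza.symm⟩, Linked.trans ?_ (.of_adj hav.symm
            ⟨hpM _ p.start_mem_support, fun h : v = z => hzt (h ▸ by simp)⟩ ⟨hAM ha, hza.symm⟩)⟩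
          exact Linked.symm ⟨p.takeUntil u hu, fun x hx =>
            ⟨hpM x (p.support_takeUntil_subset_support hu hx), fun h : x = z => hzt (h ▸ hx)⟩⟩
        · refine ⟨y, ⟨hyA, fun h : y = z => hzd (h ▸ by simp)⟩, p.dropUntil u hu, fun x hx => ?_⟩
          exact ⟨hpM x (p.support_dropUntil_subset_support hu hx), fun h : x = z => hzd (h ▸ hx)⟩
    intro s hs t ht
    obtain ⟨s', hs', hss'⟩ := hend s hs
    obtain ⟨t', ht', htt'⟩ := hend t ht
    exact (hss'.trans (hAz s' t' hs' ht')).trans htt'.symm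

theorem IsBlock.nonseparable [Finite V] (hB : IsBlock G S B) : Nonseparable G B :=
  (twoConnected_iff.1 hB.prop.2).1

theorem IsBlock.subset (hB : IsBlock G S B) : B ⊆ S :=
  hB.prop.1

theorem IsBlock.three_le (hB : IsBlock G S B) : 3 ≤ B.ncard :=
  hB.prop.2.2.1

variable [Finite V]

theorem IsBlock.exists_ne_ne (hB : IsBlock G S B) (x y : V) : ∃ z ∈ B, z ≠ x ∧ z ≠ y := by
  by_contra! h
  have hsub : B ⊆ {x, y} := fun z hz => by
    by_cases hzx : z = x
    · exact Or.inl hzx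
    · exact Or.inr (h z hz hzx)
  have h1 := Set.ncard_le_ncard hsub (Set.toFinite _)
  have h2 := Set.ncard_insert_le x {y}
  rw [Set.ncard_singleton] at h2
  have := hB.three_le
  lia

theorem IsBlock.eq_of_subset (hB : IsBlock G S B) (hA : Nonseparable G A) (hAS : A ⊆ S)
    (hBA : B ⊆ A) : A = B := by
  refine (hB.eq_of_le ⟨hAS, twoConnected_iff.2 ⟨hA, ?_⟩⟩ hBA).symm
  exact hB.three_le.trans (Set.ncard_le_ncard hBA (Set.toFinite _))

theorem Nonseparable.exists_isBlock (hA : Nonseparable G A) (hAS : A ⊆ S) (h3 : 3 ≤ A.ncard) :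
    ∃ B, IsBlock G S B ∧ A ⊆ B := by
  obtain ⟨B, hAB, hB⟩ := Set.Finite.exists_le_maximal
    (s := {A : Set V | A ⊆ S ∧ TwoConnected G A}) (Set.toFinite _)
    (show A ∈ _ from ⟨hAS, twoConnected_iff.2 ⟨hA, h3⟩⟩)
  exact ⟨B, hB, hAB⟩

/-- Two 2-connected components with two common vertices are equal. -/
theorem IsBlock.eq_of_mem (hB : IsBlock G S B) (hB' : IsBlock G S B') (huv : u ≠ v)
    (hu : u ∈ B) (hv : v ∈ B) (hu' : u ∈ B') (hv' : v ∈ B') : B = B' := by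
  have hU := hB.nonseparable.union hB'.nonseparable ⟨hu, hu'⟩ ⟨hv, hv'⟩ huv
  have hS := Set.union_subset hB.subset hB'.subset
  exact (hB.eq_of_subset hU hS Set.subset_union_left).symm.trans
    (hB'.eq_of_subset hU hS Set.subset_union_right)

/-- Two edges at `u` whose other ends are linked without `u` lie in one 2-connected component. -/
theorem exists_isBlock_of_adj_adj (huv : G.Adj u v) (huw : G.Adj u w) (hvw : v ≠ w) (hu : u ∈ S)
    (hl : Linked G (S \ {u}) w v) : ∃ B, IsBlock G S B ∧ u ∈ B ∧ v ∈ B ∧ w ∈ B := by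
  obtain ⟨A, hA, hwA, hAS, hns⟩ := (Nonseparable.pair huv).exists_ear
    (S := S) (by rintro _ (rfl | rfl); exacts [hu, hl.mem_right.1]) (by simp) huw
    (show v ∈ _ by simp) hl
  have h3 : 3 ≤ A.ncard := by
    have : ({u, v, w} : Set V).ncard = 3 :=
      Set.ncard_eq_three.2 ⟨u, v, w, huv.ne, huw.ne, hvw, rfl⟩
    rw [← this]
    refine Set.ncard_le_ncard ?_ (Set.toFinite _)
    rintro _ (rfl | rfl | rfl)
    exacts [hA (by simp), hA (by simp), hwA]
  obtain ⟨B, hB, hAB⟩ := hns.exists_isBlock hAS h3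
  exact ⟨B, hB, hAB (hA (by simp)), hAB (hA (by simp)), hAB hwA⟩

/-- A 2-connected component contains every ear that starts in it. -/
theorem IsBlock.mem_of_adj (hB : IsBlock G S B) (ha : a ∈ B) (hav : G.Adj a v) (hy : y ∈ B)
    (hl : Linked G (S \ {a}) v y) : v ∈ B := by
  obtain ⟨A, hBA, hv, hAS, hA⟩ := hB.nonseparable.exists_ear hB.subset ha hav hy hl
  rwa [hB.eq_of_subset hA hAS hBA] at hv

/-- Inside a 2-connected component, every vertex has a neighbour that avoids a given vertex. -/
theorem IsBlock.exists_adj (hB : IsBlock G S B) (hu : u ∈ B) (hux : u ≠ x) :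
    ∃ v ∈ B, v ≠ x ∧ G.Adj u v := by
  obtain ⟨z, hz, hzu, hzx⟩ := hB.exists_ne_ne u x
  obtain ⟨p, hp⟩ := hB.nonseparable.2 x u ⟨hu, hux⟩ z ⟨hz, hzx⟩
  cases p with
  | nil => exact absurd rfl hzu
  | @cons _ b _ hadj p =>
    have := hp b (by simp)
    exact ⟨b, this.1, this.2, hadj⟩

/-- All neighbours of an internal vertex of a 2-connected component lie in that component. -/
theorem IsBlock.mem_of_adj_internal (hB : IsBlock G S B) (hu : u ∈ internalVertices G S B)
    (huv : G.Adj u v) (hv : v ∈ S) : v ∈ B := by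
  obtain ⟨huB, hart⟩ := hu
  obtain ⟨z, hz, hzu, -⟩ := hB.exists_ne_ne u u
  exact hB.mem_of_adj huB huv hz ((not_isArticulation_iff (hB.subset huB)).1 hart v
    ⟨hv, huv.ne'⟩ z ⟨hB.subset hz, hzu⟩)

/-- A vertex in two 2-connected components is an articulation point. -/
theorem isArticulation_of_mem_of_mem (hB : IsBlock G S B) (hB' : IsBlock G S B') (hne : B ≠ B')
    (hu : u ∈ B) (hu' : u ∈ B') : IsArticulation G S u := by
  by_contra hart
  obtain ⟨z, hz, hzu, -⟩ := hB'.exists_ne_ne u u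
  obtain ⟨v, hv, -, hadj⟩ := hB'.exists_adj hu' (x := z) hzu.symm
  exact hne (hB.eq_of_mem hB' hadj.ne hu (hB.mem_of_adj_internal ⟨hu, hart⟩ hadj
    (hB'.subset hv)) hu' hv)

/-- Deleting a vertex `a` from `G[S]` leaves the rest of a 2-connected component linked. -/
theorem IsBlock.linked_diff (hB : IsBlock G S B) (hu : u ∈ B) (hv : v ∈ B) (hua : u ≠ a)
    (hva : v ≠ a) : Linked G (S \ {a}) u v :=
  (hB.nonseparable.2 a u ⟨hu, hua⟩ v ⟨hv, hva⟩).mono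
    (Set.sdiff_subset_sdiff_left hB.subset)

theorem not_isLeaf_of_mem_isBlock (hB : IsBlock G S B) (hu : u ∈ B) : ¬ IsLeaf G S u := by
  rintro ⟨-, h⟩
  obtain ⟨w, hw⟩ := Set.ncard_eq_one.1 h
  obtain ⟨z, hz, hzu, -⟩ := hB.exists_ne_ne u u
  obtain ⟨v, hv, -, hadj⟩ := hB.exists_adj hu (x := z) hzu.symm
  obtain ⟨v', hv', hvv', hadj'⟩ := hB.exists_adj hu (x := v) hadj.ne
  have h1 : v ∈ ({w} : Set V) := hw ▸ ⟨hadj, hB.subset hv⟩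
  have h2 : v' ∈ ({w} : Set V) := hw ▸ ⟨hadj', hB.subset hv'⟩
  exact hvv' (h2.trans h1.symm)

end Nonseparable

/-! ### The tree of 2-connected components -/

section BlockTree

variable {V : Type*} {G : SimpleGraph V} {S B : Set V} {a v : V}

theorem blockTree_adj_inl_inl {u v : {v : V // IsLeaf G S v ∨ IsArticulation G S v}} :
    (blockTree G S).Adj (.inl u) (.inl v) ↔
      G.Adj u.1 v.1 ∧ ¬ ∃ B, IsBlock G S B ∧ u.1 ∈ B ∧ v.1 ∈ B := by
  simp only [blockTree, SimpleGraph.fromRel_adj]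
  constructor
  · rintro ⟨-, h | ⟨h1, h2⟩⟩
    exacts [h, ⟨h1.symm, fun ⟨B, hB, hv, hu⟩ => h2 ⟨B, hB, hu, hv⟩⟩]
  · exact fun h => ⟨fun h' => h.1.ne (congrArg Subtype.val (Sum.inl.inj h')), .inl h⟩

theorem blockTree_adj_inl_inr {u : {v : V // IsLeaf G S v ∨ IsArticulation G S v}}
    {B : {B : Set V // IsBlock G S B}} :
    (blockTree G S).Adj (.inl u) (.inr B) ↔ IsArticulation G S u.1 ∧ u.1 ∈ B.1 := by
  simp [blockTree, SimpleGraph.fromRel_adj]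

theorem blockTree_not_adj_inr_inr {B B' : {B : Set V // IsBlock G S B}} :
    ¬ (blockTree G S).Adj (.inr B) (.inr B') := by
  simp [blockTree, SimpleGraph.fromRel_adj]

/-- The vertices of the tree structure that are, or contain, a vertex of `K`. -/
def blockTreeMeets (G : SimpleGraph V) (S K : Set V) :
    {v : V // IsLeaf G S v ∨ IsArticulation G S v} ⊕ {B : Set V // IsBlock G S B} → Prop
  | .inl w => w.1 ∈ K
  | .inr B => (B.1 ∩ K).Nonempty

theorem mem_of_adj_component {u : V} {K : Set V} (hK : K = {w | Linked G (S \ {a}) v w})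
    {w : V} (hu : u ∈ K) (h : G.Adj u w) (hw : w ∈ S) (hwa : w ≠ a) : w ∈ K := by
  subst hK
  exact Linked.trans hu (.of_adj h (Linked.mem_right hu) ⟨hw, hwa⟩)

variable [Finite V]

/-- An edge of the tree structure that crosses from outside to inside a component `K` of
`G[S] - a` starts at `a`, and yields an edge of `G` from `a` to `K`. -/
theorem blockTree_crossing {K : Set V} (hK : K = {w | Linked G (S \ {a}) v w})
    {x y} (h : (blockTree G S).Adj x y) (hx : ¬ blockTreeMeets G S K x)
    (hy : blockTreeMeets G S K y) :
    (∃ ha, x = .inl ⟨a, ha⟩) ∧ ∃ w ∈ K, G.Adj a w ∧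
      ((∃ hw, y = .inl ⟨w, hw⟩ ∧ ¬ ∃ B, IsBlock G S B ∧ a ∈ B ∧ w ∈ B) ∨
        ∃ B, y = .inr B ∧ a ∈ B.1 ∧ w ∈ B.1) := by
  have haK : a ∉ K := fun h => by
    rw [hK] at h
    exact h.mem_right.2 rfl
  have hblock : ∀ B, IsBlock G S B → ∀ u ∈ B, u ≠ a → (B ∩ K).Nonempty → u ∈ K := by
    rintro B hB u hu hua ⟨z, hzB, hzK⟩
    rw [hK] at hzK ⊢
    exact hzK.trans (hB.linked_diff hzB hu (fun h => hzK.mem_right.2 h) hua)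
  rcases x with ⟨x, hxS⟩ | B <;> rcases y with ⟨y, hyS⟩ | B'
  · rw [blockTree_adj_inl_inl] at h
    have hxa : x = a := by
      by_contra hne
      exact hx (mem_of_adj_component hK hy h.1.symm (hxS.elim (·.1) (·.1)) hne)
    subst hxa
    exact ⟨⟨hxS, rfl⟩, y, hy, h.1, .inl ⟨hyS, rfl, h.2⟩⟩
  · rw [blockTree_adj_inl_inr] at h
    have hxa : x = a := by
      by_contra hne
      exact hx (hblock _ B'.2 x h.2 hne hy)
    subst hxa
    obtain ⟨z, hz, hzK⟩ := id hy
    obtain ⟨w, hw, -, hadj⟩ := B'.2.exists_adj h.2 (B'.2.exists_ne_ne x x).choose_spec.2.1.symm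
    exact ⟨⟨hxS, rfl⟩, w, hblock _ B'.2 w hw hadj.ne' hy, hadj, .inr ⟨B', rfl, h.2, hw⟩⟩
  · obtain ⟨h1, h2⟩ := blockTree_adj_inl_inr.1 h.symm
    have hya : y ≠ a := fun h => haK (h ▸ hy)
    exact absurd ⟨y, h2, hy⟩ hx
  · exact absurd h blockTree_not_adj_inr_inr

/-- At most one edge of the tree structure crosses into a component of `G[S] - a`: two of them
would give two edges from `a` to the component, and these lie in one 2-connected component. -/
theorem blockTree_crossing_unique {K : Set V} (hK : K = {w | Linked G (S \ {a}) v w})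
    (haS : a ∈ S) {x y x' y'} (h : (blockTree G S).Adj x y) (hx : ¬ blockTreeMeets G S K x)
    (hy : blockTreeMeets G S K y) (h' : (blockTree G S).Adj x' y')
    (hx' : ¬ blockTreeMeets G S K x') (hy' : blockTreeMeets G S K y') : x = x' ∧ y = y' := by
  obtain ⟨⟨_, rfl⟩, w, hw, haw, hor⟩ := blockTree_crossing hK h hx hy
  obtain ⟨⟨_, rfl⟩, w', hw', haw', hor'⟩ := blockTree_crossing hK h' hx' hy'
  refine ⟨rfl, ?_⟩
  have hcommon : w ≠ w' → ∃ B, IsBlock G S B ∧ a ∈ B ∧ w ∈ B ∧ w' ∈ B := fun hne => by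
    rw [hK] at hw hw'
    exact exists_isBlock_of_adj_adj haw haw' hne haS (Linked.trans (Linked.symm hw') hw)
  rcases hor with ⟨_, rfl, hno⟩ | ⟨B, rfl, haB, hwB⟩ <;>
    rcases hor' with ⟨_, rfl, hno'⟩ | ⟨B', rfl, haB', hwB'⟩
  · by_cases hne : w = w'
    · subst hne
      rfl
    · obtain ⟨B, hB, ha, hw, -⟩ := hcommon hne
      exact absurd ⟨B, hB, ha, hw⟩ hno
  · by_cases hne : w = w'
    · exact absurd ⟨B'.1, B'.2, haB', hne ▸ hwB'⟩ hno
    · obtain ⟨B, hB, ha, hw, -⟩ := hcommon hne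
      exact absurd ⟨B, hB, ha, hw⟩ hno
  · by_cases hne : w = w'
    · exact absurd ⟨B.1, B.2, haB, hne ▸ hwB⟩ hno'
    · obtain ⟨B, hB, ha, -, hw⟩ := hcommon hne
      exact absurd ⟨B, hB, ha, hw⟩ hno'
  · congr 1
    apply Subtype.ext
    by_cases hne : w = w'
    · exact B.2.eq_of_mem B'.2 haw.ne haB hwB haB' (hne ▸ hwB')
    · obtain ⟨B'', hB, ha, hw, hw'⟩ := hcommon hne
      exact (B.2.eq_of_mem hB haw.ne haB hwB ha hw).trans
        (hB.eq_of_mem B'.2 haw'.ne ha hw' haB' hwB')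

theorem blockTree_isAcyclic : (blockTree G S).IsAcyclic := by
  -- an edge whose two ends are told apart by the label of a component is a bridge
  have key : ∀ a ha y, (blockTree G S).Adj (.inl ⟨a, ha⟩) y →
      ¬ (blockTree G S \ SimpleGraph.fromEdgeSet {s(.inl ⟨a, ha⟩, y)}).Reachable
        (.inl ⟨a, ha⟩) y := by
    intro a ha y hadj hreach
    have haS : a ∈ S := ha.elim (·.1) (·.1)
    obtain ⟨v, hvS, hva, hy⟩ : ∃ v ∈ S, v ≠ a ∧
        blockTreeMeets G S {w | Linked G (S \ {a}) v w} y := by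
      rcases y with ⟨y, hy⟩ | B
      · have h := (blockTree_adj_inl_inl.1 hadj).1
        have hyS : y ∈ S := hy.elim (·.1) (·.1)
        exact ⟨y, hyS, h.ne', .refl ⟨hyS, h.ne'⟩⟩
      · obtain ⟨z, hz, hza, -⟩ := B.2.exists_ne_ne a a
        exact ⟨z, B.2.subset hz, hza, z, hz, .refl ⟨B.2.subset hz, hza⟩⟩
    set K := {w | Linked G (S \ {a}) v w} with hK
    have hx : ¬ blockTreeMeets G S K (.inl ⟨a, ha⟩) := fun h => (Linked.mem_right h).2 rfl
    obtain ⟨p⟩ := hreach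
    refine hx ?_
    refine Linked.induction (A := Set.univ) (Q := blockTreeMeets G S K) ⟨p.reverse, by simp⟩ hy ?_
    intro s t _ _ hst hs
    rw [SimpleGraph.sdiff_adj] at hst
    by_contra ht
    obtain ⟨rfl, rfl⟩ := blockTree_crossing_unique hK haS hadj hx hy hst.1.symm ht hs
    exact hst.2 (by simp [Sym2.eq_swap, hst.1.ne])
  rw [SimpleGraph.isAcyclic_iff_forall_adj_isBridge]
  intro x y hxy
  rw [SimpleGraph.isBridge_iff]
  rcases x with ⟨x, hx⟩ | B
  · exact key x hx y hxy
  · rcases y with ⟨y, hy⟩ | B'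
    · intro h
      refine key y hy _ hxy.symm ?_
      rw [Sym2.eq_swap]
      exact h.symm
    · exact absurd hxy blockTree_not_adj_inr_inr

/-- The vertices of the tree structure that stand for the vertex `w` of `G[S]`. -/
def blockTreeReps (G : SimpleGraph V) (S : Set V) (w : V) :
    {v : V // IsLeaf G S v ∨ IsArticulation G S v} ⊕ {B : Set V // IsBlock G S B} → Prop
  | .inl u => u.1 = w
  | .inr B => w ∈ B.1

theorem blockTreeReps_reachable {w : V} {x y} (hx : blockTreeReps G S w x)
    (hy : blockTreeReps G S w y) : (blockTree G S).Reachable x y := by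
  have hlb : ∀ u B, blockTreeReps G S w (.inl u) → blockTreeReps G S w (.inr B) →
      (blockTree G S).Adj (.inl u) (.inr B) := by
    rintro ⟨u, hu⟩ B (rfl : u = w) (hB : u ∈ B.1)
    exact blockTree_adj_inl_inr.2 ⟨hu.resolve_left (not_isLeaf_of_mem_isBlock B.2 hB), hB⟩
  rcases x with ⟨x, hxS⟩ | B <;> rcases y with ⟨y, hyS⟩ | B'
  · obtain rfl : x = y := hx.trans hy.symm
    exact .rfl
  · exact (hlb _ _ hx hy).reachable
  · exact (hlb _ _ hy hx).symm.reachable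
  · by_cases h : B.1 = B'.1
    · rw [Subtype.ext h]
    · have hw : blockTreeReps G S w (.inl ⟨w, .inr
        (isArticulation_of_mem_of_mem B.2 B'.2 h hx hy)⟩) := rfl
      exact (hlb _ _ hw hx).symm.reachable.trans (hlb _ _ hw hy).reachable

/-- A vertex of `G[S]` with a neighbour `v` that is neither a leaf nor an articulation point lies
in a 2-connected component together with `v`. -/
theorem exists_isBlock_of_adj {w : V} (hwv : G.Adj w v)
    (hw : w ∈ S) (hv : v ∈ S) (hleaf : ¬ IsLeaf G S w) (hart : ¬ IsArticulation G S w) :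
    ∃ B, IsBlock G S B ∧ w ∈ B ∧ v ∈ B := by
  obtain ⟨z, hz, hzv⟩ : ∃ z ∈ G.neighborSet w ∩ S, z ≠ v := by
    by_contra! h
    refine hleaf ⟨hw, Set.ncard_eq_one.2 ⟨v, ?_⟩⟩
    ext z
    exact ⟨fun hz => h z hz, fun hz => by rw [Set.mem_singleton_iff.1 hz]; exact ⟨hwv, hv⟩⟩
  obtain ⟨B, hB, h1, h2, -⟩ := exists_isBlock_of_adj_adj hwv hz.1 hzv.symm hw
    ((not_isArticulation_iff hw).1 hart z ⟨hz.2, (SimpleGraph.Adj.ne hz.1).symm⟩ v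
      ⟨hv, hwv.ne'⟩)
  exact ⟨B, hB, h1, h2⟩

theorem blockTree_isTree (hconn : (G.induce S).Connected) (hS : S.Nontrivial) :
    (blockTree G S).IsTree := by
  have hlink := preconnected_induce_iff_linked.1 hconn.preconnected
  have hnb : ∀ w ∈ S, ∃ v ∈ S, G.Adj w v := by
    intro w hw
    obtain ⟨z, hz, hzw⟩ := hS.exists_ne w
    obtain ⟨p, hp⟩ := hlink w hw z hz
    cases p with
    | nil => exact absurd rfl hzw
    | @cons _ b _ hadj p => exact ⟨b, hp b (by simp), hadj⟩
  have hrep : ∀ w ∈ S, ∃ x, blockTreeReps G S w x := by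
    intro w hw
    by_cases h : IsLeaf G S w ∨ IsArticulation G S w
    · exact ⟨.inl ⟨w, h⟩, rfl⟩
    · push Not at h
      obtain ⟨v, hv, hwv⟩ := hnb w hw
      obtain ⟨B, hB, hwB, -⟩ := exists_isBlock_of_adj hwv hw hv h.1 h.2
      exact ⟨.inr ⟨B, hB⟩, hwB⟩
  have hstep : ∀ u ∈ S, ∀ v ∈ S, G.Adj u v → ∃ x y, blockTreeReps G S u x ∧
      blockTreeReps G S v y ∧ (blockTree G S).Reachable x y := by
    intro u hu v hv huv
    by_cases hB : ∃ B, IsBlock G S B ∧ u ∈ B ∧ v ∈ B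
    · obtain ⟨B, hB, huB, hvB⟩ := hB
      exact ⟨.inr ⟨B, hB⟩, .inr ⟨B, hB⟩, huB, hvB, .rfl⟩
    · have hla : ∀ u ∈ S, ∀ v ∈ S, G.Adj u v → (¬ ∃ B, IsBlock G S B ∧ u ∈ B ∧ v ∈ B) →
          IsLeaf G S u ∨ IsArticulation G S u := by
        intro u hu v hv huv hB
        by_contra h
        push Not at h
        exact hB (exists_isBlock_of_adj huv hu hv h.1 h.2)
      have hB' : ¬ ∃ B, IsBlock G S B ∧ v ∈ B ∧ u ∈ B := fun ⟨B, h1, h2, h3⟩ => hB ⟨B, h1, h3, h2⟩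
      exact ⟨.inl ⟨u, hla u hu v hv huv hB⟩, .inl ⟨v, hla v hv u hu huv.symm hB'⟩, rfl, rfl,
        (blockTree_adj_inl_inl.2 ⟨huv, hB⟩).reachable⟩
  have hall : ∀ u ∈ S, ∀ v ∈ S, ∀ x y, blockTreeReps G S u x → blockTreeReps G S v y →
      (blockTree G S).Reachable x y := by
    intro u hu v hv x y hx
    refine Linked.induction (hlink u hu v hv)
      (Q := fun v => ∀ y, blockTreeReps G S v y → (blockTree G S).Reachable x y)
      (fun y hy => blockTreeReps_reachable hx hy) (fun s t hs ht hst ih y hy => ?_) y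
    obtain ⟨x', y', hx', hy', h⟩ := hstep s hs t ht hst
    exact ((ih x' hx').trans h).trans (blockTreeReps_reachable hy' hy)
  have hmem : ∀ x, ∃ w ∈ S, blockTreeReps G S w x := by
    rintro (⟨x, hx⟩ | B)
    · exact ⟨x, hx.elim (·.1) (·.1), rfl⟩
    · obtain ⟨z, hz, -⟩ := B.2.exists_ne_ne hS.nonempty.some hS.nonempty.some
      exact ⟨z, B.2.subset hz, hz⟩
  obtain ⟨x₀, -⟩ := hrep _ hS.nonempty.some_mem
  have : Nonempty ({v : V // IsLeaf G S v ∨ IsArticulation G S v} ⊕ {B : Set V // IsBlock G S B}) :=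
    ⟨x₀⟩
  refine ⟨⟨fun x y => ?_⟩, blockTree_isAcyclic⟩
  obtain ⟨u, hu, hx⟩ := hmem x
  obtain ⟨v, hv, hy⟩ := hmem y
  exact hall u hu v hv x y hx hy

end BlockTree

/-! ### Pendant parts, leaves and leaf components -/

section Pendant

variable {V : Type*} {G : SimpleGraph V} {C S T B : Set V} {a c u v x : V}

/-- `T` hangs at `a` in `G[S]`: all edges of `G[S]` that leave `T` end in `a`. -/
def IsPendant (G : SimpleGraph V) (S : Set V) (a : V) (T : Set V) : Prop :=
  T ⊆ S ∧ a ∈ S ∧ a ∉ T ∧ ∀ t ∈ T, ∀ v ∈ S, G.Adj t v → v ∈ T ∨ v = a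

theorem IsLeaf.isPendant (h : IsLeaf G S v) : ∃ a, IsPendant G S a {v} := by
  obtain ⟨hv, h1⟩ := h
  obtain ⟨a, ha⟩ := Set.ncard_eq_one.1 h1
  have ha' : a ∈ G.neighborSet v ∩ S := by simp [ha]
  refine ⟨a, by simpa using hv, ha'.2, (SimpleGraph.Adj.ne ha'.1).symm, ?_⟩
  rintro t rfl w hw htw
  have : w ∈ G.neighborSet t ∩ S := ⟨htw, hw⟩
  rw [ha] at this
  exact Or.inr this

theorem IsLeafBlock.isPendant [Finite V] (h : IsLeafBlock G S B) :
    ∃ a, IsPendant G S a (internalVertices G S B) := by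
  obtain ⟨hB, a, ⟨haB, ha⟩, huniq⟩ := h
  refine ⟨a, fun v hv => hB.subset hv.1, hB.subset haB, fun h => h.2 ha, fun t ht v hv htv => ?_⟩
  have hvB := hB.mem_of_adj_internal ht htv hv
  by_cases hart : IsArticulation G S v
  · exact Or.inr (huniq v ⟨hvB, hart⟩)
  · exact Or.inl ⟨hvB, hart⟩

theorem IsLeafBlock.internalVertices_nonempty [Finite V] (h : IsLeafBlock G S B) :
    (internalVertices G S B).Nonempty := by
  obtain ⟨hB, a, -, huniq⟩ := h
  obtain ⟨z, hz, hza, -⟩ := hB.exists_ne_ne a a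
  exact ⟨z, hz, fun hart => hza (huniq z ⟨hz, hart⟩)⟩

theorem exists_adj_of_linked (hS : ∀ u ∈ S, ∀ v ∈ S, Linked G S u v) (hu : u ∈ S) (hx : x ∈ S)
    (hux : u ≠ x) : ∃ v ∈ S, G.Adj u v := by
  obtain ⟨p, hp⟩ := hS u hu x hx
  cases p with
  | nil => exact absurd rfl hux
  | @cons _ b _ hadj p => exact ⟨b, hp b (by simp), hadj⟩

/-- Distinct leaf components have no common internal vertex. -/
theorem disjoint_internalVertices [Finite V] {B' : Set V} (h : IsLeafBlock G S B)
    (h' : IsLeafBlock G S B') (hne : B ≠ B') :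
    Disjoint (internalVertices G S B) (internalVertices G S B') :=
  Set.disjoint_left.2 fun _ hu hu' =>
    hu.2 (isArticulation_of_mem_of_mem h.1 h'.1 hne hu.1 hu'.1)

/-- Each component that is left when an articulation point is deleted contains a leaf or all
internal vertices of a leaf component: one takes an articulation point `x` and a component `K` of
`G[S] - x` such that `K` is minimal; then `K ∪ {x}` is nonseparable. -/
theorem exists_isLeaf_or_isLeafBlock [Finite V] (hS : ∀ u ∈ S, ∀ v ∈ S, Linked G S u v)
    (hx : IsArticulation G S x) (hc : c ∈ S \ {x}) :
    (∃ v, Linked G (S \ {x}) c v ∧ IsLeaf G S v) ∨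
      ∃ B, IsLeafBlock G S B ∧ ∀ v ∈ internalVertices G S B, Linked G (S \ {x}) c v := by
  induction hn : {w | Linked G (S \ {x}) c w}.ncard using Nat.strong_induction_on
    generalizing x c with
  | _ n ih =>
  set K := {w | Linked G (S \ {x}) c w} with hK
  have hKS : K ⊆ S \ {x} := fun w hw => Linked.mem_right hw
  have hcK : c ∈ K := .refl hc
  have hKadj : ∀ u ∈ K, ∀ w ∈ S, w ≠ x → G.Adj u w → w ∈ K := fun u hu w hw hwx h =>
    mem_of_adj_component hK hu h hw hwx
  by_cases hart : ∃ y ∈ K, IsArticulation G S y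
  · obtain ⟨y, hyK, hy⟩ := hart
    have hyx : y ≠ x := (hKS hyK).2
    obtain ⟨z, hz, hzx⟩ : ∃ z ∈ S \ {y}, ¬ Linked G (S \ {y}) z x := by
      by_contra! h
      exact (not_isArticulation_iff hy.1).2 (fun u hu v hv => (h u hu).trans (h v hv).symm) hy
    have hzx' : z ≠ x := fun h => hzx (h ▸ .refl ⟨hz.1, hz.2⟩)
    have hzy : Linked G (S \ {x}) z y := by
      have := Linked.induction (hS z hz.1 y hy.1)
        (Q := fun t => (Linked G (S \ {x}) z t ∧ Linked G (S \ {y}) z t) ∨ Linked G (S \ {x}) z y)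
        (Or.inl ⟨.refl ⟨hz.1, hzx'⟩, .refl hz⟩) fun s t hs ht hst h => by
          rcases h with ⟨h1, h2⟩ | h
          · by_cases hty : t = y
            · exact Or.inr (hty ▸ h1.trans (.of_adj hst h1.mem_right ⟨ht, hty ▸ hyx⟩))
            · have h2' := h2.trans (.of_adj hst h2.mem_right ⟨ht, hty⟩)
              have htx : t ≠ x := fun h => hzx (h ▸ h2')
              exact Or.inl ⟨h1.trans (.of_adj hst h1.mem_right ⟨ht, htx⟩), h2'⟩
          · exact Or.inr h
      rcases this with ⟨-, h⟩ | h
      exacts [absurd rfl h.mem_right.2, h]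
    have hsub : ∀ w, Linked G (S \ {y}) z w → w ∈ K := by
      intro w hw
      refine (Linked.trans hyK hzy.symm : Linked G (S \ {x}) c z).trans ?_
      refine (Linked.induction hw
        (Q := fun t => Linked G (S \ {x}) z t ∧ Linked G (S \ {y}) z t)
        ⟨.refl ⟨hz.1, hzx'⟩, .refl hz⟩ fun s t hs ht hst h => ?_).1
      have h2 := h.2.trans (.of_adj hst h.2.mem_right ht)
      exact ⟨h.1.trans (.of_adj hst h.1.mem_right ⟨ht.1, fun h : t = x => hzx (h ▸ h2)⟩), h2⟩
    have hlt : {w | Linked G (S \ {y}) z w}.ncard < n := by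
      rw [← hn]
      exact Set.ncard_lt_ncard ⟨hsub, fun h => (Linked.mem_right (h hyK)).2 rfl⟩ (Set.toFinite _)
    rcases ih _ hlt hy hz rfl with ⟨v, hv, hleaf⟩ | ⟨B, hB, hint⟩
    · exact Or.inl ⟨v, hsub v hv, hleaf⟩
    · exact Or.inr ⟨B, hB, fun v hv => hsub v (hint v hv)⟩
  · push Not at hart
    by_cases hone : ∃ w ∈ K, w ≠ c
    · right
      set A := insert x K with hA
      have hAS : A ⊆ S := Set.insert_subset hx.1 fun w hw => (hKS hw).1
      -- a walk from `u ∈ A` to `x` stays in `A` until it first meets `x`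
      have hto : ∀ T ⊆ S, ∀ u ∈ A ∩ T, Linked G T u x → Linked G (A ∩ T) u x := by
        intro T hTS u hu hux
        have := Linked.induction hux
          (Q := fun t => (t ∈ A ∧ Linked G (A ∩ T) u t) ∨ Linked G (A ∩ T) u x)
          (Or.inl ⟨hu.1, .refl hu⟩) fun s t hs ht hst h => by
            rcases h with ⟨hsA, h⟩ | h
            · rcases hsA with rfl | hsK
              · exact Or.inr h
              · have htA : t ∈ A := by
                  by_cases htx : t = x
                  · exact Or.inl htx
                  · exact Or.inr (hKadj s hsK t (hTS ht) htx hst)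
                exact Or.inl ⟨htA, h.trans (.of_adj hst h.mem_right ⟨htA, ht⟩)⟩
            · exact Or.inr h
        rcases this with ⟨-, h⟩ | h <;> exact h
      have hA1 : ∀ u ∈ A, ∀ v ∈ A, Linked G A u v := by
        have h : ∀ u ∈ A, Linked G A u x := fun u hu =>
          (hto S subset_rfl u ⟨hu, hAS hu⟩ (hS u (hAS hu) x hx.1)).mono Set.inter_subset_left
        exact fun u hu v hv => (h u hu).trans (h v hv).symm
      have hns : Nonseparable G A := by
        refine ⟨hA1, fun z => ?_⟩
        by_cases hzx : z = x
        · subst hzx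
          have h : ∀ u ∈ A \ {z}, Linked G (A \ {z}) c u := by
            rintro u ⟨hu | hu, huz⟩
            · exact absurd hu huz
            · refine (Linked.induction hu (Q := fun t => t ∈ K ∧ Linked G (A \ {z}) c t)
                ⟨hcK, .refl ⟨Or.inr hcK, hc.2⟩⟩ fun s t hs ht hst h => ?_).2
              have htK := hKadj s h.1 t ht.1 ht.2 hst
              exact ⟨htK, h.2.trans (.of_adj hst h.2.mem_right ⟨Or.inr htK, ht.2⟩)⟩
          exact fun u hu v hv => (h u hu).symm.trans (h v hv)
        · by_cases hzA : z ∈ A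
          · have hzK : z ∈ K := hzA.resolve_left hzx
            have hAz : A ∩ (S \ {z}) = A \ {z} := by
              rw [← Set.inter_sdiff_assoc, Set.inter_eq_left.2 hAS]
            have h : ∀ u ∈ A \ {z}, Linked G (A \ {z}) u x := fun u hu => hAz ▸
              hto (S \ {z}) Set.sdiff_subset u (hAz ▸ hu)
                ((not_isArticulation_iff (hAS hzA)).1 (hart z hzK) u ⟨hAS hu.1, hu.2⟩ x
                  ⟨hx.1, Ne.symm hzx⟩)
            exact fun u hu v hv => (h u hu).trans (h v hv).symm
          · rw [Set.sdiff_singleton_eq_self hzA]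
            exact hA1
      obtain ⟨w, hwK, hwc⟩ := hone
      have h3 : 3 ≤ A.ncard := by
        have : ({x, c, w} : Set V).ncard = 3 := Set.ncard_eq_three.2
          ⟨x, c, w, Ne.symm hc.2, Ne.symm (hKS hwK).2, hwc.symm, rfl⟩
        rw [← this]
        refine Set.ncard_le_ncard ?_ (Set.toFinite _)
        rintro _ (rfl | rfl | rfl)
        exacts [Or.inl rfl, Or.inr hcK, Or.inr hwK]
      obtain ⟨B, hB, hAB⟩ := hns.exists_isBlock hAS h3
      have hBA : ∀ v ∈ B, v ≠ x → v ∈ K := fun v hv hvx =>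
        hB.linked_diff (hAB (Or.inr hcK)) hv hc.2 hvx
      refine ⟨B, ⟨hB, x, ⟨hAB (Or.inl rfl), hx⟩, fun v hv => ?_⟩, fun v hv => ?_⟩
      · by_contra hvx
        exact hart v (hBA v hv.1 hvx) hv.2
      · exact hBA v hv.1 fun h => hv.2 (h ▸ hx)
    · left
      push Not at hone
      obtain ⟨b, hb, hcb⟩ := exists_adj_of_linked hS hc.1 hx.1 hc.2
      have hnb : ∀ w ∈ S, G.Adj c w → w = x := fun w hw hcw => by
        by_contra hwx
        exact hcw.ne' (hone w (hKadj c hcK w hw hwx hcw))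
      refine ⟨c, hcK, hc.1, Set.ncard_eq_one.2 ⟨x, ?_⟩⟩
      ext w
      refine ⟨fun hw => hnb w hw.2 hw.1, ?_⟩
      rintro rfl
      exact ⟨hnb b hb hcb ▸ hcb, hx.1⟩

/-- A set that contains the leaves, meets the interiors of the leaf components and has two
elements is met by every component of `G[S] - x`. -/
theorem exists_linked_of_hits_ends [Finite V] {X : Set V}
    (hS : ∀ u ∈ S, ∀ v ∈ S, Linked G S u v) (hXS : X ⊆ S) (hleaf : ∀ v, IsLeaf G S v → v ∈ X)
    (hblock : ∀ B, IsLeafBlock G S B → ∃ y ∈ X, y ∈ internalVertices G S B)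
    (hX : X.Nontrivial) (hc : c ∈ S) (hcx : c ≠ x) : ∃ y ∈ X, Linked G {x}ᶜ c y := by
  have hsub : S \ {x} ⊆ {x}ᶜ := fun w hw => hw.2
  by_cases hx : IsArticulation G S x
  · rcases exists_isLeaf_or_isLeafBlock hS hx ⟨hc, hcx⟩ with ⟨v, hv, hl⟩ | ⟨B, hB, hint⟩
    · exact ⟨v, hleaf v hl, hv.mono hsub⟩
    · obtain ⟨y, hy, hyB⟩ := hblock B hB
      exact ⟨y, hy, (hint y hyB).mono hsub⟩
  · obtain ⟨y, hy, hyx⟩ := hX.exists_ne x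
    exact ⟨y, hy, (linked_diff_of_not_isArticulation hS hx c ⟨hc, hcx⟩ y ⟨hXS hy, hyx⟩).mono hsub⟩

/-- If there is a leaf or a leaf component, then there are at least two of them. -/
theorem nontrivial_of_hits_ends [Finite V] {X : Set V}
    (hS : ∀ u ∈ S, ∀ v ∈ S, Linked G S u v) (hleaf : ∀ v, IsLeaf G S v → v ∈ X)
    (hblock : ∀ B, IsLeafBlock G S B → ∃ y ∈ X, y ∈ internalVertices G S B)
    (hex : (∃ v, IsLeaf G S v) ∨ ∃ B, IsLeafBlock G S B) : X.Nontrivial := by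
  by_cases hart : ∃ z, IsArticulation G S z
  · obtain ⟨z, hz⟩ := hart
    obtain ⟨c, hc, c', hc', hcc'⟩ : ∃ c ∈ S \ {z}, ∃ c' ∈ S \ {z}, ¬ Linked G (S \ {z}) c c' := by
      by_contra! h
      exact (not_isArticulation_iff hz.1).2 h hz
    have hit : ∀ c ∈ S \ {z}, ∃ y ∈ X, Linked G (S \ {z}) c y := by
      intro c hc
      rcases exists_isLeaf_or_isLeafBlock hS hz hc with ⟨v, hv, hl⟩ | ⟨B, hB, hint⟩
      · exact ⟨v, hleaf v hl, hv⟩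
      · obtain ⟨y, hy, hyB⟩ := hblock B hB
        exact ⟨y, hy, hint y hyB⟩
    obtain ⟨y, hy, hcy⟩ := hit c hc
    obtain ⟨y', hy', hcy'⟩ := hit c' hc'
    exact ⟨y, hy, y', hy', fun h => hcc' (hcy.trans (h ▸ hcy'.symm))⟩
  · push Not at hart
    obtain ⟨v, hv⟩ := hex.resolve_right fun ⟨B, hB⟩ => by
      obtain ⟨a, ha, -⟩ := hB.2
      exact hart a ha.2
    -- without articulation points a leaf `v` and its neighbour `w` are the whole graph
    obtain ⟨w, hw⟩ := Set.ncard_eq_one.1 hv.2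
    have hw' : w ∈ G.neighborSet v ∩ S := by simp [hw]
    have hvw : G.Adj v w := hw'.1
    have honly : ∀ z ∈ S, z ≠ v → z = w := by
      intro z hz hzv
      by_contra hzw
      obtain ⟨p, hp⟩ := (not_isArticulation_iff hw'.2).1 (hart w) v ⟨hv.1, hvw.ne⟩ z ⟨hz, hzw⟩
      cases p with
      | nil => exact hzv rfl
      | @cons _ b _ hadj p =>
        have hb := hp b (by simp)
        have : b ∈ G.neighborSet v ∩ S := ⟨hadj, hb.1⟩
        rw [hw] at this
        exact hb.2 this
    refine ⟨v, hleaf v hv, w, hleaf w ⟨hw'.2, Set.ncard_eq_one.2 ⟨v, ?_⟩⟩, hvw.ne⟩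
    ext z
    refine ⟨fun hz => ?_, ?_⟩
    · by_contra hzv
      exact SimpleGraph.Adj.ne hz.1 (honly z hz.2 hzv).symm
    · rintro rfl
      exact ⟨hvw.symm, hv.1⟩

end Pendant

/-! ### Pruning -/

section Pruning

variable {V : Type*} {G : SimpleGraph V} {C F S S' T : Set V} {a u v x : V} {ρ : V → V}

/-- `ρ` maps `G` to `G[S]` and shows that the rest of `G` hangs at single vertices of `S`: it fixes
`S`, and the two ends of an edge have the same image unless both lie in `S`. -/
def IsHangingRetraction (G : SimpleGraph V) (S : Set V) (ρ : V → V) : Prop :=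
  (∀ v, ρ v ∈ S) ∧ (∀ v ∈ S, ρ v = v) ∧ ∀ u v, G.Adj u v → ρ u ≠ ρ v → u ∈ S ∧ v ∈ S

theorem IsHangingRetraction.linked (h : IsHangingRetraction G S ρ) (hG : G.Connected) :
    ∀ u ∈ S, ∀ v ∈ S, Linked G S u v := by
  intro u hu v hv
  have := Linked.induction (linked_univ_of_connected hG u v) (Q := fun t => Linked G S u (ρ t))
    (by rw [h.2.1 u hu]; exact .refl hu) fun s t _ _ hst hs => by
      by_cases heq : ρ s = ρ t
      · exact heq ▸ hs
      · obtain ⟨hsS, htS⟩ := h.2.2 s t hst heq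
        rw [h.2.1 s hsS] at hs
        rw [h.2.1 t htS]
        exact hs.trans (.of_adj hst hsS htS)
  rwa [h.2.1 v hv] at this

/-- Deleting a pendant part sends it to the vertex where it hangs. -/
theorem IsHangingRetraction.diff (h : IsHangingRetraction G S ρ) (hT : IsPendant G S a T) :
    ∃ ρ', IsHangingRetraction G (S \ T) ρ' := by
  classical
  obtain ⟨hTS, haS, haT, hedge⟩ := hT
  refine ⟨fun v => if ρ v ∈ T then a else ρ v, fun v => ?_, fun v hv => ?_, fun u v huv hne => ?_⟩
  · by_cases hv : ρ v ∈ T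
    · simpa [hv] using ⟨haS, haT⟩
    · simpa [hv] using h.1 v
  · simp [h.2.1 v hv.1, hv.2]
  · have hρ : ρ u ≠ ρ v := fun heq => hne (by simp [heq])
    obtain ⟨hu, hv⟩ := h.2.2 u v huv hρ
    simp only [h.2.1 u hu, h.2.1 v hv] at hne
    by_cases huT : u ∈ T <;> by_cases hvT : v ∈ T
    · simp [huT, hvT] at hne
    · rcases hedge u huT v hv huv with h | rfl
      · exact absurd h hvT
      · simp [huT, hvT] at hne
    · rcases hedge v hvT u hu huv.symm with h | rfl
      · exact absurd h huT
      · simp [huT, hvT] at hne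
    · exact ⟨⟨hu, huT⟩, hv, hvT⟩

theorem PruneStep.exists_isPendant [Finite V] (h : PruneStep G C S S') :
    ∃ a T, IsPendant G S a T ∧ T.Nonempty ∧ Disjoint T C ∧ S' = S \ T := by
  rcases h with ⟨v, hv, hvC, rfl⟩ | ⟨B, hB, hd, rfl⟩
  · obtain ⟨a, ha⟩ := hv.isPendant
    exact ⟨a, {v}, ha, ⟨v, rfl⟩, Set.disjoint_singleton_left.2 hvC, rfl⟩
  · obtain ⟨a, ha⟩ := hB.isPendant
    exact ⟨a, _, ha, hB.internalVertices_nonempty, hd, rfl⟩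

theorem exists_isHangingRetraction [Finite V]
    (h : Relation.ReflTransGen (PruneStep G C) Set.univ S) :
    C ⊆ S ∧ ∃ ρ, IsHangingRetraction G S ρ := by
  induction h with
  | refl => exact ⟨Set.subset_univ C, id, by simp [IsHangingRetraction]⟩
  | tail _ hstep ih =>
    obtain ⟨hCS, ρ, hρ⟩ := ih
    obtain ⟨a, T, hT, -, hTC, rfl⟩ := hstep.exists_isPendant
    exact ⟨fun c hc => ⟨hCS hc, fun hcT => Set.disjoint_left.1 hTC hcT hc⟩, hρ.diff hT⟩

theorem exists_isPruned [Finite V] (G : SimpleGraph V) (C : Set V) : ∃ S, IsPruned G C S := by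
  have key : ∀ (n : ℕ) (S : Set V), S.ncard = n →
      Relation.ReflTransGen (PruneStep G C) Set.univ S → ∃ S', IsPruned G C S' := by
    intro n
    induction n using Nat.strong_induction_on with
    | _ n ih =>
    intro S hn hS
    by_cases h : ∃ S', PruneStep G C S S'
    · obtain ⟨S', hstep⟩ := h
      obtain ⟨a, T, hT, ⟨t, ht⟩, -, rfl⟩ := hstep.exists_isPendant
      refine ih _ ?_ (S \ T) rfl (hS.tail hstep)
      rw [← hn]
      exact Set.ncard_lt_ncard ⟨Set.sdiff_subset, fun h => (h (hT.1 ht)).2 ht⟩ (Set.toFinite _)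
    · push Not at h
      exact ⟨S, hS, h⟩
  exact key _ Set.univ rfl .refl

/-- Every cover meets the part of the network that is retracted to a pendant part of `G[S]`
containing a customer. -/
theorem IsPendant.inter_nonempty_of_isCover {Y : Set V} (hT : IsPendant G S a T)
    (hρ : IsHangingRetraction G S ρ) {c : V} (hc : c ∈ C) (hcT : c ∈ T)
    (hY : IsCover (allPaths G) C Y) : (ρ ⁻¹' T ∩ Y).Nonempty := by
  obtain ⟨hTS, haS, haT, hedge⟩ := hT
  have hca : c ≠ a := fun h => haT (h ▸ hcT)
  have : Nontrivial V := ⟨c, a, hca⟩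
  obtain ⟨y, hy, hl⟩ := isCover_iff.1 hY c hc a hca
  refine ⟨y, ?_, hy⟩
  refine hl.induction (Q := fun t => ρ t ∈ T) (by rwa [hρ.2.1 c (hTS hcT)]) ?_
  intro s t _ hta hst hs
  by_cases heq : ρ s = ρ t
  · exact heq ▸ hs
  · obtain ⟨hsS, htS⟩ := hρ.2.2 s t hst heq
    rw [hρ.2.1 s hsS] at hs
    rw [hρ.2.1 t htS]
    exact (hedge s hs t htS hst).resolve_right hta

/-- The optimal covers that consist of the leaves and of one internal customer of each leaf
component of the pruned graph. -/
theorem isOptimalCover_ends [Finite V] (hG : G.Connected) (hCF : C ⊆ F)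
    (hCS : C ⊆ S) (hρ : IsHangingRetraction G S ρ) (hleaf : ∀ v, IsLeaf G S v → v ∈ C)
    (hex : (∃ v, IsLeaf G S v) ∨ ∃ B, IsLeafBlock G S B) (g : Set V → V)
    (hg : ∀ B, IsLeafBlock G S B → g B ∈ internalVertices G S B ∩ C) :
    IsOptimalCover (allPaths G) C F ({v | IsLeaf G S v} ∪ g '' {B | IsLeafBlock G S B}) := by
  classical
  set X : Set V := {v | IsLeaf G S v} ∪ g '' {B | IsLeafBlock G S B} with hX
  have hS := hρ.linked hG
  have hXC : X ⊆ C := by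
    rintro v (hv | ⟨B, hB, rfl⟩)
    exacts [hleaf v hv, (hg B hB).2]
  have hleafX : ∀ v, IsLeaf G S v → v ∈ X := fun v hv => Or.inl hv
  have hblockX : ∀ B, IsLeafBlock G S B → ∃ y ∈ X, y ∈ internalVertices G S B := fun B hB =>
    ⟨g B, Or.inr ⟨B, hB, rfl⟩, (hg B hB).1⟩
  have hnt := nontrivial_of_hits_ends hS hleafX hblockX hex
  have : Nontrivial V := let ⟨x, _, y, _, h⟩ := hnt; ⟨x, y, h⟩
  refine ⟨hXC.trans hCF, isCover_iff.2 fun c hc x hcx => ?_, fun Y _ hY => ?_⟩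
  · exact exists_linked_of_hits_ends hS (hXC.trans hCS) hleafX hblockX hnt (hCS hc) hcx
  · -- each point of `X` lies in a pendant part of its own
    have hpend : ∀ x ∈ X, ∃ T, x ∈ T ∧ (∃ a, IsPendant G S a T) ∧
        ((IsLeaf G S x ∧ T = {x}) ∨
          ∃ B, IsLeafBlock G S B ∧ x = g B ∧ T = internalVertices G S B) := by
      rintro x (hx | ⟨B, hB, rfl⟩)
      · exact ⟨{x}, rfl, IsLeaf.isPendant hx, Or.inl ⟨hx, rfl⟩⟩
      · exact ⟨_, (hg B hB).1, IsLeafBlock.isPendant hB, Or.inr ⟨B, hB, rfl, rfl⟩⟩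
    choose! T hxT hT hTx using hpend
    refine ncard_le_of_disjoint_family (fun x => ρ ⁻¹' T x) (fun x hx => ?_)
      fun x hx x' hx' hne => Disjoint.preimage ρ ?_
    · obtain ⟨a, ha⟩ := hT x hx
      exact ha.inter_nonempty_of_isCover hρ (hXC hx) (hxT x hx) hY
    · have hmix : ∀ u B, IsLeaf G S u → IsLeafBlock G S B →
          Disjoint {u} (internalVertices G S B) := fun u B hu hB =>
        Set.disjoint_singleton_left.2 fun h => not_isLeaf_of_mem_isBlock hB.1 h.1 hu
      rcases hTx x hx with ⟨hl, h⟩ | ⟨B, hB, hxB, h⟩ <;>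
        rcases hTx x' hx' with ⟨hl', h'⟩ | ⟨B', hB', hxB', h'⟩ <;> rw [h, h']
      · simpa using hne
      · exact hmix x B' hl hB'
      · exact (hmix x' B hl' hB).symm
      · refine disjoint_internalVertices hB hB' ?_
        rintro rfl
        exact hne (hxB.trans hxB'.symm)

/-- If the pruned graph has neither leaves nor leaf components, any two customers form an
optimal cover. -/
theorem isOptimalCover_pair [Finite V] (hG : G.Connected) (hCF : C ⊆ F)
    (hCS : C ⊆ S) (hρ : IsHangingRetraction G S ρ) (hleaf : ¬ ∃ v, IsLeaf G S v)
    (hblock : ¬ ∃ B, IsLeafBlock G S B) (hu : u ∈ C) (hv : v ∈ C) (huv : u ≠ v) :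
    IsOptimalCover (allPaths G) C F {u, v} := by
  have hS := hρ.linked hG
  have : Nontrivial V := ⟨u, v, huv⟩
  refine ⟨?_, isCover_iff.2 fun c hc x hcx => ?_, fun Y _ hY => ?_⟩
  · rintro _ (rfl | rfl)
    exacts [hCF hu, hCF hv]
  · refine exists_linked_of_hits_ends hS ?_ (fun v hv => absurd ⟨v, hv⟩ hleaf)
      (fun B hB => absurd ⟨B, hB⟩ hblock) (Set.nontrivial_pair huv) (hCS hc) hcx
    rintro _ (rfl | rfl)
    exacts [hCS hu, hCS hv]
  · rw [Set.ncard_pair huv]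
    exact two_le_ncard_of_isCover hu hv huv hY

theorem isOptimalCover_empty (hC : C = ∅) : IsOptimalCover (allPaths G) C F ∅ := by
  subst hC
  exact ⟨Set.empty_subset F, fun _ h => h.elim, fun Y _ _ => by simp⟩

theorem isOptimalCover_singleton [Finite V] (hCF : C ⊆ F) (hC : C = {v}) :
    IsOptimalCover (allPaths G) C F {v} := by
  subst hC
  refine ⟨hCF, fun c hc hc' => absurd hc hc', fun Y _ hY => ?_⟩
  rw [Set.ncard_singleton, Nat.one_le_iff_ne_zero, ← Nat.pos_iff_ne_zero,
    Set.ncard_pos (Set.toFinite Y)]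
  exact nonempty_of_isCover (Set.singleton_nonempty v) hY

theorem isCover_pair_of_twoConnected [Finite V] (hG : TwoConnected G Set.univ) (huv : u ≠ v) :
    IsCover (allPaths G) C {u, v} := by
  have : Nontrivial V := ⟨u, v, huv⟩
  have hdel := (twoConnected_iff.1 hG).1.2
  refine isCover_iff.2 fun c _ x hcx => ?_
  obtain ⟨y, hy, hyx⟩ := (Set.nontrivial_pair huv).exists_ne x
  exact ⟨y, hy, (hdel x c ⟨trivial, hcx⟩ y ⟨trivial, hyx⟩).mono fun w hw => hw.2⟩

theorem isCover_allPaths_of_shortestPaths {X : Set V} {w : G.Dart → ℝ}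
    (h : IsCover (shortestPaths w) C X) : IsCover (allPaths G) C X := by
  intro c hc hcX
  obtain ⟨f₁, hf₁, f₂, hf₂, h₁, h₂, p₁, hp₁, p₂, hp₂, hp⟩ := h c hc hcX
  exact ⟨f₁, hf₁, f₂, hf₂, h₁, h₂, p₁, hp₁.1, p₂, hp₂.1, hp⟩

end Pruning

/-! ### Depth-first search trees and optimal covers -/

section DFS

variable {V : Type*} {G : SimpleGraph V} {r : V} {P : V → V → Prop} {pre : V → ℕ}
  {C F X : Set V} {a b c p u v w x y z : V}

/-- `Anc P a b`: the vertex `a` is an ancestor of `b`, or `b` itself, in the forest with parent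
relation `P`, where `P a b` says that `a` is the parent of `b`. -/
abbrev Anc (P : V → V → Prop) : V → V → Prop :=
  Relation.ReflTransGen P

/-- `P` is the parent relation of a spanning tree of `G` with root `r`, numbered from the root
upwards by `pre`, such that every edge of `G` joins a vertex to one of its ancestors. -/
structure IsDFSTree (G : SimpleGraph V) (r : V) (P : V → V → Prop) (pre : V → ℕ) : Prop where
  parent_unique : ∀ {a a' b}, P a b → P a' b → a = a'
  not_parent_root : ∀ {a}, ¬ P a r
  exists_parent : ∀ {v}, v ≠ r → ∃ a, P a v
  pre_lt : ∀ {a b}, P a b → pre a < pre b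
  adj : ∀ {a b}, P a b → G.Adj a b
  anc_or_anc : ∀ {u v}, G.Adj u v → Anc P u v ∨ Anc P v u

/-- The subtree of `u`, for `u` not the root, is a component of `G` without the parent of `u`. -/
def IsCut (G : SimpleGraph V) (P : V → V → Prop) (pre : V → ℕ) (u : V) : Prop :=
  ∃ p, P p u ∧ ∀ w, Anc P u w → ∀ z, G.Adj w z → pre p ≤ pre z

/-- The subtree of `u` is a component of `G` without the parent of `u`, and it contains a
customer. -/
def IsCustomerCut (G : SimpleGraph V) (P : V → V → Prop) (pre : V → ℕ) (C : Set V) (u : V) :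
    Prop :=
  IsCut G P pre u ∧ ∃ c ∈ C, Anc P u c

/-- The subtree of `u` is minimal among those of the customer cuts. -/
def IsMinCut (G : SimpleGraph V) (P : V → V → Prop) (pre : V → ℕ) (C : Set V) (u : V) : Prop :=
  IsCustomerCut G P pre C u ∧ ∀ u', Anc P u u' → IsCustomerCut G P pre C u' → u' = u

/-- The subtree of `v` contains a customer cut. -/
def HasCut (G : SimpleGraph V) (P : V → V → Prop) (pre : V → ℕ) (C : Set V) (v : V) : Prop :=
  ∃ u, Anc P v u ∧ IsCustomerCut G P pre C u

/-- All minimal cuts lie in the subtree of `x`, and those other than `x` itself are separated from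
the root by `x`: they lie in the subtrees of children of `x` that are cuts. If there are two minimal
cuts, no customer chosen in them is in the component of the root in `G - x`. -/
def SeparatesCuts (G : SimpleGraph V) (P : V → V → Prop) (pre : V → ℕ) (C : Set V) (x : V) :
    Prop :=
  HasCut G P pre C x ∧ (∀ u, IsMinCut G P pre C u → Anc P x u) ∧
    ∀ v, P x v → HasCut G P pre C v → IsCut G P pre v

namespace IsDFSTree

variable (h : IsDFSTree G r P pre)
include h

theorem pre_le (hab : Anc P a b) : pre a ≤ pre b := by
  induction hab with
  | refl => exact le_rfl
  | tail _ hbc ih => exact ih.trans (h.pre_lt hbc).le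

theorem eq_of_anc_of_pre_le (hab : Anc P a b) (hle : pre b ≤ pre a) : a = b := by
  rcases Relation.ReflTransGen.cases_tail hab with rfl | ⟨c, hac, hcb⟩
  · rfl
  · have := h.pre_le hac
    have := h.pre_lt hcb
    lia

theorem anc_parent (hab : Anc P a b) (hne : a ≠ b) (hp : P p b) : Anc P a p := by
  rcases Relation.ReflTransGen.cases_tail hab with rfl | ⟨c, hac, hcb⟩
  · exact absurd rfl hne
  · exact h.parent_unique hcb hp ▸ hac

theorem anc_total (ha : Anc P a c) (hb : Anc P b c) : Anc P a b ∨ Anc P b a := by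
  induction ha with
  | refl => exact Or.inr hb
  | @tail d e had hde ih =>
    by_cases hbe : b = e
    · subst hbe
      exact Or.inl (had.tail hde)
    · exact ih (h.anc_parent hb hbe hde)

theorem root_anc (v : V) : Anc P r v := by
  induction hn : pre v using Nat.strong_induction_on generalizing v with
  | _ n ih =>
  by_cases hv : v = r
  · rw [hv]
  · obtain ⟨a, ha⟩ := h.exists_parent hv
    exact (ih _ (hn ▸ h.pre_lt ha) a rfl).tail ha

theorem eq_root_of_anc_root (hv : Anc P v r) : v = r := by
  rcases Relation.ReflTransGen.cases_tail hv with rfl | ⟨c, -, hc⟩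
  exacts [rfl, absurd hc h.not_parent_root]

/-- A subtree that does not contain `x` is linked without `x`. -/
theorem linked_of_anc (hux : ¬ Anc P u x) (huw : Anc P u w) : Linked G {x}ᶜ u w := by
  have hmem : ∀ y, Anc P u y → y ∈ ({x}ᶜ : Set V) := fun y hy hyx => hux (hyx ▸ hy)
  induction huw with
  | refl => exact .refl (hmem _ .refl)
  | tail hub hbc ih => exact ih.trans (.of_adj (h.adj hbc) (hmem _ hub) (hmem _ (hub.tail hbc)))

/-- The tree path from a vertex down to the root avoids every vertex that is not an ancestor. -/
theorem linked_root (hxw : ¬ Anc P x w) : Linked G {x}ᶜ w r := by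
  have : ∀ y, Anc P y w → Linked G {x}ᶜ y w := by
    intro y hy
    induction hy using Relation.ReflTransGen.head_induction_on with
    | refl => exact .refl fun hwx => hxw (by rw [Set.mem_singleton_iff.1 hwx])
    | @head b d hbd hdw ih =>
      refine (Linked.of_adj (h.adj hbd) ?_ ih.mem_left).trans ih
      rintro rfl
      exact hxw (.head hbd hdw)
  exact (this r (h.root_anc w)).symm

theorem anc_of_adj (hu : Anc P u w) (hwz : G.Adj w z) : Anc P u z ∨ Anc P z u := by
  rcases h.anc_or_anc hwz with hz | hz
  · exact Or.inl (hu.trans hz)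
  · exact h.anc_total hu hz

/-- All edges that leave the subtree of a cut end in the parent. -/
theorem anc_of_adj_isCut (hcut : IsCut G P pre u) (hpu : P p u) (hu : Anc P u w)
    (hwz : G.Adj w z) (hzp : z ≠ p) : Anc P u z := by
  obtain ⟨p', hp', hle⟩ := hcut
  obtain rfl := h.parent_unique hpu hp'
  rcases h.anc_of_adj hu hwz with hz | hz
  · exact hz
  · by_cases hzu : z = u
    · rw [hzu]
    · exact absurd (h.eq_of_anc_of_pre_le (h.anc_parent hz hzu hpu) (hle w hu z hwz)) hzp

/-- The subtree of a child `v` of `x` that is not a cut reaches the root without `x`. -/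
theorem linked_root_of_not_isCut (hxv : P x v) (hcut : ¬ IsCut G P pre v) (hvw : Anc P v w) :
    Linked G {x}ᶜ w r := by
  have hvx : ¬ Anc P v x := fun hvx => by
    have := h.pre_le hvx
    have := h.pre_lt hxv
    lia
  obtain ⟨w', hw', z, hz, hlt⟩ : ∃ w', Anc P v w' ∧ ∃ z, G.Adj w' z ∧ pre z < pre x := by
    by_contra! hno
    exact hcut ⟨x, hxv, hno⟩
  have hzx : ¬ Anc P x z := fun hxz => by
    have := h.pre_le hxz
    lia
  refine (h.linked_of_anc hvx hvw).symm.trans ((h.linked_of_anc hvx hw').trans ?_)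
  exact (Linked.of_adj hz (h.linked_of_anc hvx hw').mem_right
    (h.linked_root hzx).mem_left).trans (h.linked_root hzx)

theorem IsMinCut.disjoint (hu : IsMinCut G P pre C u) (hv : IsMinCut G P pre C v) (huv : u ≠ v)
    (huw : Anc P u w) : ¬ Anc P v w := fun hvw => by
  rcases h.anc_total huw hvw with hle | hle
  exacts [huv (hu.2 v hle hv.1).symm, huv (hv.2 u hle hu.1)]

theorem HasCut.exists_isMinCut [Finite V] (hv : HasCut G P pre C v) :
    ∃ u, Anc P v u ∧ IsMinCut G P pre C u := by
  obtain ⟨u₀, h₀⟩ := hv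
  obtain ⟨u, hu, hmax⟩ := Set.exists_max_image {u | Anc P v u ∧ IsCustomerCut G P pre C u} pre
    (Set.toFinite _) ⟨u₀, h₀⟩
  exact ⟨u, hu.1, hu.2, fun u' huu' hu' =>
    (h.eq_of_anc_of_pre_le huu' (hmax u' ⟨hu.1.trans huu', hu'⟩)).symm⟩

/-- A cover meets the subtree of every customer cut. -/
theorem exists_mem_of_isCustomerCut {Y : Set V} (hY : IsCover (allPaths G) C Y)
    (hu : IsCustomerCut G P pre C u) : ∃ y ∈ Y, Anc P u y := by
  obtain ⟨hcut, c, hc, huc⟩ := hu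
  obtain ⟨p, hpu, -⟩ := id hcut
  have hcp : c ≠ p := fun hcp => by
    have := h.pre_le (hcp ▸ huc)
    have := h.pre_lt hpu
    lia
  have : Nontrivial V := ⟨c, p, hcp⟩
  obtain ⟨y, hy, hl⟩ := isCover_iff.1 hY c hc p hcp
  exact ⟨y, hy, hl.induction huc fun s t _ htp hst hs => h.anc_of_adj_isCut hcut hpu hs hst htp⟩

theorem root_notMem (hXm : ∀ c ∈ X, ∃ u, IsMinCut G P pre C u ∧ Anc P u c ∧ c ∈ C) : r ∉ X := by
  intro hr
  obtain ⟨u, ⟨⟨⟨p, hp, -⟩, -⟩, -⟩, hur, -⟩ := hXm r hr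
  exact h.not_parent_root (h.eq_root_of_anc_root hur ▸ hp)

variable (hrC : r ∈ C) (hX : ∀ u, IsMinCut G P pre C u → ∃ c ∈ X, Anc P u c)
include hrC hX

/-- One customer from each minimal cut, together with the root if some vertex separates the cuts,
meets every component of `G - x` that contains a customer. -/
theorem isCover_of_hits [Finite V] {X' : Set V} (hXX' : X ⊆ X')
    (hroot : ¬ HasCut G P pre C r ∨ (∃ x, x ≠ r ∧ SeparatesCuts G P pre C x) → r ∈ X') :
    IsCover (allPaths G) C X' := by
  cases subsingleton_or_nontrivial V with
  | inl hsub =>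
    have hno : ¬ HasCut G P pre C r := by
      rintro ⟨u, -, ⟨p, hp, -⟩, -⟩
      exact absurd (h.pre_lt hp) (by rw [Subsingleton.elim p u]; exact lt_irrefl _)
    exact fun c _ hcX => absurd (Subsingleton.elim r c ▸ hroot (Or.inl hno)) hcX
  | inr hnt =>
  rw [isCover_iff]
  intro c hc x hcx
  -- the component of `c` in `G - x` either contains the root or is the subtree of a cut
  by_cases hroot_comp : Linked G {x}ᶜ c r
  · by_cases hr : r ∈ X'
    · exact ⟨r, hr, hroot_comp⟩
    suffices hs : ∃ y ∈ X, Linked G {x}ᶜ y r by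
      obtain ⟨y, hy, hl⟩ := hs
      exact ⟨y, hXX' hy, hroot_comp.trans hl.symm⟩
    have hxr : x ≠ r := fun hxr => hroot_comp.mem_right hxr.symm
    have hcuts : HasCut G P pre C r := by_contra fun hno => hr (hroot (Or.inl hno))
    have hsep : ¬ SeparatesCuts G P pre C x := fun hs => hr (hroot (Or.inr ⟨x, hxr, hs⟩))
    -- a minimal cut whose subtree and whose path to the root avoid `x`
    have hgood : ∀ u, IsMinCut G P pre C u → ¬ Anc P x u → ¬ Anc P u x →
        ∃ y ∈ X, Linked G {x}ᶜ y r := by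
      intro u hu hxu hux
      obtain ⟨y, hy, huy⟩ := hX u hu
      exact ⟨y, hy, (h.linked_of_anc hux huy).symm.trans (h.linked_root hxu)⟩
    have hnsep_self : ∀ u, IsMinCut G P pre C u → ∃ u', IsMinCut G P pre C u' ∧ u' ≠ u := by
      intro u hu
      by_contra! hno
      have hur : u ≠ r := by
        rintro rfl
        obtain ⟨p, hp, -⟩ := hu.1.1
        exact h.not_parent_root hp
      refine hr (hroot (Or.inr ⟨u, hur, ⟨u, .refl, hu.1⟩, fun u' hu' => ?_, ?_⟩))
      · rw [hno u' hu']
      · rintro v huv ⟨u', hvu', hu'⟩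
        have := hu.2 u' (.head huv hvu') hu'
        have h1 := h.pre_le hvu'
        have h2 := h.pre_lt huv
        rw [this] at h1
        lia
    by_cases hall : ∀ u, IsMinCut G P pre C u → Anc P x u
    · have hxcut : HasCut G P pre C x := by
        obtain ⟨u, -, hu⟩ := HasCut.exists_isMinCut h hcuts
        exact ⟨u, hall u hu, hu.1⟩
      obtain ⟨v, hxv, hv, hvcut⟩ : ∃ v, P x v ∧ HasCut G P pre C v ∧ ¬ IsCut G P pre v := by
        by_contra! hno
        exact hsep ⟨hxcut, hall, hno⟩
      obtain ⟨u, hvu, hu⟩ := HasCut.exists_isMinCut h hv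
      obtain ⟨y, hy, huy⟩ := hX u hu
      exact ⟨y, hy, h.linked_root_of_not_isCut hxv hvcut (hvu.trans huy)⟩
    · push Not at hall
      obtain ⟨u, hu, hxu⟩ := hall
      by_cases hux : Anc P u x
      · obtain ⟨u', hu', hne⟩ := hnsep_self u hu
        refine hgood u' hu' (fun hxu' => ?_) (fun hu'x => ?_)
        · exact IsMinCut.disjoint h hu' hu hne .refl (hux.trans hxu')
        · exact IsMinCut.disjoint h hu' hu hne hu'x hux
      · exact hgood u hu hxu hux
  · have hxc : Anc P x c := by_contra fun hxc => hroot_comp (h.linked_root hxc)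
    rcases Relation.ReflTransGen.cases_head hxc with rfl | ⟨v, hxv, hvc⟩
    · exact absurd rfl hcx
    have hvx : ¬ Anc P v x := fun hvx => by
      have := h.pre_le hvx
      have := h.pre_lt hxv
      lia
    have hcut : IsCut G P pre v :=
      by_contra fun hcut => hroot_comp (h.linked_root_of_not_isCut hxv hcut hvc)
    obtain ⟨u, hvu, hu⟩ := HasCut.exists_isMinCut (C := C) h ⟨v, .refl, hcut, c, hc, hvc⟩
    obtain ⟨y, hy, huy⟩ := hX u hu
    exact ⟨y, hXX' hy, (h.linked_of_anc hvx hvc).symm.trans (h.linked_of_anc hvx (hvu.trans huy))⟩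

variable (hXm : ∀ c ∈ X, ∃ u, IsMinCut G P pre C u ∧ Anc P u c ∧ c ∈ C)
  (hX1 : ∀ u, IsMinCut G P pre C u → ∀ c ∈ X, ∀ c' ∈ X, Anc P u c → Anc P u c' → c = c')
include hXm hX1

/-- The optimality of one customer per minimal cut, when the root is not needed. -/
theorem isOptimalCover_cuts [Finite V] (hCF : C ⊆ F)
    (hroot : HasCut G P pre C r ∧ ¬ ∃ x, x ≠ r ∧ SeparatesCuts G P pre C x) :
    IsOptimalCover (allPaths G) C F X := by
  refine ⟨fun c hc => ?_, ?_, fun Y _ hY => ?_⟩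
  · obtain ⟨u, -, -, hcC⟩ := hXm c hc
    exact hCF hcC
  · refine h.isCover_of_hits hrC hX subset_rfl fun h => ?_
    exact (h.elim (· hroot.1) hroot.2).elim
  · choose! m hm hmc _ using hXm
    refine ncard_le_of_disjoint_family (fun c => {w | Anc P (m c) w}) (fun c hc => ?_)
      fun c hc c' hc' hne => ?_
    · obtain ⟨y, hy, hmy⟩ := h.exists_mem_of_isCustomerCut hY (hm c hc).1
      exact ⟨y, hmy, hy⟩
    · refine Set.disjoint_left.2 fun w hw => IsMinCut.disjoint h (hm c hc) (hm c' hc') ?_ hw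
      intro heq
      exact hne (hX1 _ (hm c hc) c hc c' hc' (hmc c hc) (heq ▸ hmc c' hc'))

/-- The optimality of one customer per minimal cut and the root, when the root is needed: if two
minimal cuts are separated by `x`, the component of the root in `G - x` is disjoint from the
subtrees of all minimal cuts. -/
theorem isOptimalCover_insert_root [Finite V] (hCF : C ⊆ F)
    (hroot : ¬ HasCut G P pre C r ∨ ∃ x, x ≠ r ∧ SeparatesCuts G P pre C x) :
    IsOptimalCover (allPaths G) C F (insert r X) := by
  have hrX := h.root_notMem hXm
  refine ⟨?_, h.isCover_of_hits hrC hX (Set.subset_insert r X) fun _ => Or.inl rfl,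
    fun Y _ hY => ?_⟩
  · rintro c (rfl | hc)
    · exact hCF hrC
    · obtain ⟨u, -, -, hcC⟩ := hXm c hc
      exact hCF hcC
  rw [Set.ncard_insert_of_notMem hrX (Set.toFinite X)]
  rcases hroot with hno | ⟨x, hxr, hxcut, hall, hsep⟩
  · have hXe : X = ∅ := by
      rw [Set.eq_empty_iff_forall_notMem]
      intro c hc
      obtain ⟨u, hu, -⟩ := hXm c hc
      exact hno ⟨u, h.root_anc u, hu.1⟩
    rw [hXe, Set.ncard_empty, zero_add, Nat.one_le_iff_ne_zero, ← Nat.pos_iff_ne_zero,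
      Set.ncard_pos (Set.toFinite Y)]
    exact nonempty_of_isCover ⟨r, hrC⟩ hY
  by_cases hx : IsMinCut G P pre C x
  · -- the subtree of `x` is the only minimal cut
    have hone : ∀ c ∈ X, ∀ c' ∈ X, c = c' := by
      have : ∀ c ∈ X, Anc P x c := fun c hc => by
        obtain ⟨u, hu, huc, -⟩ := hXm c hc
        exact (hall u hu).trans huc
      exact fun c hc c' hc' => hX1 x hx c hc c' hc' (this c hc) (this c' hc')
    obtain ⟨c, hc, -⟩ := hX x hx
    have hcard : X.ncard ≤ 1 := (Set.ncard_le_one (Set.toFinite X)).2 hone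
    obtain ⟨-, -, -, hcC⟩ := hXm c hc
    have := two_le_ncard_of_isCover hcC hrC (fun hcr : c = r => hrX (hcr ▸ hc)) hY
    lia
  · have : Nontrivial V := ⟨x, r, hxr⟩
    choose! m hm hmc _ using hXm
    obtain ⟨y, hy, hyr⟩ := isCover_iff.1 hY r hrC x hxr.symm
    have hout : ∀ u, IsMinCut G P pre C u → ¬ Anc P u y := by
      intro u hu huy
      rcases Relation.ReflTransGen.cases_head (hall u hu) with rfl | ⟨v, hxv, hvu⟩
      · exact hx hu
      · have hcut := hsep v hxv ⟨u, hvu, hu.1⟩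
        have : Anc P v r := hyr.symm.induction (Q := fun t => Anc P v t) (hvu.trans huy)
          fun s t _ htx hst hs => h.anc_of_adj_isCut hcut hxv hs hst htx
        exact h.not_parent_root (h.eq_root_of_anc_root this ▸ hxv)
    have hle : X.ncard ≤ (Y \ {y}).ncard := by
      refine ncard_le_of_disjoint_family (fun c => {w | Anc P (m c) w}) (fun c hc => ?_)
        fun c hc c' hc' hne => ?_
      · obtain ⟨z, hz, hmz⟩ := h.exists_mem_of_isCustomerCut hY (hm c hc).1
        exact ⟨z, hmz, hz, fun hzy : z = y => hout _ (hm c hc) (hzy ▸ hmz)⟩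
      · refine Set.disjoint_left.2 fun w hw => IsMinCut.disjoint h (hm c hc) (hm c' hc') ?_ hw
        intro heq
        exact hne (hX1 _ (hm c hc) c hc c' hc' (hmc c hc) (heq ▸ hmc c' hc'))
    have := Set.ncard_sdiff_singleton_add_one hy (Set.toFinite Y)
    lia

end IsDFSTree
end DFS

/-! ### Reasoning about programs -/

section Programs

@[simp] theorem Memory.setReg_reg (s : Memory) (x k y : ℕ) :
    (s.setReg x k).reg y = if y = x then k else s.reg y := by
  simp [Memory.setReg, Function.update_apply]

@[simp] theorem Memory.setReg_arr (s : Memory) (x k : ℕ) : (s.setReg x k).arr = s.arr := rfl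

@[simp] theorem Memory.setArr_reg (s : Memory) (a i k : ℕ) : (s.setArr a i k).reg = s.reg := rfl

@[simp] theorem Memory.setArr_arr (s : Memory) (a i k b j : ℕ) :
    (s.setArr a i k).arr b j = if b = a ∧ j = i then k else s.arr b j := by
  by_cases hb : b = a
  · subst hb
    simp [Memory.setArr, Function.update_apply]
  · simp [Memory.setArr, hb]

/-- The program contains no loop. -/
def Program.LoopFree : Program → Prop
  | .skip | .assign _ _ | .store _ _ _ => True
  | .seq p q | .ite _ p q => p.LoopFree ∧ q.LoopFree
  | .loop _ _ => False

/-- The final memory of a loop-free program. -/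
def Program.exec : Program → Memory → Memory
  | .skip, s => s
  | .assign x e, s => s.setReg x (e.eval s)
  | .store a i e, s => s.setArr a (i.eval s) (e.eval s)
  | .seq p q, s => q.exec (p.exec s)
  | .ite e p q, s => if e.eval s ≠ 0 then p.exec s else q.exec s
  | .loop _ _, s => s

/-- An upper bound for the running time of a loop-free program. -/
def Program.cost : Program → ℕ
  | .skip => 1
  | .assign _ e => e.cost + 1
  | .store _ i e => i.cost + e.cost + 1
  | .seq p q => p.cost + q.cost
  | .ite e p q => e.cost + 1 + (p.cost + q.cost)
  | .loop _ _ => 0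

/-- The program contains an assignment to the register `x`. -/
def Program.writesReg : Program → ℕ → Bool
  | .skip, _ | .store _ _ _, _ => false
  | .assign y _, x => x == y
  | .seq p q, x | .ite _ p q, x => p.writesReg x || q.writesReg x
  | .loop _ p, x => p.writesReg x

/-- The program contains an assignment to a cell of the array `a`. -/
def Program.writesArr : Program → ℕ → Bool
  | .skip, _ | .assign _ _, _ => false
  | .store b _ _, a => a == b
  | .seq p q, a | .ite _ p q, a => p.writesArr a || q.writesArr a
  | .loop _ p, a => p.writesArr a

/-- The two memories differ at most in registers and arrays that the program assigns to. -/
structure Unchanged (p : Program) (s s' : Memory) : Prop where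
  reg : ∀ x, p.writesReg x = false → s'.reg x = s.reg x
  arr : ∀ a, p.writesArr a = false → s'.arr a = s.arr a

theorem Runs.unchanged {p : Program} {s s' : Memory} {t : ℕ} (h : Runs p s s' t) :
    Unchanged p s s' := by
  induction h with
  | skip s => exact ⟨fun _ _ => rfl, fun _ _ => rfl⟩
  | assign s x e =>
    refine ⟨fun y hy => ?_, fun _ _ => rfl⟩
    have : y ≠ x := by simpa [Program.writesReg] using hy
    simp [this]
  | store s a i e =>
    refine ⟨fun _ _ => rfl, fun b hb => ?_⟩
    have : b ≠ a := by simpa [Program.writesArr] using hb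
    simp [Memory.setArr, this]
  | seq _ _ ih₁ ih₂ =>
    constructor
    · intro x hx
      simp only [Program.writesReg, Bool.or_eq_false_iff] at hx
      rw [ih₂.reg x hx.2, ih₁.reg x hx.1]
    · intro a ha
      simp only [Program.writesArr, Bool.or_eq_false_iff] at ha
      rw [ih₂.arr a ha.2, ih₁.arr a ha.1]
  | iteTrue _ _ ih =>
    constructor
    · intro x hx
      simp only [Program.writesReg, Bool.or_eq_false_iff] at hx
      exact ih.reg x hx.1
    · intro a ha
      simp only [Program.writesArr, Bool.or_eq_false_iff] at ha
      exact ih.arr a ha.1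
  | iteFalse _ _ ih =>
    constructor
    · intro x hx
      simp only [Program.writesReg, Bool.or_eq_false_iff] at hx
      exact ih.reg x hx.2
    · intro a ha
      simp only [Program.writesArr, Bool.or_eq_false_iff] at ha
      exact ih.arr a ha.2
  | loopTrue _ _ _ ih₁ ih₂ =>
    exact ⟨fun x hx => (ih₂.reg x hx).trans (ih₁.reg x hx),
      fun a ha => (ih₂.arr a ha).trans (ih₁.arr a ha)⟩
  | loopFalse _ => exact ⟨fun _ _ => rfl, fun _ _ => rfl⟩

theorem Program.LoopFree.exists_runs {p : Program} (hp : p.LoopFree) (s : Memory) :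
    ∃ t ≤ p.cost, Runs p s (p.exec s) t := by
  induction p generalizing s with
  | skip => exact ⟨1, le_rfl, .skip s⟩
  | assign x e => exact ⟨_, le_rfl, .assign s x e⟩
  | store a i e => exact ⟨_, le_rfl, .store s a i e⟩
  | seq p q ihp ihq =>
    obtain ⟨t, ht, h⟩ := ihp hp.1 s
    obtain ⟨t', ht', h'⟩ := ihq hp.2 (p.exec s)
    exact ⟨t + t', by simp only [Program.cost]; lia, .seq h h'⟩
  | ite e p q ihp ihq =>
    by_cases he : e.eval s = 0
    · obtain ⟨t, ht, h⟩ := ihq hp.2 s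
      refine ⟨e.cost + 1 + t, by simp only [Program.cost]; lia, ?_⟩
      simpa [Program.exec, he] using Runs.iteFalse (p := p) he h
    · obtain ⟨t, ht, h⟩ := ihp hp.1 s
      refine ⟨e.cost + 1 + t, by simp only [Program.cost]; lia, ?_⟩
      simpa [Program.exec, he] using Runs.iteTrue (q := q) he h
  | loop e p => exact hp.elim

theorem Program.LoopFree.unchanged {p : Program} (hp : p.LoopFree) (s : Memory) :
    Unchanged p s (p.exec s) := by
  obtain ⟨_, -, h⟩ := hp.exists_runs s
  exact h.unchanged

/-- Started in memory `s`, the program halts after at most `T` steps, and the final memory has the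
property `Q`. -/
def Achieves (p : Program) (s : Memory) (T : ℕ) (Q : Memory → Prop) : Prop :=
  ∃ s' t, Runs p s s' t ∧ t ≤ T ∧ Q s'

theorem Program.LoopFree.achieves {p : Program} (hp : p.LoopFree) {s : Memory}
    {Q : Memory → Prop} (h : Q (p.exec s)) : Achieves p s p.cost Q := by
  obtain ⟨t, ht, hr⟩ := hp.exists_runs s
  exact ⟨_, t, hr, ht, h⟩

theorem Achieves.seq {p q : Program} {s : Memory} {T T' : ℕ} {Q Q' : Memory → Prop}
    (h : Achieves p s T Q) (h' : ∀ s', Unchanged p s s' → Q s' → Achieves q s' T' Q') :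
    Achieves (.seq p q) s (T + T') Q' := by
  obtain ⟨s₁, t, hr, ht, hQ⟩ := h
  obtain ⟨s₂, t', hr', ht', hQ'⟩ := h' s₁ hr.unchanged hQ
  exact ⟨s₂, t + t', .seq hr hr', by lia, hQ'⟩

theorem Achieves.mono {p : Program} {s : Memory} {T T' : ℕ} {Q Q' : Memory → Prop}
    (h : Achieves p s T Q) (hT : T ≤ T') (hQ : ∀ s', Unchanged p s s' → Q s' → Q' s') :
    Achieves p s T' Q' := by
  obtain ⟨s', t, hr, ht, hs⟩ := h
  exact ⟨s', t, hr, ht.trans hT, hQ s' hr.unchanged hs⟩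

theorem Achieves.iteTrue {e : Expr} {p q : Program} {s : Memory} {T : ℕ} {Q : Memory → Prop}
    (he : e.eval s ≠ 0) (h : Achieves p s T Q) : Achieves (.ite e p q) s (e.cost + 1 + T) Q := by
  obtain ⟨s', t, hr, ht, hs⟩ := h
  exact ⟨s', _, .iteTrue he hr, by lia, hs⟩

theorem Achieves.iteFalse {e : Expr} {p q : Program} {s : Memory} {T : ℕ} {Q : Memory → Prop}
    (he : e.eval s = 0) (h : Achieves q s T Q) : Achieves (.ite e p q) s (e.cost + 1 + T) Q := by
  obtain ⟨s', t, hr, ht, hs⟩ := h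
  exact ⟨s', _, .iteFalse he hr, by lia, hs⟩

/-- The rule for loops with loop-free body: `I` is an invariant and `μ` bounds the number of the
remaining iterations. -/
theorem Achieves.loop {e : Expr} {p : Program} (hp : p.LoopFree) {s : Memory}
    (I : Memory → Prop) (μ : Memory → ℕ) (hI : I s)
    (step : ∀ s', Unchanged p s s' → I s' → e.eval s' ≠ 0 →
      I (p.exec s') ∧ μ (p.exec s') < μ s') :
    Achieves (.loop e p) s (μ s * (e.cost + 1 + p.cost) + (e.cost + 1))
      (fun s' => I s' ∧ e.eval s' = 0) := by
  have key : ∀ (N : ℕ) (s' : Memory), μ s' = N → Unchanged p s s' → I s' →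
      Achieves (.loop e p) s' (N * (e.cost + 1 + p.cost) + (e.cost + 1))
        (fun s' => I s' ∧ e.eval s' = 0) := by
    intro N
    induction N using Nat.strong_induction_on with
    | _ N ih =>
    intro s' hN hun hI
    by_cases he : e.eval s' = 0
    · exact ⟨s', _, .loopFalse he, by lia, hI, he⟩
    · obtain ⟨hI', hμ⟩ := step s' hun hI he
      obtain ⟨t, ht, hr⟩ := hp.exists_runs s'
      have hun' := hr.unchanged
      obtain ⟨s'', t', hr', ht', hQ⟩ := ih _ (hN ▸ hμ) (p.exec s') rfl
        ⟨fun x hx => (hun'.reg x hx).trans (hun.reg x hx),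
          fun a ha => (hun'.arr a ha).trans (hun.arr a ha)⟩ hI'
      refine ⟨s'', _, .loopTrue he hr hr', ?_, hQ⟩
      have h1 : (μ (p.exec s') + 1) * (e.cost + 1 + p.cost) ≤ N * (e.cost + 1 + p.cost) :=
        Nat.mul_le_mul_right _ (hN ▸ hμ)
      rw [Nat.add_mul, one_mul] at h1
      lia
  exact key _ s rfl ⟨fun _ _ => rfl, fun _ _ => rfl⟩ hI

end Programs

/-! ### Depth-first search -/

section Search

variable {n : ℕ} {G : SimpleGraph (Fin n)} {r c u v w : Fin n} {off adj : ℕ → ℕ}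

/-- Adjacency lists: the entries `adj k` with `off v ≤ k < off (v + 1)` are the neighbours of
`v`. -/
structure IsAdjacency (G : SimpleGraph (Fin n)) (off adj : ℕ → ℕ) : Prop where
  mono : ∀ v : Fin n, off v ≤ off ((v : ℕ) + 1)
  entry : ∀ (v : Fin n) (k : ℕ), off v ≤ k → k < off ((v : ℕ) + 1) →
    ∃ u : Fin n, G.Adj v u ∧ adj k = u
  exists_entry : ∀ v u : Fin n, G.Adj v u →
    ∃ k : ℕ, off v ≤ k ∧ k < off ((v : ℕ) + 1) ∧ adj k = u

/-- A state of the depth-first search. The search stands at the vertex `cur - 1`, or is finished if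
`cur = 0`; it has found `cnt` vertices; `pre v` is the number of `v`, starting with `1`, or `0` if
`v` has not been found; `par v - 1` is the parent of `v`, and `par v = 0` if there is none; `ptr v`
is the index of the next entry of the list of `v`; `low v` is the least number seen from `v`; and
`ord` is the inverse of `pre`. -/
@[ext]
structure SearchState (n : ℕ) where
  cur : ℕ
  cnt : ℕ
  pre : Fin n → ℕ
  par : Fin n → ℕ
  ptr : Fin n → ℕ
  low : Fin n → ℕ
  ord : ℕ → ℕ

namespace SearchState

/-- `a` is the parent of `b` in the search tree. -/
def parent (σ : SearchState n) (a b : Fin n) : Prop :=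
  σ.par b = (a : ℕ) + 1

/-- `v` lies on the path from the root to the current vertex. -/
def Active (σ : SearchState n) (v : Fin n) : Prop :=
  ∃ c : Fin n, σ.cur = (c : ℕ) + 1 ∧ Anc σ.parent v c

/-- The search has found `v` and has left it for good. -/
def Finished (σ : SearchState n) (v : Fin n) : Prop :=
  σ.pre v ≠ 0 ∧ ¬ σ.Active v

open Classical in
/-- The number of iterations that the search may still take. -/
noncomputable def potential (σ : SearchState n) (off : ℕ → ℕ) : ℕ :=
  ∑ v : Fin n, if σ.Finished v then 0 else 1 + (off ((v : ℕ) + 1) - σ.ptr v)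

/-- The effect of looking at an entry for a vertex `u` that has been found before. -/
def look (σ : SearchState n) (c u : Fin n) : SearchState n :=
  { σ with
    ptr := Function.update σ.ptr c (σ.ptr c + 1)
    low := Function.update σ.low c (min (σ.low c) (σ.pre u)) }

/-- The effect of looking at an entry for a new vertex `u`. -/
def push (σ : SearchState n) (c u : Fin n) : SearchState n where
  cur := u + 1
  cnt := σ.cnt + 1
  pre := Function.update σ.pre u (σ.cnt + 1)
  par := Function.update σ.par u (c + 1)
  ptr := Function.update σ.ptr c (σ.ptr c + 1)
  low := Function.update σ.low u (σ.cnt + 1)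
  ord := Function.update σ.ord (σ.cnt + 1) u

/-- The effect of returning from `c` to its parent. -/
def pop (σ : SearchState n) (c : Fin n) : SearchState n :=
  { σ with cur := σ.par c }

/-- The invariant of the depth-first search. -/
structure Invariant (G : SimpleGraph (Fin n)) (off adj : ℕ → ℕ) (r : Fin n)
    (σ : SearchState n) : Prop where
  cur : σ.cur = 0 ∨ ∃ c : Fin n, σ.cur = (c : ℕ) + 1 ∧ σ.pre c ≠ 0
  root : σ.pre r = 1
  par_root : σ.par r = 0
  exists_parent : ∀ v, σ.pre v ≠ 0 → v ≠ r → ∃ a, σ.parent a v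
  par_new : ∀ v, σ.pre v = 0 → σ.par v = 0
  parent : ∀ a b, σ.parent a b → σ.pre a ≠ 0 ∧ G.Adj a b ∧ σ.pre a < σ.pre b
  ord_pre : ∀ v, σ.pre v ≠ 0 → σ.pre v ≤ σ.cnt ∧ σ.ord (σ.pre v) = v
  pre_ord : ∀ i, 1 ≤ i → i ≤ σ.cnt → ∃ v : Fin n, σ.ord i = v ∧ σ.pre v = i
  ptr : ∀ v : Fin n, off v ≤ σ.ptr v ∧ σ.ptr v ≤ off ((v : ℕ) + 1)
  ptr_new : ∀ v, σ.pre v = 0 → σ.ptr v = off v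
  scanned : ∀ (v : Fin n) (k : ℕ), off v ≤ k → k < σ.ptr v → ∀ u : Fin n, adj k = u →
    σ.pre u ≠ 0 ∧ σ.low v ≤ σ.pre u
  low_le : ∀ v, σ.pre v ≠ 0 → σ.low v ≤ σ.pre v
  low_eq : ∀ v, σ.pre v ≠ 0 → σ.low v = σ.pre v ∨
    ∃ w, G.Adj v w ∧ σ.pre w ≠ 0 ∧ σ.low v = σ.pre w
  finished : ∀ v, σ.Finished v → σ.ptr v = off ((v : ℕ) + 1)
  edge : ∀ u v, σ.pre u ≠ 0 → σ.pre v ≠ 0 → G.Adj u v →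
    Anc σ.parent u v ∨ Anc σ.parent v u

theorem active_iff {σ : SearchState n} (hc : σ.cur = (c : ℕ) + 1) :
    σ.Active v ↔ Anc σ.parent v c := by
  constructor
  · rintro ⟨c', hc', h⟩
    have : c = c' := Fin.ext (by lia)
    exact this ▸ h
  · exact fun h => ⟨c, hc, h⟩

theorem potential_lt {σ σ' : SearchState n}
    (hle : ∀ v, σ.Finished v → σ'.Finished v)
    (hptr : ∀ v, σ.ptr v ≤ σ'.ptr v)
    (hlt : ∃ v, ¬ σ.Finished v ∧ (σ'.Finished v ∨
      σ.ptr v < σ'.ptr v ∧ σ'.ptr v ≤ off ((v : ℕ) + 1))) :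
    σ'.potential off < σ.potential off := by
  refine Finset.sum_lt_sum (fun v _ => ?_) ?_
  · have := hptr v
    by_cases h : σ.Finished v
    · simp [h, hle v h]
    · by_cases h' : σ'.Finished v
      · simp [h']
      · simp only [h, h', if_false]
        lia
  · obtain ⟨v, hv, h⟩ := hlt
    refine ⟨v, Finset.mem_univ v, ?_⟩
    by_cases h' : σ'.Finished v
    · simp [hv, h']
    · have := h.resolve_left h'
      simp only [hv, h', if_false]
      lia

namespace Invariant

variable {σ : SearchState n} (h : Invariant G off adj r σ)
include h

theorem look (hcur : σ.cur = (c : ℕ) + 1) (hpre : σ.pre c ≠ 0)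
    (hptr : σ.ptr c < off ((c : ℕ) + 1)) (hu : adj (σ.ptr c) = u) (hcu : G.Adj c u)
    (hufound : σ.pre u ≠ 0) :
    Invariant G off adj r (σ.look c u) ∧ (σ.look c u).potential off < σ.potential off := by
  have hfin : ∀ v, (σ.look c u).Finished v ↔ σ.Finished v := fun v => Iff.rfl
  have hcact : ¬ σ.Finished c := fun hf => hf.2 ⟨c, hcur, .refl⟩
  have hupd : ∀ v, (σ.look c u).ptr v = if v = c then σ.ptr c + 1 else σ.ptr v := fun v => by
    simp [SearchState.look, Function.update_apply]
  have hlow : ∀ v, (σ.look c u).low v = if v = c then min (σ.low c) (σ.pre u) else σ.low v :=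
    fun v => by simp [SearchState.look, Function.update_apply]
  refine ⟨{ h with ptr := ?_, ptr_new := ?_, scanned := ?_, low_le := ?_, low_eq := ?_,
                   finished := ?_ }, ?_⟩
  · intro v
    have := h.ptr v
    rw [hupd]
    split_ifs with hv
    · subst hv
      lia
    · exact this
  · intro v hv
    rw [hupd, if_neg]
    · exact h.ptr_new v hv
    · rintro rfl
      exact hpre hv
  · intro v k hk hk' w hw
    rw [hupd] at hk'
    rw [hlow]
    split_ifs at hk' ⊢ with hv
    · subst hv
      by_cases hkp : k = σ.ptr v
      · have : w = u := Fin.ext (by rw [← hw, hkp, hu])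
        subst this
        exact ⟨hufound, min_le_right _ _⟩
      · obtain ⟨h1, h2⟩ := h.scanned v k hk (by lia) w hw
        exact ⟨h1, (min_le_left _ _).trans h2⟩
    · exact h.scanned v k hk hk' w hw
  · intro v hv
    rw [hlow]
    split_ifs with hvc
    · subst hvc
      exact (min_le_left _ _).trans (h.low_le v hv)
    · exact h.low_le v hv
  · intro v hv
    rw [hlow]
    split_ifs with hvc
    · subst hvc
      rcases min_choice (σ.low v) (σ.pre u) with hm | hm <;> rw [hm]
      · exact h.low_eq v hv
      · exact Or.inr ⟨u, hcu, hufound, rfl⟩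
    · exact h.low_eq v hv
  · intro v hv
    rw [hupd, if_neg]
    · exact h.finished v hv
    · rintro rfl
      exact hcact hv
  · refine potential_lt (fun v hv => hv) (fun v => ?_) ⟨c, hcact, Or.inr ?_⟩
    · rw [hupd]
      split_ifs with hv
      · subst hv
        lia
      · exact le_rfl
    · simp only [hupd, if_true]
      lia

theorem pop (hcur : σ.cur = (c : ℕ) + 1) (hpre : σ.pre c ≠ 0)
    (hptr : off ((c : ℕ) + 1) ≤ σ.ptr c) :
    Invariant G off adj r (σ.pop c) ∧ (σ.pop c).potential off < σ.potential off := by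
  have hple := (h.ptr c).2
  have hmono : ∀ a b, Anc σ.parent a b → σ.pre a ≤ σ.pre b := fun a b hab => by
    induction hab with
    | refl => exact le_rfl
    | tail _ hbc ih => exact ih.trans (h.parent _ _ hbc).2.2.le
  have hact : ∀ v, (σ.pop c).Active v → σ.Active v ∧ v ≠ c := by
    rintro v ⟨p, hp, hvp⟩
    refine ⟨⟨c, hcur, hvp.tail hp⟩, ?_⟩
    rintro rfl
    have h1 := hmono _ _ hvp
    have h2 := (h.parent p v hp).2.2
    have h3 : (σ.pop v).pre = σ.pre := rfl
    lia
  have hact' : ∀ v, σ.Active v → v ≠ c → (σ.pop c).Active v := by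
    intro v hv hvc
    rw [active_iff hcur] at hv
    rcases Relation.ReflTransGen.cases_tail hv with rfl | ⟨p, hvp, hp⟩
    · exact absurd rfl hvc
    · exact ⟨p, hp, hvp⟩
  refine ⟨{ h with cur := ?_, finished := ?_ }, ?_⟩
  · by_cases hcr : c = r
    · exact Or.inl (hcr ▸ h.par_root)
    · obtain ⟨a, ha⟩ := h.exists_parent c hpre hcr
      exact Or.inr ⟨a, ha, (h.parent a c ha).1⟩
  · intro v hv
    by_cases hvc : v = c
    · subst hvc
      exact le_antisymm hple hptr
    · exact h.finished v ⟨hv.1, fun ha => hv.2 (hact' v ha hvc)⟩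
  · refine potential_lt (fun v hv => ⟨hv.1, fun ha => hv.2 (hact v ha).1⟩) (fun v => le_rfl)
      ⟨c, fun hf => hf.2 ⟨c, hcur, .refl⟩, Or.inl ⟨hpre, fun ha => (hact c ha).2 rfl⟩⟩

theorem push (hG : IsAdjacency G off adj) (hcur : σ.cur = (c : ℕ) + 1) (hpre : σ.pre c ≠ 0)
    (hptr : σ.ptr c < off ((c : ℕ) + 1)) (hu : adj (σ.ptr c) = u) (hcu : G.Adj c u)
    (hunew : σ.pre u = 0) :
    Invariant G off adj r (σ.push c u) ∧ (σ.push c u).potential off < σ.potential off := by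
  have huc : u ≠ c := hcu.ne'
  have hpre' : ∀ v, (σ.push c u).pre v = if v = u then σ.cnt + 1 else σ.pre v := fun v => by
    simp [SearchState.push, Function.update_apply]
  have hpar' : ∀ v, (σ.push c u).par v = if v = u then (c : ℕ) + 1 else σ.par v := fun v => by
    simp [SearchState.push, Function.update_apply]
  have hptr' : ∀ v, (σ.push c u).ptr v = if v = c then σ.ptr c + 1 else σ.ptr v := fun v => by
    simp [SearchState.push, Function.update_apply]
  have hlow' : ∀ v, (σ.push c u).low v = if v = u then σ.cnt + 1 else σ.low v := fun v => by
    simp [SearchState.push, Function.update_apply]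
  have hord' : ∀ i, (σ.push c u).ord i = if i = σ.cnt + 1 then (u : ℕ) else σ.ord i := fun i => by
    simp [SearchState.push, Function.update_apply]
  have hcur' : (σ.push c u).cur = (u : ℕ) + 1 := rfl
  have hcnt' : (σ.push c u).cnt = σ.cnt + 1 := rfl
  have hfound : ∀ v, σ.pre v ≠ 0 → (σ.push c u).pre v = σ.pre v := fun v hv => by
    rw [hpre', if_neg]
    rintro rfl
    exact hv hunew
  have hfound_le : ∀ v, σ.pre v ≠ 0 → (σ.push c u).pre v ≠ 0 := fun v hv => by rwa [hfound v hv]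
  have hP : ∀ a b, (σ.push c u).parent a b ↔ σ.parent a b ∨ (a = c ∧ b = u) := by
    intro a b
    simp only [SearchState.parent, hpar']
    split_ifs with hb
    · subst hb
      rw [h.par_new b hunew]
      constructor
      · exact fun hac => Or.inr ⟨Fin.ext (by lia), rfl⟩
      · rintro (h0 | ⟨rfl, -⟩)
        · lia
        · rfl
    · simp [hb]
  have hstep : (σ.push c u).parent c u := (hP c u).2 (Or.inr ⟨rfl, rfl⟩)
  have hmono : ∀ a b, Anc σ.parent a b → Anc (σ.push c u).parent a b := fun a b hab =>
    Relation.ReflTransGen.mono (fun a b hab => (hP a b).2 (Or.inl hab)) a b hab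
  -- the new vertex is the end of its branch, so nothing else gets new ancestors
  have hold : ∀ a b, Anc (σ.push c u).parent a b → b ≠ u → Anc σ.parent a b := by
    intro a b hab
    induction hab with
    | refl => exact fun _ => .refl
    | @tail b d hab hbd ih =>
      intro hd
      have hbd' := ((hP b d).1 hbd).resolve_right fun h => hd h.2
      refine (ih ?_).tail hbd'
      rintro rfl
      exact (h.parent b d hbd').1 hunew
  have hact : ∀ v, (σ.push c u).Active v ↔ v = u ∨ σ.Active v := by
    intro v
    rw [active_iff hcur, active_iff (σ := σ.push c u) hcur']
    constructor
    · intro hv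
      rcases Relation.ReflTransGen.cases_tail hv with rfl | ⟨b, hvb, hbu⟩
      · exact Or.inl rfl
      · rcases (hP b u).1 hbu with hb | ⟨rfl, -⟩
        · have := (h.parent b u hb).2.2
          lia
        · exact Or.inr (hold v b hvb huc.symm)
    · rintro (rfl | hv)
      · exact .refl
      · exact (hmono v c hv).tail hstep
  have hfin : ∀ v, (σ.push c u).Finished v ↔ σ.Finished v := by
    intro v
    simp only [SearchState.Finished, hact, not_or]
    constructor
    · rintro ⟨h1, h2, h3⟩
      rw [hpre', if_neg h2] at h1
      exact ⟨h1, h3⟩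
    · rintro ⟨h1, h2⟩
      refine ⟨hfound_le v h1, ?_, h2⟩
      rintro rfl
      exact h1 hunew
  have hcact : ¬ σ.Finished c := fun hf => hf.2 ⟨c, hcur, .refl⟩
  -- the neighbours of the new vertex that have been found are active
  have hnb : ∀ w, σ.pre w ≠ 0 → G.Adj u w → Anc (σ.push c u).parent w u := by
    intro w hw huw
    by_cases hf : σ.Finished w
    · obtain ⟨k, hk1, hk2, hk3⟩ := hG.exists_entry w u huw.symm
      exact absurd hunew (h.scanned w k hk1 (by rw [h.finished w hf]; exact hk2) u hk3).1
    · have hwa : σ.Active w := by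
        by_contra hwa
        exact hf ⟨hw, hwa⟩
      exact (active_iff (σ := σ.push c u) hcur').1 ((hact w).2 (Or.inr hwa))
  have hcnt : ∀ v, σ.pre v ≤ σ.cnt := fun v => by
    by_cases hv : σ.pre v = 0
    · lia
    · exact (h.ord_pre v hv).1
  refine ⟨{ cur := ?_, root := ?_, par_root := ?_, exists_parent := ?_, par_new := ?_,
            parent := ?_, ord_pre := ?_, pre_ord := ?_, ptr := ?_, ptr_new := ?_, scanned := ?_,
            low_le := ?_, low_eq := ?_, finished := ?_, edge := ?_ }, ?_⟩
  · exact Or.inr ⟨u, hcur', by simp [hpre']⟩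
  · rw [hfound r (by rw [h.root]; exact one_ne_zero)]
    exact h.root
  · rw [hpar', if_neg]
    · exact h.par_root
    · rintro rfl
      exact absurd (h.root.symm.trans hunew) one_ne_zero
  · intro v hv hvr
    by_cases hvu : v = u
    · exact ⟨c, hvu ▸ hstep⟩
    · rw [hpre', if_neg hvu] at hv
      obtain ⟨a, ha⟩ := h.exists_parent v hv hvr
      exact ⟨a, (hP a v).2 (Or.inl ha)⟩
  · intro v hv
    rw [hpre'] at hv
    split_ifs at hv with hvu
    rw [hpar', if_neg hvu]
    exact h.par_new v hv
  · intro a b hab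
    rcases (hP a b).1 hab with hab | ⟨rfl, rfl⟩
    · obtain ⟨h1, h2, h3⟩ := h.parent a b hab
      exact ⟨hfound_le a h1, h2, by rwa [hfound a h1, hfound b (by lia)]⟩
    · refine ⟨hfound_le a hpre, hcu, ?_⟩
      have := hcnt a
      rw [hfound a hpre, hpre', if_pos rfl]
      lia
  · intro v hv
    by_cases hvu : v = u
    · subst hvu
      simp [hpre', hord', hcnt']
    · rw [hpre', if_neg hvu] at hv ⊢
      obtain ⟨h1, h2⟩ := h.ord_pre v hv
      refine ⟨by lia, ?_⟩
      rw [hord', if_neg (by lia)]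
      exact h2
  · intro i h1 hi
    by_cases hic : i = σ.cnt + 1
    · exact ⟨u, by simp [hord', hic], by simp [hpre', hic]⟩
    · obtain ⟨v, hv, hvi⟩ := h.pre_ord i h1 (by lia)
      refine ⟨v, ?_, ?_⟩
      · rw [hord', if_neg hic]
        exact hv
      · rw [hfound v (by lia)]
        exact hvi
  · intro v
    have := h.ptr v
    rw [hptr']
    split_ifs with hv
    · subst hv
      lia
    · exact this
  · intro v hv
    rw [hpre'] at hv
    split_ifs at hv with hvu
    rw [hptr', if_neg]
    · exact h.ptr_new v hv
    · rintro rfl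
      exact hpre hv
  · intro v k hk hk' w hw
    rw [hptr'] at hk'
    by_cases hvu : v = u
    · subst hvu
      rw [if_neg huc, h.ptr_new v hunew] at hk'
      lia
    rw [hlow', if_neg hvu]
    have hcase : (v = c ∧ w = u) ∨ (σ.pre w ≠ 0 ∧ σ.low v ≤ σ.pre w) := by
      split_ifs at hk' with hv
      · subst hv
        by_cases hkp : k = σ.ptr v
        · exact Or.inl ⟨rfl, Fin.ext (by rw [← hw, hkp, hu])⟩
        · exact Or.inr (h.scanned v k hk (by lia) w hw)
      · exact Or.inr (h.scanned v k hk hk' w hw)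
    rcases hcase with ⟨rfl, rfl⟩ | ⟨h1, h2⟩
    · have h3 := h.low_le v hpre
      have h4 := hcnt v
      rw [hpre', if_pos rfl]
      exact ⟨by lia, by lia⟩
    · exact ⟨hfound_le w h1, by rwa [hfound w h1]⟩
  · intro v hv
    rw [hlow']
    split_ifs with hvu
    · simp [hpre', hvu]
    · rw [hpre', if_neg hvu] at hv ⊢
      exact h.low_le v hv
  · intro v hv
    rw [hlow']
    split_ifs with hvu
    · simp [hpre', hvu]
    · rw [hpre', if_neg hvu] at hv ⊢
      rcases h.low_eq v hv with heq | ⟨w, hvw, hw, heq⟩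
      · exact Or.inl heq
      · exact Or.inr ⟨w, hvw, hfound_le w hw, by rw [hfound w hw]; exact heq⟩
  · intro v hv
    rw [hfin] at hv
    rw [hptr', if_neg]
    · exact h.finished v hv
    · rintro rfl
      exact hcact hv
  · intro v w hv hw hvw
    by_cases hvu : v = u
    · subst hvu
      rw [hpre', if_neg hvw.ne'] at hw
      exact Or.inr (hnb w hw hvw)
    · rw [hpre', if_neg hvu] at hv
      by_cases hwu : w = u
      · subst hwu
        exact Or.inl (hnb v hv hvw.symm)
      · rw [hpre', if_neg hwu] at hw
        exact (h.edge v w hv hw hvw).imp (hmono v w) (hmono w v)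
  · refine potential_lt (fun v hv => (hfin v).2 hv) (fun v => ?_) ⟨c, hcact, Or.inr ?_⟩
    · rw [hptr']
      split_ifs with hv
      · subst hv
        lia
      · exact le_rfl
    · simp only [hptr', if_true]
      lia

/-- When the search is finished, it has found a depth-first search tree of a connected graph. -/
theorem isDFSTree (hG : IsAdjacency G off adj) (hconn : G.Connected) (hcur : σ.cur = 0) :
    (∀ v, σ.pre v ≠ 0) ∧ IsDFSTree G r σ.parent σ.pre ∧
      ∀ v w, G.Adj v w → σ.low v ≤ σ.pre w := by
  have hfin : ∀ v, σ.pre v ≠ 0 → σ.Finished v := fun v hv => by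
    refine ⟨hv, ?_⟩
    rintro ⟨c, hc, -⟩
    lia
  have hscan : ∀ v w, σ.pre v ≠ 0 → G.Adj v w → σ.pre w ≠ 0 ∧ σ.low v ≤ σ.pre w := by
    intro v w hv hvw
    obtain ⟨k, hk1, hk2, hk3⟩ := hG.exists_entry v w hvw
    exact h.scanned v k hk1 (by rw [h.finished v (hfin v hv)]; exact hk2) w hk3
  have hall : ∀ v, σ.pre v ≠ 0 := fun v =>
    (linked_univ_of_connected hconn r v).induction (by rw [h.root]; exact one_ne_zero)
      fun s t _ _ hst hs => (hscan s t hs hst).1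
  refine ⟨hall, ⟨fun {a a' b} hab hab' => ?_, fun {a} ha => ?_, fun hv => ?_, fun hab => ?_,
    fun hab => ?_, fun huv => ?_⟩, fun v w hvw => (hscan v w (hall v) hvw).2⟩
  · have h1 : σ.par b = (a : ℕ) + 1 := hab
    have h2 : σ.par b = (a' : ℕ) + 1 := hab'
    exact Fin.ext (by lia)
  · have h1 : σ.par r = (a : ℕ) + 1 := ha
    rw [h.par_root] at h1
    lia
  · exact h.exists_parent _ (hall _) hv
  · exact (h.parent _ _ hab).2.2
  · exact (h.parent _ _ hab).2.1
  · exact h.edge _ _ (hall _) (hall _) huv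

end Invariant
end SearchState
end Search

/-! ### Collecting the minimal cuts -/

section Sweep

variable {n : ℕ} {G : SimpleGraph (Fin n)} {r p u v w : Fin n} {P : Fin n → Fin n → Prop}
  {pre lo : Fin n → ℕ} {C : Set (Fin n)} {i : ℕ}

/-- The data that are collected for each vertex `v` by a sweep over the vertices from the last one
found to the first one: `low v` is the least number adjacent to the subtree of `v`, `cand v - 1` is
a customer in that subtree (and `cand v = 0` if there is none), `done v`, `multi v` and `nc v` tell
whether there are a customer cut in the subtree, two children of `v` with a customer cut in their
subtrees, and such a child that is not itself a cut, and `chosen v` marks the customers chosen in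
the minimal cuts. -/
@[ext]
structure SweepState (n : ℕ) where
  low : Fin n → ℕ
  cand : Fin n → ℕ
  done : Fin n → ℕ
  multi : Fin n → ℕ
  nc : Fin n → ℕ
  chosen : Fin n → ℕ

namespace SweepState

/-- A customer is chosen in the subtree of `v`, where `k` is the number of the parent of `v`. -/
def Selects (σ : SweepState n) (v : Fin n) (k : ℕ) : Prop :=
  σ.cand v ≠ 0 ∧ ¬ σ.low v < k ∧ σ.done v = 0

open Classical in
/-- The effect of processing the vertex `v` with parent `p`, where `k` is the number of `p`. -/
noncomputable def step (σ : SweepState n) (v p : Fin n) (k : ℕ) : SweepState n where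
  low w := if w = p then min (σ.low p) (σ.low v) else σ.low w
  cand w := if w = p ∧ σ.cand v ≠ 0 then σ.cand v else σ.cand w
  done w := if w = p ∧ (σ.done v ≠ 0 ∨ σ.Selects v k) ∨ w = v ∧ σ.Selects v k then 1 else σ.done w
  multi w := if w = p ∧ (σ.done v ≠ 0 ∨ σ.Selects v k) ∧ σ.done p ≠ 0 then 1 else σ.multi w
  nc w := if w = p ∧ (σ.done v ≠ 0 ∨ σ.Selects v k) ∧ σ.low v < k then 1 else σ.nc w
  chosen w := if (w : ℕ) = σ.cand v - 1 ∧ σ.Selects v k then 1 else σ.chosen w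

/-- The invariant of the sweep when the vertices with numbers above `i` have been processed. -/
structure Invariant (G : SimpleGraph (Fin n)) (P : Fin n → Fin n → Prop) (pre lo : Fin n → ℕ)
    (C : Set (Fin n)) (i : ℕ) (σ : SweepState n) : Prop where
  low_self : ∀ v, σ.low v ≤ lo v
  low_child : ∀ v u, P v u → i < pre u → ∀ w, Anc P u w → σ.low v ≤ lo w
  low_eq : ∀ v, ∃ w, Anc P v w ∧ σ.low v = lo w
  cand_eq_zero : ∀ v, σ.cand v = 0 ↔
    v ∉ C ∧ ∀ u, P v u → i < pre u → ∀ c ∈ C, ¬ Anc P u c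
  cand_ne_zero : ∀ v, σ.cand v ≠ 0 → ∃ c ∈ C, Anc P v c ∧ σ.cand v = (c : ℕ) + 1
  done : ∀ v, σ.done v ≠ 0 ↔ (i < pre v ∧ IsCustomerCut G P pre C v) ∨
    ∃ u, P v u ∧ i < pre u ∧ HasCut G P pre C u
  multi : ∀ v, σ.multi v ≠ 0 ↔ ∃ u u', u ≠ u' ∧ (P v u ∧ i < pre u ∧ HasCut G P pre C u) ∧
    (P v u' ∧ i < pre u' ∧ HasCut G P pre C u')
  nc : ∀ v, σ.nc v ≠ 0 ↔ ∃ u, P v u ∧ i < pre u ∧ HasCut G P pre C u ∧ ¬ IsCut G P pre u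
  exists_chosen : ∀ u, IsMinCut G P pre C u → i < pre u → ∃ c, σ.chosen c = 1 ∧ Anc P u c
  of_chosen : ∀ c, σ.chosen c = 1 →
    ∃ u, IsMinCut G P pre C u ∧ i < pre u ∧ Anc P u c ∧ c ∈ C
  chosen_unique : ∀ u, IsMinCut G P pre C u → ∀ c c', σ.chosen c = 1 → σ.chosen c' = 1 →
    Anc P u c → Anc P u c' → c = c'

end SweepState

theorem or_and_not_iff {a q : Prop} : q ∨ a ∧ ¬ q ↔ a ∨ q := by
  tauto

theorem ite_one_ne_zero_iff {a : Prop} [Decidable a] {k : ℕ} :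
    (if a then 1 else k) ≠ 0 ↔ k ≠ 0 ∨ a := by
  split_ifs with h <;> simp [h]

theorem hasCut_iff : HasCut G P pre C v ↔
    IsCustomerCut G P pre C v ∨ ∃ u, P v u ∧ HasCut G P pre C u := by
  constructor
  · rintro ⟨u, hvu, hu⟩
    rcases Relation.ReflTransGen.cases_head hvu with rfl | ⟨w, hvw, hwu⟩
    exacts [Or.inl hu, Or.inr ⟨w, hvw, u, hwu, hu⟩]
  · rintro (hv | ⟨u, hvu, w, huw, hw⟩)
    exacts [⟨v, .refl, hv⟩, ⟨w, .head hvu huw, hw⟩]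

theorem exists_customer_iff : (∃ c ∈ C, Anc P v c) ↔ v ∈ C ∨ ∃ u, P v u ∧ ∃ c ∈ C, Anc P u c := by
  constructor
  · rintro ⟨c, hc, hvc⟩
    rcases Relation.ReflTransGen.cases_head hvc with rfl | ⟨w, hvw, hwc⟩
    exacts [Or.inl hc, Or.inr ⟨w, hvw, c, hc, hwc⟩]
  · rintro (hv | ⟨u, hvu, c, hc, huc⟩)
    exacts [⟨v, hv, .refl⟩, ⟨c, hc, .head hvu huc⟩]

theorem IsDFSTree.isMinCut_iff (h : IsDFSTree G r P pre) : IsMinCut G P pre C v ↔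
    IsCustomerCut G P pre C v ∧ ¬ ∃ u, P v u ∧ HasCut G P pre C u := by
  refine and_congr_right fun _ => ⟨?_, ?_⟩
  · rintro hmin ⟨u, hvu, w, huw, hw⟩
    have h1 := h.pre_lt hvu
    have h2 := h.pre_le huw
    rw [hmin w (.head hvu huw) hw] at h2
    lia
  · intro hno u hvu hu
    rcases Relation.ReflTransGen.cases_head hvu with rfl | ⟨w, hvw, hwu⟩
    · rfl
    · exact absurd ⟨w, hvw, u, hwu, hu⟩ hno

section Step

variable (h : IsDFSTree G r P pre) (hinj : Function.Injective pre)
  (hlo : ∀ v w, G.Adj v w → lo v ≤ pre w)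
  (hlo' : ∀ v, lo v = pre v ∨ ∃ w, G.Adj v w ∧ lo v = pre w)
include h hinj hlo hlo'

theorem SweepState.Invariant.step {σ : SweepState n} (hσ : σ.Invariant G P pre lo C i)
    (hv : pre v = i) (hpv : P p v) :
    (σ.step v p (pre p)).Invariant G P pre lo C (i - 1) := by
  have hpi : pre p < i := hv ▸ h.pre_lt hpv
  have hpv' : p ≠ v := by
    rintro rfl
    exact absurd (h.pre_lt hpv) (lt_irrefl _)
  have hchild : ∀ u, P v u → i < pre u := fun u hvu => hv ▸ h.pre_lt hvu
  have hlt : ∀ u, i - 1 < pre u ↔ i < pre u ∨ u = v := by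
    intro u
    have : pre u = i ↔ u = v := ⟨fun hu => hinj (hu.trans hv.symm), fun hu => hu ▸ hv⟩
    rw [← this]
    lia
  -- processing `v` adds the child `v` of `p` to the children seen so far
  have hadd : ∀ (Q : Fin n → Prop) w, (∃ u, P w u ∧ i - 1 < pre u ∧ Q u) ↔
      (∃ u, P w u ∧ i < pre u ∧ Q u) ∨ (w = p ∧ Q v) := by
    intro Q w
    constructor
    · rintro ⟨u, hwu, hu, hQ⟩
      rcases (hlt u).1 hu with hu | rfl
      · exact Or.inl ⟨u, hwu, hu, hQ⟩
      · exact Or.inr ⟨h.parent_unique hwu hpv, hQ⟩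
    · rintro (⟨u, hwu, hu, hQ⟩ | ⟨rfl, hQ⟩)
      · exact ⟨u, hwu, (hlt u).2 (Or.inl hu), hQ⟩
      · exact ⟨v, hpv, (hlt v).2 (Or.inr rfl), hQ⟩
  have hlow : ∀ w, Anc P v w → σ.low v ≤ lo w := by
    intro w hvw
    rcases Relation.ReflTransGen.cases_head hvw with rfl | ⟨u, hvu, huw⟩
    · exact hσ.low_self _
    · exact hσ.low_child v u hvu (hchild u hvu) w huw
  have hcut : ¬ σ.low v < pre p ↔ IsCut G P pre v := by
    rw [not_lt]
    constructor
    · exact fun hle => ⟨p, hpv, fun w hvw z hwz => (hle.trans (hlow w hvw)).trans (hlo w z hwz)⟩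
    · rintro ⟨p', hp', hle⟩
      obtain rfl := h.parent_unique hpv hp'
      obtain ⟨w, hvw, hw⟩ := hσ.low_eq v
      rw [hw]
      rcases hlo' w with heq | ⟨z, hwz, heq⟩ <;> rw [heq]
      · exact (h.pre_lt hpv).le.trans (h.pre_le hvw)
      · exact hle w hvw z hwz
  have hcand : σ.cand v ≠ 0 ↔ ∃ c ∈ C, Anc P v c := by
    rw [Ne, hσ.cand_eq_zero, exists_customer_iff, not_and_or, not_not]
    refine or_congr_right ?_
    push Not
    exact ⟨fun ⟨u, hvu, _, hc⟩ => ⟨u, hvu, hc⟩, fun ⟨u, hvu, hc⟩ => ⟨u, hvu, hchild u hvu, hc⟩⟩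
  have hdone : σ.done v ≠ 0 ↔ ∃ u, P v u ∧ HasCut G P pre C u := by
    rw [hσ.done, hv]
    constructor
    · rintro (⟨hlt, -⟩ | ⟨u, hvu, -, hu⟩)
      exacts [absurd hlt (lt_irrefl i), ⟨u, hvu, hu⟩]
    · exact fun ⟨u, hvu, hu⟩ => Or.inr ⟨u, hvu, hchild u hvu, hu⟩
  have hsel : σ.Selects v (pre p) ↔ IsMinCut G P pre C v := by
    rw [h.isMinCut_iff, ← hdone, SweepState.Selects, hcut, hcand, IsCustomerCut, not_not,
      ← and_assoc, and_comm (a := ∃ c ∈ C, Anc P v c)]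
  have hhas : σ.done v ≠ 0 ∨ IsMinCut G P pre C v ↔ HasCut G P pre C v := by
    rw [hasCut_iff, hdone, h.isMinCut_iff, or_and_not_iff]
  have hpdone : σ.done p ≠ 0 ↔ ∃ u, P p u ∧ i < pre u ∧ HasCut G P pre C u := by
    rw [hσ.done]
    exact or_iff_right fun hlt => absurd hlt.1 (by lia)
  refine ⟨?_, ?_, ?_, ?_, ?_, ?_, ?_, ?_, ?_, ?_, ?_⟩
  · intro w
    simp only [SweepState.step]
    split_ifs with hw
    · subst hw
      exact (min_le_left _ _).trans (hσ.low_self w)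
    · exact hσ.low_self w
  · intro w u hwu hu z huz
    simp only [SweepState.step]
    rcases (hlt u).1 hu with hu | rfl
    · split_ifs with hw
      · exact (min_le_left _ _).trans (hσ.low_child p u (hw ▸ hwu) hu z huz)
      · exact hσ.low_child w u hwu hu z huz
    · rw [if_pos (h.parent_unique hwu hpv)]
      exact (min_le_right _ _).trans (hlow z huz)
  · intro w
    simp only [SweepState.step]
    split_ifs with hw
    · subst hw
      rcases min_choice (σ.low w) (σ.low v) with hm | hm <;> rw [hm]
      · exact hσ.low_eq w
      · obtain ⟨z, hz, heq⟩ := hσ.low_eq v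
        exact ⟨z, .head hpv hz, heq⟩
    · exact hσ.low_eq w
  · intro w
    have key : (∀ u, P w u → i - 1 < pre u → ∀ c ∈ C, ¬ Anc P u c) ↔
        (∀ u, P w u → i < pre u → ∀ c ∈ C, ¬ Anc P u c) ∧ ¬ (w = p ∧ σ.cand v ≠ 0) := by
      have hnot : ∀ k, (∀ u, P w u → k < pre u → ∀ c ∈ C, ¬ Anc P u c) ↔
          ¬ ∃ u, P w u ∧ k < pre u ∧ ∃ c ∈ C, Anc P u c := fun k => by
        push Not
        rfl
      rw [hnot, hnot, hadd, hcand, not_or]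
    rw [key, ← and_assoc, ← hσ.cand_eq_zero]
    simp only [SweepState.step]
    split_ifs with hw
    · simp [hw]
    · simp [hw]
  · intro w hw
    simp only [SweepState.step] at hw ⊢
    split_ifs at hw ⊢ with hwp
    · obtain ⟨c, hc, hvc, heq⟩ := hσ.cand_ne_zero v hw
      exact ⟨c, hc, hwp.1 ▸ .head hpv hvc, heq⟩
    · exact hσ.cand_ne_zero w hw
  · intro w
    rw [hadd, hlt]
    have hd : (σ.step v p (pre p)).done w ≠ 0 ↔
        σ.done w ≠ 0 ∨ (w = p ∧ HasCut G P pre C v) ∨ (w = v ∧ IsMinCut G P pre C v) := by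
      simp only [SweepState.step, ite_one_ne_zero_iff, hsel, hhas]
    rw [hd, hσ.done]
    constructor
    · rintro ((⟨hw, hc⟩ | hc) | hc | ⟨rfl, hc⟩)
      exacts [Or.inl ⟨Or.inl hw, hc⟩, Or.inr (Or.inl hc), Or.inr (Or.inr hc),
        Or.inl ⟨Or.inr rfl, hc.1⟩]
    · rintro (⟨hw | rfl, hc⟩ | hc | hc)
      · exact Or.inl (Or.inl ⟨hw, hc⟩)
      · by_cases hch : ∃ u, P w u ∧ HasCut G P pre C u
        · obtain ⟨u, hwu, hu⟩ := hch
          exact Or.inl (Or.inr ⟨u, hwu, hchild u hwu, hu⟩)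
        · exact Or.inr (Or.inr ⟨rfl, h.isMinCut_iff.2 ⟨hc, hch⟩⟩)
      · exact Or.inl (Or.inr hc)
      · exact Or.inr (Or.inl hc)
  · intro w
    have hm : (σ.step v p (pre p)).multi w ≠ 0 ↔
        σ.multi w ≠ 0 ∨ (w = p ∧ HasCut G P pre C v ∧
          ∃ u, P p u ∧ i < pre u ∧ HasCut G P pre C u) := by
      simp only [SweepState.step, ite_one_ne_zero_iff, hsel, hhas, hpdone]
    rw [hm, hσ.multi]
    constructor
    · rintro (⟨u, u', hne, ⟨h1, h2, h3⟩, h4, h5, h6⟩ | ⟨rfl, hc, u, hwu, hu, huc⟩)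
      · exact ⟨u, u', hne, ⟨h1, (hlt u).2 (Or.inl h2), h3⟩, h4, (hlt u').2 (Or.inl h5), h6⟩
      · refine ⟨v, u, ?_, ⟨hpv, (hlt v).2 (Or.inr rfl), hc⟩, hwu, (hlt u).2 (Or.inl hu), huc⟩
        rintro rfl
        lia
    · rintro ⟨u, u', hne, ⟨h1, h2, h3⟩, h4, h5, h6⟩
      rcases (hlt u).1 h2 with h2 | rfl <;> rcases (hlt u').1 h5 with h5 | rfl
      · exact Or.inl ⟨u, u', hne, ⟨h1, h2, h3⟩, h4, h5, h6⟩
      · obtain rfl := h.parent_unique h4 hpv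
        exact Or.inr ⟨rfl, h6, u, h1, h2, h3⟩
      · obtain rfl := h.parent_unique h1 hpv
        exact Or.inr ⟨rfl, h3, u', h4, h5, h6⟩
      · exact absurd rfl hne
  · intro w
    rw [hadd (fun u => HasCut G P pre C u ∧ ¬ IsCut G P pre u), ← hσ.nc, ← hcut, not_not]
    simp only [SweepState.step, ite_one_ne_zero_iff, hsel, hhas]
  · intro u hu hlt'
    rcases (hlt u).1 hlt' with hlt' | rfl
    · obtain ⟨c, hc, huc⟩ := hσ.exists_chosen u hu hlt'
      refine ⟨c, ?_, huc⟩
      simp only [SweepState.step, hc, ite_self]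
    · obtain ⟨c, hc, huc, heq⟩ := hσ.cand_ne_zero u (hcand.2 hu.1.2)
      exact ⟨c, by simp [SweepState.step, heq, hsel, hu], huc⟩
  · intro c hc
    simp only [SweepState.step] at hc
    split_ifs at hc with hcs
    · obtain ⟨c', hc', huc, heq⟩ := hσ.cand_ne_zero v hcs.2.1
      have : c = c' := Fin.ext (by lia)
      subst this
      exact ⟨v, hsel.1 hcs.2, (hlt v).2 (Or.inr rfl), huc, hc'⟩
    · obtain ⟨u, hu, hlt', huc, hcC⟩ := hσ.of_chosen c hc
      exact ⟨u, hu, (hlt u).2 (Or.inl hlt'), huc, hcC⟩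
  · -- the customer chosen for `v` is not in the subtree of another minimal cut
    have hnew : ∀ c, (σ.step v p (pre p)).chosen c = 1 →
        σ.chosen c = 1 ∨ (IsMinCut G P pre C v ∧ Anc P v c ∧ (c : ℕ) = σ.cand v - 1) := by
      intro c hc
      simp only [SweepState.step] at hc
      split_ifs at hc with hcs
      · obtain ⟨c', hc', huc, heq⟩ := hσ.cand_ne_zero v hcs.2.1
        have : c = c' := Fin.ext (by lia)
        exact Or.inr ⟨hsel.1 hcs.2, this ▸ huc, hcs.1⟩
      · exact Or.inl hc
    have hsep : ∀ u, IsMinCut G P pre C u → ∀ c c', σ.chosen c = 1 → IsMinCut G P pre C v →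
        Anc P v c' → Anc P u c → Anc P u c' → False := by
      intro u hu c c' hc hvm hvc' huc huc'
      obtain ⟨u', hu', hlt', hu'c, -⟩ := hσ.of_chosen c hc
      have h1 : u = v := by
        by_contra hne
        exact IsDFSTree.IsMinCut.disjoint h hu hvm hne huc' hvc'
      have h2 : u = u' := by
        by_contra hne
        exact IsDFSTree.IsMinCut.disjoint h hu hu' hne huc hu'c
      rw [← h2, h1, hv] at hlt'
      exact lt_irrefl i hlt'
    intro u hu c c' hc hc' huc huc'
    rcases hnew c hc with hc | ⟨hvm, hvc, hcv⟩ <;> rcases hnew c' hc' with hc' | ⟨hvm', hvc', hcv'⟩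
    · exact hσ.chosen_unique u hu c c' hc hc' huc huc'
    · exact (hsep u hu c c' hc hvm' hvc' huc huc').elim
    · exact (hsep u hu c' c hc' hvm hvc huc' huc).elim
    · exact Fin.ext (hcv.trans hcv'.symm)

end Step

/-- The invariant of the sweep that looks for a vertex separating the minimal cuts, from the first
vertex found to the last one, when the vertices with numbers below `i` have been processed: `out v`
tells whether some minimal cut is outside the subtree of `v`. -/
structure SeparatorInvariant (G : SimpleGraph (Fin n)) (r : Fin n) (P : Fin n → Fin n → Prop)
    (pre : Fin n → ℕ) (C : Set (Fin n)) (i : ℕ) (out : Fin n → ℕ) (flag : ℕ) : Prop where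
  out_iff : ∀ v, HasCut G P pre C v → v ≠ r → pre v < i →
    (out v ≠ 0 ↔ ∃ u, IsMinCut G P pre C u ∧ ¬ Anc P v u)
  out_root : out r = 0
  out_new : ∀ v, i ≤ pre v → out v = 0
  flag_iff : flag ≠ 0 ↔ ∃ v, v ≠ r ∧ pre v < i ∧ SeparatesCuts G P pre C v

theorem SeparatorInvariant.step (h : IsDFSTree G r P pre) (hinj : Function.Injective pre)
    {out : Fin n → ℕ} {flag : ℕ} (hs : SeparatorInvariant G r P pre C i out flag)
    (hv : pre v = i) (hpv : P p v) {multi nc : Fin n → ℕ}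
    (hmulti : multi p ≠ 0 ↔ ∃ u u', u ≠ u' ∧ (P p u ∧ HasCut G P pre C u) ∧
      (P p u' ∧ HasCut G P pre C u'))
    (hnc : nc v ≠ 0 ↔ ∃ u, P v u ∧ HasCut G P pre C u ∧ ¬ IsCut G P pre u)
    {out' : Fin n → ℕ} {flag' : ℕ}
    (hout' : ∀ w, w ≠ v → out' w = out w)
    (hv' : out' v ≠ 0 ↔ HasCut G P pre C v ∧ (out p ≠ 0 ∨ multi p ≠ 0))
    (hflag' : flag' ≠ 0 ↔
      flag ≠ 0 ∨ (HasCut G P pre C v ∧ ¬ (out p ≠ 0 ∨ multi p ≠ 0) ∧ nc v = 0)) :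
    SeparatorInvariant G r P pre C (i + 1) out' flag' := by
  have hvr : v ≠ r := by
    rintro rfl
    exact h.not_parent_root hpv
  have hsib : ∀ u, P p u → u ≠ v → ∀ w, Anc P u w → ¬ Anc P v w := by
    intro u hpu huv w huw hvw
    rcases h.anc_total huw hvw with hle | hle
    · have h1 := h.pre_le (h.anc_parent hle huv hpv)
      have h2 := h.pre_lt hpu
      lia
    · have h1 := h.pre_le (h.anc_parent hle huv.symm hpu)
      have h2 := h.pre_lt hpv
      lia
  have hout : HasCut G P pre C v →
      ((out p ≠ 0 ∨ multi p ≠ 0) ↔ ∃ u, IsMinCut G P pre C u ∧ ¬ Anc P v u) := by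
    intro hcv
    have hcp : HasCut G P pre C p := hasCut_iff.2 (Or.inr ⟨v, hpv, hcv⟩)
    have hp : out p ≠ 0 ↔ ∃ u, IsMinCut G P pre C u ∧ ¬ Anc P p u := by
      by_cases hpr : p = r
      · subst hpr
        simp only [hs.out_root, ne_eq, not_true, false_iff]
        exact fun ⟨u, _, hu⟩ => hu (h.root_anc u)
      · exact hs.out_iff p hcp hpr (hv ▸ h.pre_lt hpv)
    rw [hp, hmulti]
    constructor
    · rintro (⟨u, hu, hpu⟩ | ⟨u, u', hne, ⟨hpu, hu⟩, hpu', hu'⟩)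
      · exact ⟨u, hu, fun hvu => hpu (.head hpv hvu)⟩
      · obtain ⟨x, hpx, hx, hxv⟩ : ∃ x, P p x ∧ HasCut G P pre C x ∧ x ≠ v := by
          by_cases huv : u = v
          · exact ⟨u', hpu', hu', fun h => hne (huv.trans h.symm)⟩
          · exact ⟨u, hpu, hu, huv⟩
        obtain ⟨m, hxm, hm⟩ := IsDFSTree.HasCut.exists_isMinCut h hx
        exact ⟨m, hm, hsib x hpx hxv m hxm⟩
    · rintro ⟨u, hu, hvu⟩
      by_cases hpu : Anc P p u
      · right
        rcases Relation.ReflTransGen.cases_head hpu with rfl | ⟨x, hpx, hxu⟩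
        · exact absurd ⟨v, hpv, hcv⟩ (h.isMinCut_iff.1 hu).2
        · exact ⟨x, v, fun hxv => hvu (hxv ▸ hxu), ⟨hpx, u, hxu, hu.1⟩, hpv, hcv⟩
      · exact Or.inl ⟨u, hu, hpu⟩
  have hlt : ∀ w, pre w < i + 1 ↔ pre w < i ∨ w = v := by
    intro w
    have : pre w = i ↔ w = v := ⟨fun hw => hinj (hw.trans hv.symm), fun hw => hw ▸ hv⟩
    rw [← this]
    lia
  refine ⟨fun w hw hwr hwi => ?_, ?_, fun w hw => ?_, ?_⟩
  · rcases (hlt w).1 hwi with hwi | rfl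
    · have hwv : w ≠ v := by
        rintro rfl
        lia
      rw [hout' w hwv]
      exact hs.out_iff w hw hwr hwi
    · rw [hv', ← hout hw]
      exact and_iff_right hw
  · rw [hout' r hvr.symm]
    exact hs.out_root
  · have hwv : w ≠ v := by
      rintro rfl
      lia
    rw [hout' w hwv]
    exact hs.out_new w (by lia)
  · rw [hflag', hs.flag_iff]
    have hsepv : (HasCut G P pre C v ∧ ¬ (out p ≠ 0 ∨ multi p ≠ 0) ∧ nc v = 0) ↔
        SeparatesCuts G P pre C v := by
      refine and_congr_right fun hcv => ?_
      have hnc' : nc v = 0 ↔ ∀ u, P v u → HasCut G P pre C u → IsCut G P pre u := by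
        rw [← not_iff_not, ← Ne, hnc]
        push Not
        rfl
      rw [hout hcv, hnc']
      push Not
      rfl
    rw [hsepv]
    constructor
    · rintro (⟨w, hwr, hwi, hw⟩ | hw)
      · exact ⟨w, hwr, (hlt w).2 (Or.inl hwi), hw⟩
      · exact ⟨v, hvr, (hlt v).2 (Or.inr rfl), hw⟩
    · rintro ⟨w, hwr, hwi, hw⟩
      rcases (hlt w).1 hwi with hwi | rfl
      · exact Or.inl ⟨w, hwr, hwi, hw⟩
      · exact Or.inr hw

end Sweep

/-! ### The program -/

section Program

/-- Registers and arrays of the program, apart from the input and the output: register `2` is a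
loop counter, register `3` holds `r + 1` for a customer `r`, the root of the search, registers `5`
and `6` and the arrays `5` to `9` hold the state of the search, arrays `10` to `13` the data
collected by the sweep (with array `4` for the chosen customers), array `14` and register `9` those
of the search for a separating vertex. Registers `7`, `8` and `10` are auxiliary.

This is the body of the first loop: it copies the list starts and marks the customers. -/
def initBody : Program :=
  .seq (.store 8 (.var 2) (.cell 0 (.var 2)))
  (.seq (.ite (.cell 2 (.var 2))
      (.seq (.store 10 (.var 2) (.succ (.var 2))) (.assign 3 (.succ (.var 2)))) .skip)
    (.assign 2 (.succ (.var 2))))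

/-- Place the search at its root. -/
def startSearch : Program :=
  .seq (.assign 5 (.var 3))
  (.seq (.assign 6 (.lit 1))
  (.seq (.store 5 (.pred (.var 3)) (.lit 1))
  (.seq (.store 6 (.lit 1) (.pred (.var 3)))
    (.store 9 (.pred (.var 3)) (.lit 1)))))

/-- One step of the depth-first search: look at the next entry of the list of the current vertex,
or return to the parent if there is none. -/
def searchBody : Program :=
  .seq (.assign 7 (.pred (.var 5)))
  (.ite (.lt (.cell 8 (.var 7)) (.cell 0 (.succ (.var 7))))
    (.seq (.assign 8 (.cell 1 (.cell 8 (.var 7))))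
    (.seq (.store 8 (.var 7) (.succ (.cell 8 (.var 7))))
    (.ite (.cell 5 (.var 8))
      (.ite (.lt (.cell 5 (.var 8)) (.cell 9 (.var 7)))
        (.store 9 (.var 7) (.cell 5 (.var 8))) .skip)
      (.seq (.assign 6 (.succ (.var 6)))
      (.seq (.store 5 (.var 8) (.var 6))
      (.seq (.store 9 (.var 8) (.var 6))
      (.seq (.store 6 (.var 6) (.var 8))
      (.seq (.store 7 (.var 8) (.var 5))
        (.assign 5 (.succ (.var 8)))))))))))
    (.assign 5 (.cell 7 (.var 7))))

/-- The number of the parent is at most `low v` if and only if `v` is a cut; this is recorded, and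
`low v` is passed on to the parent. -/
def sweepLow : Program :=
  .seq (.assign 10 (.lt (.cell 9 (.var 7)) (.cell 5 (.var 8))))
    (.ite (.lt (.cell 9 (.var 7)) (.cell 9 (.var 8)))
      (.store 9 (.var 8) (.cell 9 (.var 7))) .skip)

/-- Choose the candidate of `v` if `v` is a minimal cut, and pass it on to the parent. -/
def sweepSelect : Program :=
  .ite (.cell 10 (.var 7))
    (.seq (.store 10 (.var 8) (.cell 10 (.var 7)))
      (.ite (.var 10) .skip
        (.ite (.cell 11 (.var 7)) .skip
          (.seq (.store 4 (.pred (.cell 10 (.var 7))) (.lit 1))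
            (.store 11 (.var 7) (.lit 1))))))
    .skip

/-- Tell the parent that there is a customer cut in the subtree of `v`. -/
def sweepMerge : Program :=
  .ite (.cell 11 (.var 7))
    (.seq (.ite (.cell 11 (.var 8)) (.store 12 (.var 8) (.lit 1)) .skip)
    (.seq (.store 11 (.var 8) (.lit 1))
      (.ite (.var 10) (.store 13 (.var 8) (.lit 1)) .skip)))
    .skip

/-- Process one vertex, together with its parent, in the sweep towards the root. -/
def sweepBody : Program :=
  .seq (.seq (.assign 7 (.cell 6 (.var 2))) (.assign 8 (.pred (.cell 7 (.var 7)))))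
  (.seq sweepLow (.seq sweepSelect (.seq sweepMerge (.assign 2 (.pred (.var 2))))))

/-- Process one vertex in the sweep away from the root. -/
def separatorBody : Program :=
  .seq (.assign 7 (.cell 6 (.var 2)))
  (.seq (.assign 8 (.pred (.cell 7 (.var 7))))
  (.seq (.ite (.cell 11 (.var 7))
      (.ite (.cell 14 (.var 8)) (.store 14 (.var 7) (.lit 1))
        (.ite (.cell 12 (.var 8)) (.store 14 (.var 7) (.lit 1))
          (.ite (.cell 13 (.var 7)) .skip (.assign 9 (.lit 1)))))
      .skip)
    (.assign 2 (.succ (.var 2)))))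

/-- Add the root if it is needed. -/
def addRoot : Program :=
  .ite (.cell 11 (.pred (.var 3)))
    (.ite (.var 9) (.store 4 (.pred (.var 3)) (.lit 1)) .skip)
    (.store 4 (.pred (.var 3)) (.lit 1))

/-- Count the marked vertices. -/
def countBody : Program :=
  .seq (.ite (.eq (.cell 4 (.var 2)) (.lit 1)) (.assign 1 (.succ (.var 1))) .skip)
    (.assign 2 (.succ (.var 2)))

/-- The part of the program for networks with a customer. -/
def customerProgram : Program :=
  .seq startSearch
  (.seq (.loop (.var 5) searchBody)
  (.seq (.assign 2 (.var 6))
  (.seq (.loop (.lt (.lit 1) (.var 2)) sweepBody)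
  (.seq (.assign 2 (.lit 2))
  (.seq (.loop (.lt (.var 2) (.succ (.var 6))) separatorBody)
  (.seq addRoot
  (.seq (.assign 2 (.lit 0))
    (.loop (.lt (.var 2) (.var 0)) countBody))))))))

/-- The program that computes an optimal cover. -/
def coverProgram : Program :=
  .seq (.loop (.lt (.var 2) (.var 0)) initBody)
    (.ite (.var 3) customerProgram .skip)

variable {n : ℕ} {G : SimpleGraph (Fin n)} {C F : Set (Fin n)} {s : Memory} {c u v p : Fin n}

/-- The state of the search that is held in the memory. -/
def Memory.search (n : ℕ) (s : Memory) : SearchState n where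
  cur := s.reg 5
  cnt := s.reg 6
  pre v := s.arr 5 v
  par v := s.arr 7 v
  ptr v := s.arr 8 v
  low v := s.arr 9 v
  ord := s.arr 6

/-- The data of the sweep that are held in the memory. -/
def Memory.sweep (n : ℕ) (s : Memory) : SweepState n where
  low v := s.arr 9 v
  cand v := s.arr 10 v
  done v := s.arr 11 v
  multi v := s.arr 12 v
  nc v := s.arr 13 v
  chosen v := s.arr 4 v

theorem searchBody_look (hc : s.reg 5 = c + 1) (hlt : s.arr 8 c < s.arr 0 (c + 1))
    (hu : s.arr 1 (s.arr 8 c) = u) (hpre : s.arr 5 u ≠ 0) :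
    (searchBody.exec s).search n = (s.search n).look c u := by
  by_cases hlow : s.arr 5 u < s.arr 9 c
  · ext <;> simp [searchBody, Program.exec, Expr.eval, Memory.search, SearchState.look, hc, hlt,
      hu, hpre, hlow, Function.update_apply, Fin.ext_iff, hlow.le]
  · ext <;> simp [searchBody, Program.exec, Expr.eval, Memory.search, SearchState.look, hc, hlt,
      hu, hpre, hlow, Function.update_apply, Fin.ext_iff, not_lt.1 hlow]

theorem searchBody_push (hc : s.reg 5 = c + 1) (hlt : s.arr 8 c < s.arr 0 (c + 1))
    (hu : s.arr 1 (s.arr 8 c) = u) (hpre : s.arr 5 u = 0) :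
    (searchBody.exec s).search n = (s.search n).push c u := by
  ext <;> simp [searchBody, Program.exec, Expr.eval, Memory.search, SearchState.push, hc, hlt,
      hu, hpre, Function.update_apply, Fin.ext_iff]

theorem searchBody_pop (hc : s.reg 5 = c + 1) (hlt : ¬ s.arr 8 c < s.arr 0 (c + 1)) :
    (searchBody.exec s).search n = (s.search n).pop c := by
  ext <;> simp [searchBody, Program.exec, Expr.eval, Memory.search, SearchState.pop, hc, hlt]

theorem sweepLow_exec {v p : ℕ} (hv : s.reg 7 = v) (hp : s.reg 8 = p) :
    (∀ w, (sweepLow.exec s).arr 9 w = if w = p then min (s.arr 9 p) (s.arr 9 v) else s.arr 9 w) ∧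
      ((sweepLow.exec s).reg 10 ≠ 0 ↔ s.arr 9 v < s.arr 5 p) := by
  by_cases hl : s.arr 9 v < s.arr 9 p
  · constructor
    · intro w
      simp [sweepLow, Program.exec, Expr.eval, hv, hp, hl, hl.le]
    · simp [sweepLow, Program.exec, Expr.eval, hv, hp, hl]
  · constructor
    · intro w
      simp only [sweepLow, Program.exec, Expr.eval, hv, hp, Memory.setReg_reg, Memory.setReg_arr,
        min_eq_left (not_lt.1 hl)]
      split_ifs <;> simp_all
    · simp [sweepLow, Program.exec, Expr.eval, hv, hp, hl]

theorem sweepSelect_exec {v p : ℕ} (hv : s.reg 7 = v) (hp : s.reg 8 = p) (hvp : v ≠ p)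
    {q : Prop} (hq : q ↔ s.arr 10 v ≠ 0 ∧ ¬ s.reg 10 ≠ 0 ∧ s.arr 11 v = 0) [Decidable q] :
    (∀ w, (sweepSelect.exec s).arr 10 w =
      if w = p ∧ s.arr 10 v ≠ 0 then s.arr 10 v else s.arr 10 w) ∧
    (∀ w, (sweepSelect.exec s).arr 11 w = if w = v ∧ q then 1 else s.arr 11 w) ∧
    ∀ w, (sweepSelect.exec s).arr 4 w = if w = s.arr 10 v - 1 ∧ q then 1 else s.arr 4 w := by
  by_cases h1 : s.arr 10 v = 0 <;> by_cases h2 : s.reg 10 = 0 <;> by_cases h3 : s.arr 11 v = 0 <;>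
    simp [sweepSelect, Program.exec, Expr.eval, hv, hp, hq, h1, h2, h3, hvp]

theorem sweepMerge_exec {v p : ℕ} (hv : s.reg 7 = v) (hp : s.reg 8 = p) :
    (∀ w, (sweepMerge.exec s).arr 11 w = if w = p ∧ s.arr 11 v ≠ 0 then 1 else s.arr 11 w) ∧
    (∀ w, (sweepMerge.exec s).arr 12 w =
      if w = p ∧ s.arr 11 v ≠ 0 ∧ s.arr 11 p ≠ 0 then 1 else s.arr 12 w) ∧
    ∀ w, (sweepMerge.exec s).arr 13 w =
      if w = p ∧ s.arr 11 v ≠ 0 ∧ s.reg 10 ≠ 0 then 1 else s.arr 13 w := by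
  by_cases h1 : s.arr 11 v = 0 <;> by_cases h2 : s.arr 11 p = 0 <;> by_cases h3 : s.reg 10 = 0 <;>
    simp [sweepMerge, Program.exec, Expr.eval, hv, hp, h1, h2, h3]

theorem ite_ite_eq_ite_or {a b : Prop} [Decidable a] [Decidable b] {k l : ℕ} :
    (if a then k else if b then k else l) = if a ∨ b then k else l := by
  by_cases a <;> by_cases b <;> simp [*]

theorem sweepBody_step (hv : s.arr 6 (s.reg 2) = v) (hp : s.arr 7 v = p + 1) (hvp : v ≠ p) :
    (sweepBody.exec s).sweep n = (s.sweep n).step v p (s.arr 5 p) ∧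
      (sweepBody.exec s).reg 2 = s.reg 2 - 1 := by
  classical
  have hvp' : (v : ℕ) ≠ p := fun h => hvp (Fin.ext h)
  set s₁ := Program.exec (.seq (.assign 7 (.cell 6 (.var 2)))
    (.assign 8 (.pred (.cell 7 (.var 7))))) s with hs₁
  have h₁ : s₁.arr = s.arr ∧ s₁.reg 7 = v ∧ s₁.reg 8 = p ∧ s₁.reg 2 = s.reg 2 := by
    simp [hs₁, Program.exec, Expr.eval, hv, hp]
  obtain ⟨ha₁, h7₁, h8₁, h2₁⟩ := h₁
  set s₂ := sweepLow.exec s₁ with hs₂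
  obtain ⟨hlow, hb⟩ := sweepLow_exec h7₁ h8₁
  have hu₂ : Unchanged sweepLow s₁ s₂ :=
    Program.LoopFree.unchanged (by simp [Program.LoopFree, sweepLow]) s₁
  set s₃ := sweepSelect.exec s₂ with hs₃
  have h7₂ : s₂.reg 7 = v := (hu₂.reg 7 rfl).trans h7₁
  have h8₂ : s₂.reg 8 = p := (hu₂.reg 8 rfl).trans h8₁
  have hsel : (s.sweep n).Selects v (s.arr 5 p) ↔
      s₂.arr 10 v ≠ 0 ∧ ¬ s₂.reg 10 ≠ 0 ∧ s₂.arr 11 v = 0 := by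
    rw [hb, hu₂.arr 10 rfl, hu₂.arr 11 rfl, ha₁]
    rfl
  obtain ⟨hcand, hdone, hch⟩ := sweepSelect_exec h7₂ h8₂ hvp' hsel
  have hu₃ : Unchanged sweepSelect s₂ s₃ :=
    Program.LoopFree.unchanged (by simp [Program.LoopFree, sweepSelect]) s₂
  set s₄ := sweepMerge.exec s₃ with hs₄
  have h7₃ : s₃.reg 7 = v := (hu₃.reg 7 rfl).trans h7₂
  have h8₃ : s₃.reg 8 = p := (hu₃.reg 8 rfl).trans h8₂
  obtain ⟨hdone', hmulti, hnc⟩ := sweepMerge_exec h7₃ h8₃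
  have hu₄ : Unchanged sweepMerge s₃ s₄ :=
    Program.LoopFree.unchanged (by simp [Program.LoopFree, sweepMerge]) s₃
  have hexec : sweepBody.exec s = s₄.setReg 2 (s₄.reg 2 - 1) := rfl
  -- the cells in terms of the initial memory
  have hd₂ : s₂.arr 11 = s.arr 11 := by rw [hu₂.arr 11 rfl, ha₁]
  have hdv : s₃.arr 11 v ≠ 0 ↔ s.arr 11 v ≠ 0 ∨ (s.sweep n).Selects v (s.arr 5 p) := by
    rw [hdone, hd₂]
    exact (ite_one_ne_zero_iff (k := s.arr 11 v)).trans (by simp)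
  have hdp : s₃.arr 11 p = s.arr 11 p := by rw [hdone, hd₂, if_neg fun h => hvp' h.1.symm]
  have hb₃ : s₃.reg 10 ≠ 0 ↔ s.arr 9 v < s.arr 5 p := by rw [hu₃.reg 10 rfl, hb, ha₁]
  refine ⟨?_, ?_⟩
  · rw [hexec]
    ext w <;> simp only [Memory.sweep, Memory.setReg_arr, SweepState.step, Fin.ext_iff]
    · rw [hu₄.arr 9 rfl, hu₃.arr 9 rfl, hlow, ha₁]
    · rw [hu₄.arr 10 rfl, hcand, hu₂.arr 10 rfl, ha₁]
    · rw [hdone', hdone (w : ℕ), hd₂, ite_ite_eq_ite_or]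
      exact if_congr (or_congr_left (and_congr_right fun _ => hdv)) rfl rfl
    · rw [hmulti, hdp, hu₃.arr 12 rfl, hu₂.arr 12 rfl, ha₁]
      exact if_congr (and_congr_right fun _ => and_congr_left fun _ => hdv) rfl rfl
    · rw [hnc, hu₃.arr 13 rfl, hu₂.arr 13 rfl, ha₁]
      exact if_congr (and_congr_right fun _ => and_congr hdv hb₃) rfl rfl
    · rw [hu₄.arr 4 rfl, hch, hu₂.arr 10 rfl, hu₂.arr 4 rfl, ha₁]
      rfl
  · rw [hexec, Memory.setReg_reg, if_pos rfl, hu₄.reg 2 rfl, hu₃.reg 2 rfl, hu₂.reg 2 rfl, h2₁]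

end Program

/-! ### Correctness and running time of the program -/

section Correctness

variable {n : ℕ} {G : SimpleGraph (Fin n)} {C F : Set (Fin n)} {s s₀ : Memory} {r : Fin n}

theorem HoldsNetwork.isAdjacency (h : HoldsNetwork G C F s) :
    IsAdjacency G (s.arr 0) (s.arr 1) :=
  ⟨h.mono, h.entry, fun v u huv => (h.once v u huv).exists⟩

/-- The lists have at most `2m` entries. -/
theorem HoldsNetwork.sum_le (h : HoldsNetwork G C F s) :
    ∑ v : Fin n, (1 + (s.arr 0 ((v : ℕ) + 1) - s.arr 0 v)) ≤ n + 2 * G.edgeSet.ncard := by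
  classical
  have hdeg : ∀ v : Fin n, s.arr 0 ((v : ℕ) + 1) - s.arr 0 v ≤ G.degree v := by
    intro v
    rw [← Nat.card_Ico, ← SimpleGraph.card_neighborFinset_eq_degree]
    have : Nonempty (Fin n) := ⟨v⟩
    choose! f hf using h.entry v
    refine Finset.card_le_card_of_injOn f (fun k hk => ?_) fun k hk k' hk' heq => ?_
    · have hk := Finset.mem_Ico.1 hk
      simpa using (hf k hk.1 hk.2).1
    · have hk := Finset.mem_Ico.1 hk
      have hk' := Finset.mem_Ico.1 hk'
      exact (h.once v (f k) (hf k hk.1 hk.2).1).unique ⟨hk.1, hk.2, (hf k hk.1 hk.2).2⟩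
        ⟨hk'.1, hk'.2, heq ▸ (hf k' hk'.1 hk'.2).2⟩
  have hsum := Finset.sum_le_sum fun v (_ : v ∈ Finset.univ) => hdeg v
  rw [SimpleGraph.sum_degrees_eq_twice_card_edges] at hsum
  rw [Finset.sum_add_distrib, ← SimpleGraph.coe_edgeFinset, Set.ncard_coe_finset]
  simpa using hsum

/-- After the first loop the list starts are copied, the customers are marked, and register `3`
points to a customer if there is one. -/
theorem achieves_init (h : HoldsNetwork G C F s₀) :
    Achieves (.loop (.lt (.var 2) (.var 0)) initBody) s₀ (25 * n + 25) fun s =>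
      (∀ v : Fin n, s.arr 8 v = s₀.arr 0 v) ∧
      (∀ v : Fin n, (v ∈ C → s.arr 10 v = v + 1) ∧ (v ∉ C → s.arr 10 v = 0)) ∧
      ((s.reg 3 = 0 ∧ C = ∅) ∨ ∃ r ∈ C, s.reg 3 = r + 1) := by
  refine (Achieves.loop (by simp [initBody, Program.LoopFree])
    (fun s => s.reg 2 ≤ n ∧ (∀ v : Fin n, (v : ℕ) < s.reg 2 → s.arr 8 v = s₀.arr 0 v) ∧
      (∀ v : Fin n, ((v : ℕ) < s.reg 2 → v ∈ C → s.arr 10 v = v + 1) ∧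
        (v ∉ C → s.arr 10 v = 0)) ∧
      ((s.reg 3 = 0 ∧ ∀ v : Fin n, (v : ℕ) < s.reg 2 → v ∉ C) ∨ ∃ r ∈ C, s.reg 3 = r + 1))
    (fun s => n - s.reg 2) ?_ ?_).mono ?_ ?_
  · refine ⟨by simp [h.reg_other], by simp [h.reg_other], fun v => ⟨by simp [h.reg_other], ?_⟩, ?_⟩
    · intro _
      exact h.arr_other 10 v (by lia)
    · exact Or.inl ⟨h.reg_other 3 (by lia), by simp [h.reg_other]⟩
  · rintro s hun ⟨h1, h2, h3, h4⟩ he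
    have hn : s.reg 0 = n := (hun.reg 0 rfl).trans h.reg_zero
    have ha0 : s.arr 0 = s₀.arr 0 := hun.arr 0 rfl
    have ha2 : s.arr 2 = s₀.arr 2 := hun.arr 2 rfl
    have hlt : s.reg 2 < n := by
      by_contra hlt
      simp [Expr.eval, hn, hlt] at he
    obtain ⟨i, hi⟩ : ∃ i : Fin n, s.reg 2 = i := ⟨⟨_, hlt⟩, rfl⟩
    have hcase : ∀ v : Fin n, (v : ℕ) < s.reg 2 + 1 ↔ (v : ℕ) < s.reg 2 ∨ v = i := fun v => by
      rw [Fin.ext_iff]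
      lia
    by_cases hic : i ∈ C
    · have hc := (h.customer i).1 hic
      have hregs : (initBody.exec s).reg 2 = s.reg 2 + 1 ∧ (initBody.exec s).reg 3 = i + 1 := by
        simp [initBody, Program.exec, Expr.eval, ha2, hi, hc]
      have harrs : ∀ w, (initBody.exec s).arr 8 w = (if w = i then s₀.arr 0 i else s.arr 8 w) ∧
          (initBody.exec s).arr 10 w = (if w = i then (i : ℕ) + 1 else s.arr 10 w) := by
        simp [initBody, Program.exec, Expr.eval, ha0, ha2, hi, hc]
      rw [hregs.1]
      refine ⟨⟨hlt, fun v hv => ?_, fun v => ⟨fun hv hvC => ?_, fun hvC => ?_⟩, ?_⟩, by lia⟩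
      · rw [(harrs v).1]
        split_ifs with hvi
        · rw [hvi]
        · exact h2 v (((hcase v).1 hv).resolve_right fun h => hvi (congrArg Fin.val h))
      · rw [(harrs v).2]
        split_ifs with hvi
        · rw [hvi]
        · exact (h3 v).1 (((hcase v).1 hv).resolve_right fun h => hvi (congrArg Fin.val h)) hvC
      · rw [(harrs v).2, if_neg fun hvi => hvC (by rwa [show v = i from Fin.ext hvi])]
        exact (h3 v).2 hvC
      · exact Or.inr ⟨i, hic, hregs.2⟩
    · have hc := (h.customer i).2 hic
      have hregs : (initBody.exec s).reg 2 = s.reg 2 + 1 ∧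
          (initBody.exec s).reg 3 = s.reg 3 := by
        simp [initBody, Program.exec, Expr.eval, ha2, hi, hc]
      have harrs : ∀ w, (initBody.exec s).arr 8 w = (if w = i then s₀.arr 0 i else s.arr 8 w) ∧
          (initBody.exec s).arr 10 w = s.arr 10 w := by
        simp [initBody, Program.exec, Expr.eval, ha0, ha2, hi, hc]
      rw [hregs.1, hregs.2]
      refine ⟨⟨hlt, fun v hv => ?_, fun v => ⟨fun hv hvC => ?_, fun hvC => ?_⟩, ?_⟩, by lia⟩
      · rw [(harrs v).1]
        split_ifs with hvi
        · rw [hvi]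
        · exact h2 v (((hcase v).1 hv).resolve_right fun h => hvi (congrArg Fin.val h))
      · rw [(harrs v).2]
        exact (h3 v).1 (((hcase v).1 hv).resolve_right fun h => hic (h ▸ hvC)) hvC
      · rw [(harrs v).2]
        exact (h3 v).2 hvC
      · refine h4.imp_left fun ⟨h5, h6⟩ => ⟨h5, fun v hv => ?_⟩
        rcases (hcase v).1 hv with hv | rfl
        exacts [h6 v hv, hic]
  · simp only [h.reg_other 2 (by lia), Nat.sub_zero]
    have h1 : (Expr.lt (.var 2) (.var 0)).cost + 1 + initBody.cost ≤ 25 := by decide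
    have h2 : (Expr.lt (.var 2) (.var 0)).cost + 1 ≤ 25 := by decide
    calc _ ≤ n * 25 + 25 := Nat.add_le_add (Nat.mul_le_mul_left n h1) h2
      _ = 25 * n + 25 := by ring
  · rintro s hun ⟨⟨h1, h2, h3, h4⟩, he⟩
    have hn : s.reg 0 = n := (hun.reg 0 rfl).trans h.reg_zero
    have hlt : ∀ v : Fin n, (v : ℕ) < s.reg 2 := by
      intro v
      by_contra hlt
      have : s.reg 2 < n := by
        have := v.2
        lia
      simp [Expr.eval, hn, this] at he
    refine ⟨fun v => h2 v (hlt v), fun v => ⟨(h3 v).1 (hlt v), (h3 v).2⟩, h4.imp_left ?_⟩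
    exact fun ⟨h5, h6⟩ => ⟨h5, Set.eq_empty_iff_forall_notMem.2 fun v => h6 v (hlt v)⟩

/-- The memory before the search: the adjacency lists are given, `r` is a customer, the customers
are marked, and the other cells that are used are empty. -/
structure ReadyToSearch (G : SimpleGraph (Fin n)) (C : Set (Fin n)) (r : Fin n) (s : Memory) :
    Prop where
  reg_zero : s.reg 0 = n
  reg_one : s.reg 1 = 0
  root : s.reg 3 = r + 1
  mem : r ∈ C
  flag : s.reg 9 = 0
  isAdjacency : IsAdjacency G (s.arr 0) (s.arr 1)
  ptr : ∀ v : Fin n, s.arr 8 v = s.arr 0 v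
  cand : ∀ v : Fin n, (v ∈ C → s.arr 10 v = v + 1) ∧ (v ∉ C → s.arr 10 v = 0)
  chosen : ∀ i, s.arr 4 i = 0
  pre : ∀ i, s.arr 5 i = 0
  par : ∀ i, s.arr 7 i = 0
  done : ∀ i, s.arr 11 i = 0
  multi : ∀ i, s.arr 12 i = 0
  nc : ∀ i, s.arr 13 i = 0
  out : ∀ i, s.arr 14 i = 0

/-- The search starts with its invariant. -/
theorem ReadyToSearch.invariant (h : ReadyToSearch G C r s) :
    ((startSearch.exec s).search n).Invariant G (s.arr 0) (s.arr 1) r := by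
  set σ := (startSearch.exec s).search n with hσ
  have hcur : σ.cur = r + 1 := by simp [hσ, Memory.search, startSearch, Program.exec, Expr.eval,
    h.root]
  have hcnt : σ.cnt = 1 := by simp [hσ, Memory.search, startSearch, Program.exec, Expr.eval]
  have hpre : ∀ v, σ.pre v = if v = r then 1 else 0 := fun v => by
    simp [hσ, Memory.search, startSearch, Program.exec, Expr.eval, h.root, h.pre, Fin.ext_iff]
  have hpar : ∀ v, σ.par v = 0 := fun v => by
    simp [hσ, Memory.search, startSearch, Program.exec, Expr.eval, h.par]
  have hptr : ∀ v, σ.ptr v = s.arr 0 v := fun v => by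
    simp [hσ, Memory.search, startSearch, Program.exec, Expr.eval, h.ptr]
  have hlow : σ.low r = 1 := by
    simp [hσ, Memory.search, startSearch, Program.exec, Expr.eval, h.root]
  have hord : σ.ord 1 = r := by
    simp [hσ, Memory.search, startSearch, Program.exec, Expr.eval, h.root]
  have hroot : ∀ v, σ.pre v ≠ 0 → v = r := fun v hv => by
    by_contra hvr
    exact hv (by rw [hpre, if_neg hvr])
  have hrr : σ.pre r = 1 := by rw [hpre, if_pos rfl]
  refine ⟨Or.inr ⟨r, hcur, by simp [hpre]⟩, hrr, hpar r, fun v hv hvr => absurd (hroot v hv) hvr,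
    fun v _ => hpar v, fun a b hab => ?_, fun v hv => ?_, fun i h1 h2 => ?_, fun v => ?_,
    fun v _ => hptr v, fun v k hk hk' => ?_, fun v hv => ?_, fun v hv => ?_, fun v hv => ?_,
    fun u v hu hv huv => ?_⟩
  · have : σ.par b = (a : ℕ) + 1 := hab
    rw [hpar] at this
    lia
  · rw [hroot v hv, hrr, hcnt]
    exact ⟨le_rfl, hord⟩
  · obtain rfl : i = 1 := by lia
    exact ⟨r, hord, hrr⟩
  · rw [hptr]
    exact ⟨le_rfl, h.isAdjacency.mono v⟩
  · rw [hptr] at hk'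
    lia
  · rw [hroot v hv, hrr, hlow]
  · rw [hroot v hv, hrr, hlow]
    exact Or.inl rfl
  · refine absurd ⟨r, hcur, ?_⟩ hv.2
    rw [hroot v hv.1]
  · rw [hroot u hu, hroot v hv] at huv
    exact absurd huv (G.loopless.irrefl r)

/-- The search finishes after at most as many iterations as its potential says. -/
theorem achieves_search (hG : IsAdjacency G (s₀.arr 0) (s₀.arr 1))
    (h : (s₀.search n).Invariant G (s₀.arr 0) (s₀.arr 1) r) :
    Achieves (.loop (.var 5) searchBody) s₀ (64 * (s₀.search n).potential (s₀.arr 0) + 64)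
      fun s => (s.search n).Invariant G (s₀.arr 0) (s₀.arr 1) r ∧ s.reg 5 = 0 := by
  refine (Achieves.loop (by simp [searchBody, Program.LoopFree])
    (fun s => (s.search n).Invariant G (s₀.arr 0) (s₀.arr 1) r)
    (fun s => (s.search n).potential (s₀.arr 0)) h ?_).mono ?_ ?_
  · intro s hun hI he
    have ha0 : s.arr 0 = s₀.arr 0 := hun.arr 0 rfl
    have ha1 : s.arr 1 = s₀.arr 1 := hun.arr 1 rfl
    obtain ⟨c, hc, hpre⟩ := hI.cur.resolve_left he
    by_cases hlt : s.arr 8 c < s.arr 0 (c + 1)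
    · obtain ⟨u, hcu, hu⟩ := hG.entry c (s.arr 8 c) (hI.ptr c).1 (ha0 ▸ hlt)
      by_cases hup : s.arr 5 u = 0
      · rw [searchBody_push hc hlt (ha1 ▸ hu) hup]
        exact hI.push hG hc hpre (ha0 ▸ hlt) hu hcu hup
      · rw [searchBody_look hc hlt (ha1 ▸ hu) hup]
        exact hI.look hc hpre (ha0 ▸ hlt) hu hcu hup
    · rw [searchBody_pop hc hlt]
      exact hI.pop hc hpre (ha0 ▸ not_lt.1 hlt)
  · have h1 : (Expr.var 5).cost + 1 + searchBody.cost ≤ 64 := by decide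
    have h2 : (Expr.var 5).cost + 1 ≤ 64 := by decide
    calc _ ≤ (s₀.search n).potential (s₀.arr 0) * 64 + 64 :=
          Nat.add_le_add (Nat.mul_le_mul_left _ h1) h2
      _ = _ := by ring
  · exact fun s _ hs => hs

/-- The result of the search: a depth-first search tree, the enumeration of its vertices, and for
each vertex the least number of a neighbour. -/
structure SearchResult (G : SimpleGraph (Fin n)) (r : Fin n) (σ : SearchState n) : Prop where
  isDFSTree : IsDFSTree G r σ.parent σ.pre
  pre_root : σ.pre r = 1
  pre_le : ∀ v, σ.pre v ≤ σ.cnt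
  injective : Function.Injective σ.pre
  ord : ∀ i, 1 ≤ i → i ≤ σ.cnt → ∃ v : Fin n, σ.ord i = v ∧ σ.pre v = i
  low_le : ∀ v w, G.Adj v w → σ.low v ≤ σ.pre w
  low_eq : ∀ v, σ.low v = σ.pre v ∨ ∃ w, G.Adj v w ∧ σ.low v = σ.pre w

theorem SearchState.Invariant.searchResult {σ : SearchState n} {off adj : ℕ → ℕ}
    (h : σ.Invariant G off adj r) (hG : IsAdjacency G off adj) (hconn : G.Connected)
    (hcur : σ.cur = 0) : SearchResult G r σ := by
  obtain ⟨hall, htree, hlow⟩ := h.isDFSTree hG hconn hcur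
  refine ⟨htree, h.root, fun v => (h.ord_pre v (hall v)).1, fun u v huv => ?_, h.pre_ord, hlow,
    fun v => (h.low_eq v (hall v)).imp_right fun ⟨w, hvw, _, hw⟩ => ⟨w, hvw, hw⟩⟩
  have h1 := (h.ord_pre u (hall u)).2
  have h2 := (h.ord_pre v (hall v)).2
  have : σ.pre u = σ.pre v := huv
  rw [this, h2] at h1
  exact Fin.ext h1.symm

theorem SearchResult.cnt_le {σ : SearchState n} (h : SearchResult G r σ) : σ.cnt ≤ n := by
  have : Nonempty (Fin n) := ⟨r⟩
  choose! f hf using h.ord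
  have := Finset.card_le_card_of_injOn (s := Finset.Icc 1 σ.cnt) (t := Finset.univ) f
    (fun _ _ => Finset.mem_coe.2 (Finset.mem_univ _)) fun i hi j hj hij => by
      have hi := Finset.mem_Icc.1 (Finset.mem_coe.1 hi)
      have hj := Finset.mem_Icc.1 (Finset.mem_coe.1 hj)
      rw [← (hf i hi.1 hi.2).2, hij, (hf j hj.1 hj.2).2]
  simpa using this

theorem SearchResult.one_le_cnt {σ : SearchState n} (h : SearchResult G r σ) : 1 ≤ σ.cnt :=
  h.pre_root ▸ h.pre_le r

/-- Each vertex with a number other than `1` has a parent. -/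
theorem SearchResult.exists_parent {σ : SearchState n} (h : SearchResult G r σ) {i : ℕ}
    (h1 : 1 < i) (hi : i ≤ σ.cnt) :
    ∃ v p : Fin n, σ.ord i = v ∧ σ.pre v = i ∧ σ.parent p v := by
  obtain ⟨v, hv, hvi⟩ := h.ord i h1.le hi
  obtain ⟨p, hp⟩ := h.isDFSTree.exists_parent (v := v) (by
    rintro rfl
    rw [h.pre_root] at hvi
    lia)
  exact ⟨v, p, hv, hvi, hp⟩

/-- The sweep towards the root collects its data for all vertices. -/
theorem achieves_sweep (h : SearchResult G r (s₀.search n)) (hcnt : s₀.reg 2 = s₀.reg 6)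
    (hI : (s₀.sweep n).Invariant G (s₀.search n).parent (s₀.search n).pre (s₀.search n).low C
      (s₀.reg 6)) :
    Achieves (.loop (.lt (.lit 1) (.var 2)) sweepBody) s₀ (100 * n + 100)
      fun s => (s.sweep n).Invariant G (s₀.search n).parent (s₀.search n).pre (s₀.search n).low C
        1 := by
  refine (Achieves.loop (by simp [sweepBody, sweepLow, sweepSelect, sweepMerge, Program.LoopFree])
    (fun s => 1 ≤ s.reg 2 ∧ s.reg 2 ≤ s₀.reg 6 ∧ (s.sweep n).Invariant G (s₀.search n).parent
      (s₀.search n).pre (s₀.search n).low C (s.reg 2))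
    (fun s => s.reg 2) ?_ ?_).mono ?_ ?_
  · rw [hcnt]
    exact ⟨h.one_le_cnt, le_rfl, hI⟩
  · rintro s hun ⟨h1, h2, hI⟩ he
    have hlt : 1 < s.reg 2 := by
      by_contra hlt
      simp [Expr.eval, hlt] at he
    obtain ⟨v, p, hv, hvi, hp⟩ := h.exists_parent hlt h2
    have hv' : s.arr 6 (s.reg 2) = v := by
      rw [hun.arr 6 rfl]
      exact hv
    have hp' : s.arr 7 v = p + 1 := by
      rw [hun.arr 7 rfl]
      exact hp
    have hvp : v ≠ p := by
      rintro rfl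
      exact lt_irrefl _ (h.isDFSTree.pre_lt hp)
    obtain ⟨hstep, hreg⟩ := sweepBody_step hv' hp' hvp
    have hpre : s.arr 5 p = (s₀.search n).pre p := by
      rw [hun.arr 5 rfl]
      rfl
    rw [hstep, hreg, hpre]
    exact ⟨⟨by lia, by lia, hI.step h.isDFSTree h.injective h.low_le h.low_eq hvi hp⟩, by lia⟩
  · have h1 : (Expr.lt (.lit 1) (.var 2)).cost + 1 + sweepBody.cost ≤ 100 := by decide
    have h2 : (Expr.lt (.lit 1) (.var 2)).cost + 1 ≤ 100 := by decide
    have h3 : s₀.reg 2 ≤ n := hcnt ▸ h.cnt_le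
    calc _ ≤ n * 100 + 100 := Nat.add_le_add (Nat.mul_le_mul h3 h1) h2
      _ = _ := by ring
  · rintro s - ⟨⟨h1, -, hI⟩, he⟩
    have : s.reg 2 = 1 := by
      by_contra hne
      have hlt : 1 < s.reg 2 := by lia
      simp [Expr.eval, hlt] at he
    rwa [this] at hI

end Correctness

section Correctness

variable {n : ℕ} {G : SimpleGraph (Fin n)} {C F : Set (Fin n)} {s s₀ : Memory} {r : Fin n}
  {σ : SearchState n} {τ : SweepState n} {lo : Fin n → ℕ}

/-- What the data of the sweep say when all vertices but the root have been processed. -/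
structure SweepResult (G : SimpleGraph (Fin n)) (C : Set (Fin n)) (P : Fin n → Fin n → Prop)
    (pre : Fin n → ℕ) (τ : SweepState n) : Prop where
  done : ∀ v, τ.done v ≠ 0 ↔ HasCut G P pre C v
  multi : ∀ v, τ.multi v ≠ 0 ↔ ∃ u u', u ≠ u' ∧ (P v u ∧ HasCut G P pre C u) ∧
    (P v u' ∧ HasCut G P pre C u')
  nc : ∀ v, τ.nc v ≠ 0 ↔ ∃ u, P v u ∧ HasCut G P pre C u ∧ ¬ IsCut G P pre u
  exists_chosen : ∀ u, IsMinCut G P pre C u → ∃ c ∈ {c | τ.chosen c = 1}, Anc P u c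
  of_chosen : ∀ c ∈ {c | τ.chosen c = 1}, ∃ u, IsMinCut G P pre C u ∧ Anc P u c ∧ c ∈ C
  chosen_unique : ∀ u, IsMinCut G P pre C u → ∀ c ∈ {c | τ.chosen c = 1},
    ∀ c' ∈ {c | τ.chosen c = 1}, Anc P u c → Anc P u c' → c = c'

theorem SweepState.Invariant.sweepResult (h : SearchResult G r σ)
    (hτ : τ.Invariant G σ.parent σ.pre lo C 1) : SweepResult G C σ.parent σ.pre τ := by
  have hpos : ∀ v, 1 ≤ σ.pre v := fun v => h.pre_root ▸ h.isDFSTree.pre_le (h.isDFSTree.root_anc v)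
  have hchild : ∀ v u, σ.parent v u → 1 < σ.pre u := fun v u hvu =>
    (hpos v).trans_lt (h.isDFSTree.pre_lt hvu)
  have hcut : ∀ v, IsCut G σ.parent σ.pre v → 1 < σ.pre v := fun v ⟨p, hp, _⟩ => hchild p v hp
  refine ⟨fun v => ?_, fun v => ?_, fun v => ?_, fun u hu => ?_, fun c hc => ?_,
    fun u hu c hc c' hc' => hτ.chosen_unique u hu c c' hc hc'⟩
  · rw [hτ.done, hasCut_iff]
    exact or_congr ⟨And.right, fun hv => ⟨hcut v hv.1, hv⟩⟩
      ⟨fun ⟨u, h1, _, h2⟩ => ⟨u, h1, h2⟩, fun ⟨u, h1, h2⟩ => ⟨u, h1, hchild v u h1, h2⟩⟩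
  · rw [hτ.multi]
    constructor
    · rintro ⟨u, u', hne, ⟨h1, -, h2⟩, h3, -, h4⟩
      exact ⟨u, u', hne, ⟨h1, h2⟩, h3, h4⟩
    · rintro ⟨u, u', hne, ⟨h1, h2⟩, h3, h4⟩
      exact ⟨u, u', hne, ⟨h1, hchild v u h1, h2⟩, h3, hchild v u' h3, h4⟩
  · rw [hτ.nc]
    exact ⟨fun ⟨u, h1, _, h2⟩ => ⟨u, h1, h2⟩, fun ⟨u, h1, h2⟩ => ⟨u, h1, hchild v u h1, h2⟩⟩
  · exact hτ.exists_chosen u hu (hcut u hu.1.1)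
  · obtain ⟨u, hu, -, h1, h2⟩ := hτ.of_chosen c hc
    exact ⟨u, hu, h1, h2⟩

/-- The sweep away from the root finds out whether some vertex separates the minimal cuts. -/
theorem achieves_separator (h : SearchResult G r σ) (hcnt : s₀.reg 6 = σ.cnt)
    (hord : s₀.arr 6 = σ.ord) (hpar : ∀ v : Fin n, s₀.arr 7 v = σ.par v)
    (hτ : SweepResult G C σ.parent σ.pre (s₀.sweep n))
    (hi : s₀.reg 2 = 2) (hflag : s₀.reg 9 = 0) (hout : ∀ i, s₀.arr 14 i = 0) :
    Achieves (.loop (.lt (.var 2) (.succ (.var 6))) separatorBody) s₀ (50 * n + 50)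
      fun s => s.reg 9 ≠ 0 ↔ ∃ x, x ≠ r ∧ SeparatesCuts G σ.parent σ.pre C x := by
  refine (Achieves.loop (by simp [separatorBody, Program.LoopFree])
    (fun s => 2 ≤ s.reg 2 ∧ SeparatorInvariant G r σ.parent σ.pre C (s.reg 2)
      (fun v => s.arr 14 v) (s.reg 9))
    (fun s => σ.cnt + 1 - s.reg 2) ?_ ?_).mono ?_ ?_
  · have hlt : ∀ v, σ.pre v < 2 → v = r := fun v hv => h.injective (by
      have h1 := h.isDFSTree.pre_le (h.isDFSTree.root_anc v)
      have h2 := h.pre_root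
      lia)
    rw [hi]
    refine ⟨le_rfl, fun v _ hvr hv => absurd (hlt v hv) hvr, hout r, fun v _ => hout v, ?_⟩
    simp only [hflag, ne_eq, not_true, false_iff]
    exact fun ⟨v, hvr, hv, _⟩ => hvr (hlt v hv)
  · rintro s hun ⟨h1, hI⟩ he
    have hlt : s.reg 2 < σ.cnt + 1 := by
      by_contra hlt
      have : s.reg 6 = σ.cnt := (hun.reg 6 rfl).trans hcnt
      simp [Expr.eval, this, hlt] at he
    obtain ⟨v, p, hv, hvi, hp⟩ := h.exists_parent (i := s.reg 2) (by lia) (by lia)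
    have hv' : s.arr 6 (s.reg 2) = v := by rw [hun.arr 6 rfl, hord, hv]
    have hp' : s.arr 7 v = p + 1 := by
      rw [hun.arr 7 rfl, hpar]
      exact hp
    have hdone : s.arr 11 v ≠ 0 ↔ HasCut G σ.parent σ.pre C v := by
      rw [hun.arr 11 rfl]
      exact hτ.done v
    have hmulti : s.arr 12 p ≠ 0 ↔ ∃ u u', u ≠ u' ∧
        (σ.parent p u ∧ HasCut G σ.parent σ.pre C u) ∧
        (σ.parent p u' ∧ HasCut G σ.parent σ.pre C u') := by
      rw [hun.arr 12 rfl]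
      exact hτ.multi p
    have hnc : s.arr 13 v ≠ 0 ↔ ∃ u, σ.parent v u ∧ HasCut G σ.parent σ.pre C u ∧
        ¬ IsCut G σ.parent σ.pre u := by
      rw [hun.arr 13 rfl]
      exact hτ.nc v
    have hnew : s.arr 14 v = 0 := hI.out_new v hvi.ge
    have hexec : (separatorBody.exec s).reg 2 = s.reg 2 + 1 ∧
        (∀ w : ℕ, w ≠ v → (separatorBody.exec s).arr 14 w = s.arr 14 w) ∧
        ((separatorBody.exec s).arr 14 v ≠ 0 ↔
          s.arr 11 v ≠ 0 ∧ (s.arr 14 p ≠ 0 ∨ s.arr 12 p ≠ 0)) ∧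
        ((separatorBody.exec s).reg 9 ≠ 0 ↔ s.reg 9 ≠ 0 ∨
          (s.arr 11 v ≠ 0 ∧ ¬ (s.arr 14 p ≠ 0 ∨ s.arr 12 p ≠ 0) ∧ s.arr 13 v = 0)) := by
      by_cases h1 : s.arr 11 v = 0 <;> by_cases h2 : s.arr 14 p = 0 <;>
        by_cases h3 : s.arr 12 p = 0 <;> by_cases h4 : s.arr 13 v = 0 <;>
        simp +contextual [separatorBody, Program.exec, Expr.eval, hv', hp', hnew, h1, h2, h3, h4]
    obtain ⟨hreg, hout', hv14, hflag'⟩ := hexec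
    rw [hreg]
    refine ⟨⟨by lia, ?_⟩, by lia⟩
    refine hI.step h.isDFSTree h.injective hvi hp (multi := fun v => s.arr 12 v)
      (nc := fun v => s.arr 13 v) hmulti hnc (fun w hw => hout' w fun h => hw (Fin.ext h)) ?_ ?_
    · rw [← hdone]
      exact hv14
    · rw [← hdone]
      exact hflag'
  · have h1 : (Expr.lt (.var 2) (.succ (.var 6))).cost + 1 + separatorBody.cost ≤ 50 := by decide
    have h2 : (Expr.lt (.var 2) (.succ (.var 6))).cost + 1 ≤ 50 := by decide
    have h3 : σ.cnt + 1 - s₀.reg 2 ≤ n := by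
      have := h.cnt_le
      lia
    calc _ ≤ n * 50 + 50 := Nat.add_le_add (Nat.mul_le_mul h3 h1) h2
      _ = _ := by ring
  · rintro s hun ⟨⟨h1, hI⟩, he⟩
    have hlt : ∀ v, σ.pre v < s.reg 2 := by
      intro v
      by_contra hlt
      have h2 : s.reg 6 = σ.cnt := (hun.reg 6 rfl).trans hcnt
      have h3 : s.reg 2 < σ.cnt + 1 := by
        have := h.pre_le v
        lia
      simp [Expr.eval, h2, h3] at he
    rw [hI.flag_iff]
    exact ⟨fun ⟨v, h1, _, h2⟩ => ⟨v, h1, h2⟩, fun ⟨v, h1, h2⟩ => ⟨v, h1, hlt v, h2⟩⟩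

/-- The last loop counts the marked vertices. -/
theorem achieves_count (hn : s₀.reg 0 = n) (hk : s₀.reg 1 = 0) (hi : s₀.reg 2 = 0) :
    Achieves (.loop (.lt (.var 2) (.var 0)) countBody) s₀ (20 * n + 20)
      fun s => s.reg 1 = {v : Fin n | s₀.arr 4 v = 1}.ncard := by
  refine (Achieves.loop (by simp [countBody, Program.LoopFree])
    (fun s => s.reg 2 ≤ n ∧ s.reg 1 = {v : Fin n | (v : ℕ) < s.reg 2 ∧ s₀.arr 4 v = 1}.ncard)
    (fun s => n - s.reg 2) ?_ ?_).mono ?_ ?_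
  · simp [hi, hk]
  · rintro s hun ⟨h1, h2⟩ he
    have hlt : s.reg 2 < n := by
      by_contra hlt
      have : s.reg 0 = n := (hun.reg 0 rfl).trans hn
      simp [Expr.eval, this, hlt] at he
    obtain ⟨i, hi⟩ : ∃ i : Fin n, s.reg 2 = i := ⟨⟨_, hlt⟩, rfl⟩
    have ha4 : s.arr 4 = s₀.arr 4 := hun.arr 4 rfl
    have hset : {v : Fin n | (v : ℕ) < s.reg 2 + 1 ∧ s₀.arr 4 v = 1} =
        if s₀.arr 4 i = 1 then insert i {v : Fin n | (v : ℕ) < s.reg 2 ∧ s₀.arr 4 v = 1}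
        else {v : Fin n | (v : ℕ) < s.reg 2 ∧ s₀.arr 4 v = 1} := by
      have hcase : ∀ v : Fin n, (v : ℕ) < s.reg 2 + 1 ↔ (v : ℕ) < s.reg 2 ∨ v = i := fun v => by
        rw [Fin.ext_iff]
        lia
      ext v
      split_ifs with h4
      · simp only [hcase, Set.mem_ofPred_eq, Set.mem_insert_iff]
        constructor
        · rintro ⟨h | h, h'⟩
          exacts [Or.inr ⟨h, h'⟩, Or.inl h]
        · rintro (rfl | ⟨h, h'⟩)
          exacts [⟨Or.inr rfl, h4⟩, ⟨Or.inl h, h'⟩]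
      · simp only [hcase, Set.mem_ofPred_eq]
        constructor
        · rintro ⟨h | rfl, h'⟩
          exacts [⟨h, h'⟩, absurd h' h4]
        · exact fun h => ⟨Or.inl h.1, h.2⟩
    have hexec : (countBody.exec s).reg 2 = s.reg 2 + 1 ∧
        (countBody.exec s).reg 1 = if s₀.arr 4 i = 1 then s.reg 1 + 1 else s.reg 1 := by
      by_cases h4 : s₀.arr 4 i = 1 <;>
        simp [countBody, Program.exec, Expr.eval, ha4, hi, h4]
    rw [hexec.1, hexec.2, hset]
    refine ⟨⟨hlt, ?_⟩, by lia⟩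
    split_ifs
    · rw [Set.ncard_insert_of_notMem (by simp [hi]) (Set.toFinite _), h2]
    · exact h2
  · have h1 : (Expr.lt (.var 2) (.var 0)).cost + 1 + countBody.cost ≤ 20 := by decide
    have h2 : (Expr.lt (.var 2) (.var 0)).cost + 1 ≤ 20 := by decide
    calc _ ≤ n * 20 + 20 := Nat.add_le_add (Nat.mul_le_mul (Nat.sub_le _ _) h1) h2
      _ = _ := by ring
  · rintro s hun ⟨⟨h1, h2⟩, he⟩
    have hlt : ∀ v : Fin n, (v : ℕ) < s.reg 2 := by
      intro v
      by_contra hlt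
      have h3 : s.reg 0 = n := (hun.reg 0 rfl).trans hn
      have h4 : s.reg 2 < n := by
        have := v.2
        lia
      simp [Expr.eval, h3, h4] at he
    rw [h2]
    simp only [hlt, true_and]

/-- The marked vertices form an optimal cover after the root has been added where it is needed. -/
theorem addRoot_isOptimalCover (hCF : C ⊆ F) (hr : r ∈ C) (h : SearchResult G r σ)
    (hτ : SweepResult G C σ.parent σ.pre (s.sweep n)) (hroot : s.reg 3 = r + 1)
    (hflag : s.reg 9 ≠ 0 ↔ ∃ x, x ≠ r ∧ SeparatesCuts G σ.parent σ.pre C x) :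
    IsOptimalCover (allPaths G) C F {v : Fin n | (addRoot.exec s).arr 4 v = 1} := by
  -- `addRoot` tests the data of the sweep and the flag, that is, whether the root is needed
  have hset : ∀ (q : Prop) [Decidable q], (q ↔ ¬ HasCut G σ.parent σ.pre C r ∨
      ∃ x, x ≠ r ∧ SeparatesCuts G σ.parent σ.pre C x) →
      {v : Fin n | (addRoot.exec s).arr 4 v = 1} =
        if q then insert r {v : Fin n | s.arr 4 v = 1} else {v : Fin n | s.arr 4 v = 1} := by
    intro q _ hq
    rw [← hflag, ← hτ.done] at hq
    have hq' : q ↔ s.arr 11 r = 0 ∨ s.reg 9 ≠ 0 := by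
      rw [hq, not_not]
      rfl
    ext v
    by_cases h1 : s.arr 11 r = 0 <;> by_cases h2 : s.reg 9 = 0 <;>
      simp [addRoot, Program.exec, Expr.eval, hroot, hq', h1, h2, Fin.ext_iff] <;>
      tauto
  classical
  rw [hset _ Iff.rfl]
  split_ifs with hq
  · exact h.isDFSTree.isOptimalCover_insert_root hr hτ.exists_chosen hτ.of_chosen
      hτ.chosen_unique hCF hq
  · rw [not_or, not_not] at hq
    exact h.isDFSTree.isOptimalCover_cuts hr hτ.exists_chosen hτ.of_chosen
      hτ.chosen_unique hCF hq

/-- The invariant of the sweep holds at its start. -/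
theorem sweep_invariant_start (h : SearchResult G r (s.search n))
    (hcand : ∀ v : Fin n, (v ∈ C → s.arr 10 v = v + 1) ∧ (v ∉ C → s.arr 10 v = 0))
    (hchosen : ∀ i, s.arr 4 i = 0) (hdone : ∀ i, s.arr 11 i = 0) (hmulti : ∀ i, s.arr 12 i = 0)
    (hnc : ∀ i, s.arr 13 i = 0) :
    (s.sweep n).Invariant G (s.search n).parent (s.search n).pre (s.search n).low C
      (s.reg 6) := by
  have hno : ∀ u, ¬ s.reg 6 < (s.search n).pre u := fun u => not_lt.2 (h.pre_le u)
  refine ⟨fun v => le_rfl, fun v u _ hu => absurd hu (hno u), fun v => ⟨v, .refl, rfl⟩,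
    fun v => ?_, fun v hv => ?_, fun v => ?_, fun v => ?_, fun v => ?_,
    fun u _ hu => absurd hu (hno u), fun c hc => ?_, fun u _ c c' hc => ?_⟩
  · by_cases hv : v ∈ C
    · simp [Memory.sweep, (hcand v).1 hv, hv]
    · simp [Memory.sweep, (hcand v).2 hv, hv, hno]
  · by_cases hvC : v ∈ C
    · exact ⟨v, hvC, .refl, (hcand v).1 hvC⟩
    · exact absurd ((hcand v).2 hvC) hv
  · simp [Memory.sweep, hdone, hno]
  · simp [Memory.sweep, hmulti, hno]
  · simp [Memory.sweep, hnc, hno]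
  · exact absurd ((hchosen c).symm.trans hc) (by lia)
  · exact absurd ((hchosen c).symm.trans hc) (by lia)

/-- Before the search its potential is at most the number of vertices and list entries. -/
theorem SearchState.Invariant.potential_le {off adj : ℕ → ℕ} (h : σ.Invariant G off adj r) :
    σ.potential off ≤ ∑ v : Fin n, (1 + (off ((v : ℕ) + 1) - off v)) := by
  refine Finset.sum_le_sum fun v _ => ?_
  have := (h.ptr v).1
  split_ifs <;> lia

/-- The phases of the program for a network with a customer, which is the root of the search. The
bound allows `64` steps per vertex or list entry in the search and a constant number per vertex in
each of the other loops. -/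
theorem achieves_customerProgram (hconn : G.Connected) (hCF : C ⊆ F)
    (h : ReadyToSearch G C r s) {M : ℕ}
    (hM : ∑ v : Fin n, (1 + (s.arr 0 ((v : ℕ) + 1) - s.arr 0 v)) ≤ M) :
    Achieves customerProgram s (64 * M + 170 * n + 400) fun s' =>
      IsOptimalCover (allPaths G) C F {v : Fin n | s'.arr 4 v = 1} ∧
        s'.reg 1 = {v : Fin n | s'.arr 4 v = 1}.ncard := by
  have hstart : startSearch.LoopFree := by simp [startSearch, Program.LoopFree]
  have hadd : addRoot.LoopFree := by simp [addRoot, Program.LoopFree]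
  have hassign : ∀ e : Expr, (Program.assign 2 e).LoopFree := fun e => trivial
  -- the search
  refine ((hstart.achieves (Q := fun s' => s' = startSearch.exec s) rfl).seq
    (T' := (64 * M + 64) + (2 + ((100 * n + 100) + (2 + ((50 * n + 50) + (addRoot.cost +
      (2 + (20 * n + 20)))))))) ?_).mono ?_ fun _ _ hs => hs
  swap
  · have h1 : startSearch.cost ≤ 30 := by decide
    have h2 : addRoot.cost ≤ 30 := by decide
    lia
  rintro s₁ h₁ hs₁
  have hadj : IsAdjacency G (s₁.arr 0) (s₁.arr 1) := by
    rw [h₁.arr 0 rfl, h₁.arr 1 rfl]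
    exact h.isAdjacency
  have hI₁ : (s₁.search n).Invariant G (s₁.arr 0) (s₁.arr 1) r := by
    rw [h₁.arr 0 rfl, h₁.arr 1 rfl, hs₁]
    exact h.invariant
  have hpot : (s₁.search n).potential (s₁.arr 0) ≤ M := by
    refine hI₁.potential_le.trans ?_
    rw [h₁.arr 0 rfl]
    exact hM
  refine ((achieves_search hadj hI₁).mono (by lia) fun _ _ hs => hs).seq ?_
  rintro s₂ h₂ ⟨hI₂, hcur⟩
  have hσ : SearchResult G r (s₂.search n) := hI₂.searchResult hadj hconn hcur
  -- the sweep towards the root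
  refine ((hassign (.var 6)).achieves (Q := fun s' => s' = s₂.setReg 2 (s₂.reg 6)) rfl).seq ?_
  rintro s₃ - rfl
  have hτ₃ := sweep_invariant_start (C := C) (s := s₂) hσ
    (by rw [h₂.arr 10 rfl, h₁.arr 10 rfl]; exact h.cand)
    (by rw [h₂.arr 4 rfl, h₁.arr 4 rfl]; exact h.chosen)
    (by rw [h₂.arr 11 rfl, h₁.arr 11 rfl]; exact h.done)
    (by rw [h₂.arr 12 rfl, h₁.arr 12 rfl]; exact h.multi)
    (by rw [h₂.arr 13 rfl, h₁.arr 13 rfl]; exact h.nc)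
  refine (achieves_sweep (s₀ := s₂.setReg 2 (s₂.reg 6)) (C := C) hσ (by simp) hτ₃).seq ?_
  rintro s₄ h₄ hτ₄
  have hτ : SweepResult G C (s₂.search n).parent (s₂.search n).pre (s₄.sweep n) :=
    SweepState.Invariant.sweepResult hσ hτ₄
  -- the sweep away from the root
  refine ((hassign (.lit 2)).achieves (Q := fun s' => s' = s₄.setReg 2 2) rfl).seq ?_
  rintro s₅ - rfl
  refine (achieves_separator (s₀ := s₄.setReg 2 2) (σ := s₂.search n) (C := C) hσ (h₄.reg 6 rfl)
    (h₄.arr 6 rfl) (fun v => congrFun (h₄.arr 7 rfl) v) hτ rfl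
    (by exact (h₄.reg 9 rfl).trans ((h₂.reg 9 rfl).trans ((h₁.reg 9 rfl).trans h.flag)))
    (by
      rw [Memory.setReg_arr, h₄.arr 14 rfl, Memory.setReg_arr, h₂.arr 14 rfl, h₁.arr 14 rfl]
      exact h.out)).seq ?_
  rintro s₆ h₆ hflag
  have hsweep : s₆.sweep n = s₄.sweep n := by
    simp only [Memory.sweep, h₆.arr 9 rfl, h₆.arr 10 rfl, h₆.arr 11 rfl, h₆.arr 12 rfl,
      h₆.arr 13 rfl, h₆.arr 4 rfl, Memory.setReg_arr]
  have hroot : s₆.reg 3 = r + 1 :=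
    (h₆.reg 3 rfl).trans ((h₄.reg 3 rfl).trans ((h₂.reg 3 rfl).trans ((h₁.reg 3 rfl).trans h.root)))
  have hopt := addRoot_isOptimalCover hCF h.mem hσ (hsweep ▸ hτ) hroot hflag
  -- the output
  refine (hadd.achieves (Q := fun s' => s' = addRoot.exec s₆) rfl).seq ?_
  rintro s₇ h₇ hs₇
  refine ((hassign (.lit 0)).achieves (Q := fun s' => s' = s₇.setReg 2 0) rfl).seq ?_
  rintro s₈ - rfl
  refine (achieves_count (n := n) (s₀ := s₇.setReg 2 0) ?_ ?_ rfl).mono le_rfl ?_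
  · exact (h₇.reg 0 rfl).trans ((h₆.reg 0 rfl).trans ((h₄.reg 0 rfl).trans ((h₂.reg 0 rfl).trans
      ((h₁.reg 0 rfl).trans h.reg_zero))))
  · exact (h₇.reg 1 rfl).trans ((h₆.reg 1 rfl).trans ((h₄.reg 1 rfl).trans ((h₂.reg 1 rfl).trans
      ((h₁.reg 1 rfl).trans h.reg_one))))
  · rintro s₉ h₉ hcard
    rw [h₉.arr 4 rfl, Memory.setReg_arr]
    exact ⟨hs₇ ▸ hopt, hcard⟩

/-- The program computes an optimal cover and its size in linear time. -/
theorem achieves_coverProgram (hconn : G.Connected) (hCF : C ⊆ F) (h : HoldsNetwork G C F s) :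
    Achieves coverProgram s (1000 * (n + G.edgeSet.ncard)) fun s' =>
      IsOptimalCover (allPaths G) C F {v : Fin n | s'.arr 4 v = 1} ∧
        s'.reg 1 = {v : Fin n | s'.arr 4 v = 1}.ncard := by
  obtain ⟨v₀⟩ := hconn.nonempty
  have hn : 1 ≤ n := v₀.pos
  refine ((achieves_init h).seq
    (T' := 2 + (64 * (n + 2 * G.edgeSet.ncard) + 170 * n + 400)) ?_).mono (by lia)
    fun _ _ hs => hs
  rintro s₁ h₁ ⟨hptr, hcand, ⟨h3, hC⟩ | ⟨r, hr, h3⟩⟩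
  · refine ((Achieves.iteFalse (p := customerProgram) (e := .var 3) h3
      (Program.LoopFree.achieves (p := .skip) (Q := fun s' => s' = s₁) trivial rfl)).mono ?_ ?_)
    · simp only [Expr.cost, Program.cost]
      lia
    · rintro s' - hs'
      rw [hs']
      have hempty : {v : Fin n | s₁.arr 4 v = 1} = ∅ := by
        refine Set.eq_empty_iff_forall_notMem.2 fun v hv => ?_
        have h4 : s₁.arr 4 v = 1 := hv
        rw [h₁.arr 4 rfl, h.arr_other 4 v le_rfl] at h4
        exact absurd h4 zero_ne_one
      rw [hempty, Set.ncard_empty, h₁.reg 1 rfl]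
      exact ⟨isOptimalCover_empty hC, h.reg_other 1 one_ne_zero⟩
  · refine Achieves.iteTrue (e := .var 3) (by simp [Expr.eval, h3])
      (achieves_customerProgram (r := r) hconn hCF ?_ ?_)
    · have harr : ∀ a i, 4 ≤ a → (Program.loop (.lt (.var 2) (.var 0)) initBody).writesArr a = false →
          s₁.arr a i = 0 := fun a i ha hw => by rw [h₁.arr a hw, h.arr_other a i ha]
      exact {
        reg_zero := (h₁.reg 0 rfl).trans h.reg_zero
        reg_one := (h₁.reg 1 rfl).trans (h.reg_other 1 (by lia))
        root := h3
        mem := hr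
        flag := (h₁.reg 9 rfl).trans (h.reg_other 9 (by lia))
        isAdjacency := by
          rw [h₁.arr 0 rfl, h₁.arr 1 rfl]
          exact h.isAdjacency
        ptr := by
          rw [h₁.arr 0 rfl]
          exact hptr
        cand := hcand
        chosen := fun i => harr 4 i (by lia) rfl
        pre := fun i => harr 5 i (by lia) rfl
        par := fun i => harr 7 i (by lia) rfl
        done := fun i => harr 11 i (by lia) rfl
        multi := fun i => harr 12 i (by lia) rfl
        nc := fun i => harr 13 i (by lia) rfl
        out := fun i => harr 14 i (by lia) rfl }
    · rw [h₁.arr 0 rfl]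
      exact h.sum_le

end Correctness

end FacilityLocation

theorem mainTheorem4 :
    -- in a 2-connected network, any two facility locations cover all customers
    (∀ (V : Type*) [Finite V] (G : SimpleGraph V) (C F : Set V), C ⊆ F →
      TwoConnected G Set.univ →
      ∀ f₁ ∈ F, ∀ f₂ ∈ F, f₁ ≠ f₂ → IsCover (allPaths G) C {f₁, f₂}) ∧
    -- the 2-connected components of a connected graph form a tree
    (∀ (V : Type*) [Finite V] (G : SimpleGraph V) (S : Set V), (G.induce S).Connected →
      S.Nontrivial → (blockTree G S).IsTree) ∧
    -- the optimal covers that are read off from the pruned network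
    (∀ (V : Type*) [Finite V] (G : SimpleGraph V) (C F : Set V), G.Connected → C ⊆ F →
      (C = ∅ → IsOptimalCover (allPaths G) C F ∅) ∧
      (C.Nonempty →
        (∃ S, IsPruned G C S) ∧
        ∀ S, IsPruned G C S →
          C ⊆ S ∧
          (∀ v, IsLeaf G S v → v ∈ C) ∧
          (∀ B, IsLeafBlock G S B → (internalVertices G S B ∩ C).Nonempty) ∧
          -- first case: the pruned network has no leaves and no leaf components
          ((¬ ∃ v, IsLeaf G S v) → (¬ ∃ B, IsLeafBlock G S B) →
            (∀ v, C = {v} → IsOptimalCover (allPaths G) C F {v}) ∧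
            (∀ u ∈ C, ∀ v ∈ C, u ≠ v → IsOptimalCover (allPaths G) C F {u, v})) ∧
          -- second case: it has a leaf or a leaf component
          (((∃ v, IsLeaf G S v) ∨ ∃ B, IsLeafBlock G S B) →
            ∀ g : Set V → V,
              (∀ B, IsLeafBlock G S B → g B ∈ internalVertices G S B ∩ C) →
              IsOptimalCover (allPaths G) C F
                ({v | IsLeaf G S v} ∪ g '' {B | IsLeafBlock G S B})))) ∧
    -- the optimum of UPDFL is a lower bound for PDFL, whatever the arc weights are
    (∀ (V : Type*) [Finite V] (G : SimpleGraph V) (C F X : Set V), G.Connected → C ⊆ F →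
      IsOptimalCover (allPaths G) C F X →
      ∀ (w : G.Dart → ℝ) (Y : Set V), Y ⊆ F → IsCover (shortestPaths w) C Y →
        X.ncard ≤ Y.ncard) ∧
    -- an optimal cover of UPDFL and its size are computed in linear time
    (∃ (p : Program) (K : ℕ), ∀ (n : ℕ) (G : SimpleGraph (Fin n)) (C F : Set (Fin n)),
      G.Connected → C ⊆ F → ∀ s : Memory, HoldsNetwork G C F s →
      ∃ (s' : Memory) (t : ℕ), Runs p s s' t ∧ t ≤ K * (n + G.edgeSet.ncard) ∧
        IsOptimalCover (allPaths G) C F {v : Fin n | s'.arr 4 v = 1} ∧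
        s'.reg 1 = {v : Fin n | s'.arr 4 v = 1}.ncard) := by
  refine ⟨?_, ?_, ?_, ?_, ?_⟩
  · intro V _ G C F _ hG f₁ _ f₂ _ hne
    exact isCover_pair_of_twoConnected hG hne
  · intro V _ G S hconn hS
    exact blockTree_isTree hconn hS
  · intro V _ G C F hG hCF
    refine ⟨isOptimalCover_empty, fun _ => ⟨exists_isPruned G C, fun S hS => ?_⟩⟩
    obtain ⟨hCS, ρ, hρ⟩ := exists_isHangingRetraction hS.1
    have hleaf : ∀ v, IsLeaf G S v → v ∈ C := fun v hv => by
      by_contra hvC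
      exact hS.2 _ (Or.inl ⟨v, hv, hvC, rfl⟩)
    have hblock : ∀ B, IsLeafBlock G S B → (internalVertices G S B ∩ C).Nonempty := fun B hB => by
      rw [← Set.not_disjoint_iff_nonempty_inter]
      exact fun hdisj => hS.2 _ (Or.inr ⟨B, hB, hdisj, rfl⟩)
    exact ⟨hCS, hleaf, hblock, fun h₁ h₂ => ⟨fun v hv => isOptimalCover_singleton hCF hv,
      fun u hu v hv huv => isOptimalCover_pair hG hCF hCS hρ h₁ h₂ hu hv huv⟩,
      fun hex g hg => isOptimalCover_ends hG hCF hCS hρ hleaf hex g hg⟩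
  · intro V _ G C F X _ _ hX w Y hY hYC
    exact hX.2.2 Y hY (isCover_allPaths_of_shortestPaths hYC)
  · exact ⟨coverProgram, 1000, fun n G C F hG hCF s hs => achieves_coverProgram hG hCF hs⟩
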